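/- For a rational number $r=p/q$ in lowest terms ($q>0$) let $\mathrm{enc}(r)=\lceil\log_2(|p|+1)\rceil+\lceil\log_2(q+1)\rceil$ be its encoding length. Computations are carried out by deterministic programs on a random-access machine whose words are rational numbers, with unit-cost arithmetic $(+,-,\cdot,/)$, rounding down $\lfloor\cdot\rfloor$, comparisons, and (indirectly addressed) memory access; the input consists of $n$, $b$, $\varepsilon$ and the functions $f_1,\dots,f_n$, where one operation evaluates a chosen $f_j$ at an already computed rational point of $[0,1]$. There are one such program (independent of all the data below) and an absolute constant $C>0$ with the following property. Let $n\ge 1$, let $b\in\mathbb{Q}$, let $\varepsilon>0$ be rational, and let $f_1,\dots,f_n$ be real functions that on $[0,1]$ are nonnegative, nondecreasing, convex and rational (rational values at rational points). Let \[Q=[0,1]^n\cap\Big\{x:\ \sum_{j=1}^n f_j(x_j)\le b\Big\},\] and suppose $\mathrm{vol}(Q)>0$. Let $L$ be an input length, that is, a natural number with $\mathrm{enc}(b)\le L$ and $\mathrm{enc}(f_j(x))\le L\cdot\mathrm{enc}(x)$ for all $j$ and all rational $x\in[0,1]$. Let $L_o\ge 1$ be an output length, that is, an integer with $\mathrm{vol}(Q)\ge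 2^{-L_o}$; if $\mathrm{vol}(Q)$ is rational, one may take $L_o=\mathrm{enc}(\mathrm{vol}(Q))$. Put $\bar\varepsilon=\min\{\varepsilon,1\}$. Then the program, which is not given $L$ or $L_o$, halts and outputs a number $Z'$ with \[\mathrm{vol}(Q)\le Z'\le(1+\varepsilon)\,\mathrm{vol}(Q),\] after at most \[C\cdot\frac{n^5\,\big(L_o+\log_2(n/\bar\varepsilon)\big)^3\,\big(L+\log_2 n\big)}{\bar\varepsilon^{\,2}}\] operations, and every number that it computes has encoding length at most $C\cdot L\,\big(\log_2(n/\bar\varepsilon)+L_o\big)$. -/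

import Mathlib

open MeasureTheory Set

/-- The encoding length `⌈log₂ (|p| + 1)⌉ + ⌈log₂ (q + 1)⌉` of the rational number `p / q`
in lowest terms. -/
def encLen (r : ℚ) : ℕ :=
  Nat.clog 2 (r.num.natAbs + 1) + Nat.clog 2 (r.den + 1)

/-- The unit cube truncated by one separable constraint `∑ j, f j (x j) ≤ b`. -/
def truncatedCube {n : ℕ} (f : Fin n → ℝ → ℝ) (b : ℝ) : Set (Fin n → ℝ) :=
  {x | (∀ j, x j ∈ Icc (0 : ℝ) 1) ∧ ∑ j, f j (x j) ≤ b}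

/-- `Lo` is an admissible output length for a positive volume `v`: a positive integer with
`v ≥ 2 ^ (-Lo)`. This makes sense for irrational `v` too, and for rational `v > 0` the encoding
length of `v` is admissible (`isOutputLength_encLen`). -/
def IsOutputLength (v : ℝ) (Lo : ℕ) : Prop :=
  1 ≤ Lo ∧ 1 ≤ v * 2 ^ Lo

theorem isOutputLength_encLen (v : ℚ) (hv : 0 < v) : IsOutputLength (v : ℝ) (encLen v) := by
  have hden : v.den + 1 ≤ 2 ^ Nat.clog 2 (v.den + 1) := Nat.le_pow_clog (by norm_num) _
  have hle : v.den ≤ 2 ^ encLen v :=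
    calc v.den ≤ 2 ^ Nat.clog 2 (v.den + 1) := by omega
      _ ≤ 2 ^ encLen v := Nat.pow_le_pow_right (by norm_num) (Nat.le_add_left _ _)
  refine ⟨?_, ?_⟩
  · have : 0 < Nat.clog 2 (v.den + 1) :=
      Nat.clog_pos (by norm_num) (by have := v.den_pos; omega)
    unfold encLen
    omega
  · have hnum : (1 : ℚ) ≤ v.num := by exact_mod_cast Rat.num_pos.mpr hv
    have hq : (1 : ℚ) ≤ v * 2 ^ encLen v := by
      calc (1 : ℚ) ≤ v.num := hnum
        _ = v * v.den := (Rat.mul_den_eq_num v).symm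
        _ ≤ v * 2 ^ encLen v := by
          apply mul_le_mul_of_nonneg_left _ hv.le
          exact_mod_cast hle
    exact_mod_cast hq

/-! ### Deterministic programs over the rationals

A random-access machine whose words are rational numbers, programmed in a structured language.
It has arithmetic, rounding, comparisons, indirect addressing, and access to the functions
`f j` through evaluation at rational points of `[0, 1]`. -/

/-- A memory state: scalar variables, and arrays indexed by the natural numbers. -/
@[ext]
structure RatState where
  var : ℕ → ℚ
  arr : ℕ → ℕ → ℚ

/-- Write a value into a scalar variable. -/
def RatState.setVar (s : RatState) (x : ℕ) (v : ℚ) : RatState :=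
  { s with var := Function.update s.var x v }

/-- Write a value into a cell of an array. -/
def RatState.setArr (s : RatState) (a k : ℕ) (v : ℚ) : RatState :=
  { s with arr := Function.update s.arr a (Function.update (s.arr a) k v) }

/-- Elementary instructions; all arguments but the literal of `const` are names of variables or
arrays. -/
inductive RatInstr where
  | const (x : ℕ) (q : ℚ)
  | copy (x y : ℕ)
  | add (x y z : ℕ)
  | sub (x y z : ℕ)
  | mul (x y z : ℕ)
  | div (x y z : ℕ)
  | floor (x y : ℕ)
  | query (x i y : ℕ)
  | load (x a i : ℕ)
  | store (a i y : ℕ)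

/-- Tests: comparison of two variables. -/
inductive RatTest where
  | le (x y : ℕ)
  | lt (x y : ℕ)

def RatTest.Holds : RatTest → RatState → Prop
  | .le x y, s => s.var x ≤ s.var y
  | .lt x y, s => s.var x < s.var y

/-- Structured programs. -/
inductive RatProg where
  | skip
  | instr (c : RatInstr)
  | seq (p q : RatProg)
  | branch (g : RatTest) (p q : RatProg)
  | loop (g : RatTest) (p : RatProg)

/-- `RatInstr.Step f B c s s'`: with the functions `f` as input, the instruction `c` leads from
`s` to `s'`, and the number that it writes has encoding length at most `B`. An instruction whose
operands are not legal (a zero divisor, an index that is not a natural number or not that of a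
function, an evaluation point outside `[0, 1]`) does not lead anywhere. -/
inductive RatInstr.Step {n : ℕ} (f : Fin n → ℝ → ℝ) (B : ℕ) :
    RatInstr → RatState → RatState → Prop
  | const (s : RatState) (x : ℕ) (q : ℚ) (hB : encLen q ≤ B) :
      Step f B (.const x q) s (s.setVar x q)
  | copy (s : RatState) (x y : ℕ) (hB : encLen (s.var y) ≤ B) :
      Step f B (.copy x y) s (s.setVar x (s.var y))
  | add (s : RatState) (x y z : ℕ) (hB : encLen (s.var y + s.var z) ≤ B) :
      Step f B (.add x y z) s (s.setVar x (s.var y + s.var z))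
  | sub (s : RatState) (x y z : ℕ) (hB : encLen (s.var y - s.var z) ≤ B) :
      Step f B (.sub x y z) s (s.setVar x (s.var y - s.var z))
  | mul (s : RatState) (x y z : ℕ) (hB : encLen (s.var y * s.var z) ≤ B) :
      Step f B (.mul x y z) s (s.setVar x (s.var y * s.var z))
  | div (s : RatState) (x y z : ℕ) (hz : s.var z ≠ 0) (hB : encLen (s.var y / s.var z) ≤ B) :
      Step f B (.div x y z) s (s.setVar x (s.var y / s.var z))
  | floor (s : RatState) (x y : ℕ) (hB : encLen (⌊s.var y⌋ : ℚ) ≤ B) :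
      Step f B (.floor x y) s (s.setVar x (⌊s.var y⌋ : ℚ))
  | query (s : RatState) (x i y : ℕ) (j : Fin n) (r : ℚ) (hj : s.var i = ((j : ℕ) : ℚ))
      (hy : s.var y ∈ Icc (0 : ℚ) 1) (hr : f j (s.var y : ℝ) = (r : ℝ)) (hB : encLen r ≤ B) :
      Step f B (.query x i y) s (s.setVar x r)
  | load (s : RatState) (x a i k : ℕ) (hk : s.var i = (k : ℚ)) (hB : encLen (s.arr a k) ≤ B) :
      Step f B (.load x a i) s (s.setVar x (s.arr a k))
  | store (s : RatState) (a i y k : ℕ) (hk : s.var i = (k : ℚ)) (hB : encLen (s.var y) ≤ B) :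
      Step f B (.store a i y) s (s.setArr a k (s.var y))

/-- `RatProg.Exec f B p s s' t`: with the functions `f` as input, the program `p` started in `s`
terminates in `s'` after exactly `t` elementary operations (every instruction and every test
counts as one), and every number written on the way has encoding length at most `B`. -/
inductive RatProg.Exec {n : ℕ} (f : Fin n → ℝ → ℝ) (B : ℕ) :
    RatProg → RatState → RatState → ℕ → Prop
  | skip (s : RatState) : Exec f B .skip s s 0
  | instr (c : RatInstr) (s s' : RatState) (h : c.Step f B s s') : Exec f B (.instr c) s s' 1
  | seq (p q : RatProg) (s s₁ s₂ : RatState) (t₁ t₂ : ℕ)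
      (hp : Exec f B p s s₁ t₁) (hq : Exec f B q s₁ s₂ t₂) :
      Exec f B (.seq p q) s s₂ (t₁ + t₂)
  | branch_true (g : RatTest) (p q : RatProg) (s s' : RatState) (t : ℕ)
      (hg : g.Holds s) (hp : Exec f B p s s' t) : Exec f B (.branch g p q) s s' (t + 1)
  | branch_false (g : RatTest) (p q : RatProg) (s s' : RatState) (t : ℕ)
      (hg : ¬ g.Holds s) (hq : Exec f B q s s' t) : Exec f B (.branch g p q) s s' (t + 1)
  | loop_true (g : RatTest) (p : RatProg) (s s₁ s₂ : RatState) (t₁ t₂ : ℕ)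
      (hg : g.Holds s) (hp : Exec f B p s s₁ t₁) (hl : Exec f B (.loop g p) s₁ s₂ t₂) :
      Exec f B (.loop g p) s s₂ (t₁ + t₂ + 1)
  | loop_false (g : RatTest) (p : RatProg) (s : RatState) (hg : ¬ g.Holds s) :
      Exec f B (.loop g p) s s 1

/-- The initial state: the variables `0`, `1`, `2` hold `n`, `b`, `ε`, and everything else is
zero. -/
def RatState.init (n : ℕ) (b ε : ℚ) : RatState where
  var := fun x => if x = 0 then (n : ℚ) else if x = 1 then b else if x = 2 then ε else 0
  arr := fun _ _ => 0

/-- The output is read off from the variable `0`. -/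
def RatState.output (s : RatState) : ℚ := s.var 0

/-- Instructions are deterministic. -/
theorem RatInstr.Step.unique {n : ℕ} {f : Fin n → ℝ → ℝ} {B B' : ℕ} {c : RatInstr}
    {s s₁ s₂ : RatState} (h₁ : c.Step f B s s₁) (h₂ : c.Step f B' s s₂) : s₁ = s₂ := by
  cases h₁ with
  | query _ x i y j r hj hy hr hB =>
    cases h₂ with
    | query _ _ _ _ j' r' hj' hy' hr' hB' =>
      have e : j = j' := by
        apply Fin.ext
        exact_mod_cast hj.symm.trans hj'
      subst e
      have e' : r = r' := by exact_mod_cast hr.symm.trans hr'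
      rw [e']
  | load _ x a i k hk hB =>
    cases h₂ with
    | load _ _ _ _ k' hk' hB' =>
      have e : k = k' := by exact_mod_cast hk.symm.trans hk'
      rw [e]
  | store _ a i y k hk hB =>
    cases h₂ with
    | store _ _ _ _ k' hk' hB' =>
      have e : k = k' := by exact_mod_cast hk.symm.trans hk'
      rw [e]
  | _ => cases h₂; rfl

/-- Programs are deterministic: the final state and the number of operations are determined by the
program and its input. -/
theorem RatProg.Exec.unique {n : ℕ} {f : Fin n → ℝ → ℝ} {B B' : ℕ} {p : RatProg}
    {s s₁ s₂ : RatState} {t₁ t₂ : ℕ} (h₁ : p.Exec f B s s₁ t₁) (h₂ : p.Exec f B' s s₂ t₂) :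
    s₁ = s₂ ∧ t₁ = t₂ := by
  induction h₁ generalizing s₂ t₂ with
  | skip s => cases h₂; exact ⟨rfl, rfl⟩
  | instr c s s' h => cases h₂ with | instr _ _ _ h' => exact ⟨h.unique h', rfl⟩
  | seq p q s s₁ s₂ t₁ t₂ _ _ ihp ihq =>
    cases h₂ with
    | seq _ _ _ _ _ _ _ hp' hq' =>
      obtain ⟨rfl, rfl⟩ := ihp hp'
      obtain ⟨rfl, rfl⟩ := ihq hq'
      exact ⟨rfl, rfl⟩
  | branch_true g p q s s' t hg _ ih =>
    cases h₂ with
    | branch_true _ _ _ _ _ _ _ h' => obtain ⟨rfl, rfl⟩ := ih h'; exact ⟨rfl, rfl⟩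
    | branch_false _ _ _ _ _ _ hg' _ => exact absurd hg hg'
  | branch_false g p q s s' t hg _ ih =>
    cases h₂ with
    | branch_true _ _ _ _ _ _ hg' _ => exact absurd hg' hg
    | branch_false _ _ _ _ _ _ _ h' => obtain ⟨rfl, rfl⟩ := ih h'; exact ⟨rfl, rfl⟩
  | loop_true g p s s₁ s₂ t₁ t₂ hg _ _ ihp ihl =>
    cases h₂ with
    | loop_true _ _ _ _ _ _ _ _ hp' hl' =>
      obtain ⟨rfl, rfl⟩ := ihp hp'
      obtain ⟨rfl, rfl⟩ := ihl hl'
      exact ⟨rfl, rfl⟩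
    | loop_false _ _ _ hg' => exact absurd hg hg'
  | loop_false g p s hg =>
    cases h₂ with
    | loop_true _ _ _ _ _ _ _ hg' _ _ => exact absurd hg' hg
    | loop_false _ _ _ _ => exact ⟨rfl, rfl⟩

/-! ### A program logic with time bounds -/

/-! For uniform `x` in the cube, the volume is the distribution function of `∑ j, f j (x j)` at `b`,
and this function arises from one convolution per coordinate. Three roundings, all upwards in
effect, make it computable. The interval `[0, 1]` is cut by a nearly geometric grid with first
positive point `1 / P`, `P = 2 ^ K`, and ratio at most `1 + 1 / D`, `D = 2 ^ d`, hence with `O(D K)`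
cells. The function values at the lower ends of the cells are multiplied by `E = D ^ 2 / θ` and
rounded down to integers, where `θ ≤ 1` is a positive lower bound for the positive increments `f j
(G l) - f j 0` on the grid. After each stage the distribution function is rounded up to values of
the same grid, so that it is a step function given by integer thresholds. These are found by
bisection, and the convolution is evaluated by a sweep with two pointers, linear in the number of
cells.

Without the third rounding the recursion adds up the boxes whose rounded values at the lower corner
fit under the bound (`exactSum_eq`). These boxes cover the body (`volume_le_exactSum`). Conversely,
a box that avoids the first cell in every coordinate lies in the body dilated by `(1 + 1 / D) ^ 2`:
one factor replaces upper ends by lower ends, and the other absorbs the rounding of the values, by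
convexity and the choice of `θ`. The other boxes lie in `n` slabs of width `1 / P`
(`exactSum_le_volume`). The third rounding costs a factor `1 + 1 / D` and an additive `1 / P` per
stage (`IsGrid.exactSum_le`). Altogether `V ≤ Z ≤ (1 + 1 / D) ^ (3 n) (V + 2 n / P)`
(`IsRoundResult.bounds`).

The program fixes `D` with `24 n / D ≤ min ε 1` and doubles `K` until `2 n D ≤ Z P`. This test needs
no knowledge of `V`, and it turns the additive error into a relative one (`le_of_certificate`).
Since `Z ≥ V ≥ 2 ^ (-Lo)`, it succeeds once `K ≥ Lo + 2 d`, so the number `Lo` enters the analysis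
only. A round costs `O(n S ^ 2 M)` operations for `S` cells and `M`-bit data, and the costs of the
rounds grow geometrically (`runs_rounds`). All numbers stay short because distribution values are
multiples of a fixed fraction in `[0, 1]`. -/

namespace RatProg

/-- Sequential composition of a list of programs. -/
def block : List RatProg → RatProg
  | [] => .skip
  | p :: ps => .seq p (block ps)

/-- `p.Runs f B s T Q`: started in `s`, the program `p` halts within `T` operations, in a state
that satisfies `Q`, and every number written on the way has encoding length at most `B`. -/
def Runs {n : ℕ} (f : Fin n → ℝ → ℝ) (B : ℕ) (p : RatProg) (s : RatState) (T : ℕ)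
    (Q : RatState → Prop) : Prop :=
  ∃ s' t, p.Exec f B s s' t ∧ t ≤ T ∧ Q s'

end RatProg

/-- The scalar variables that an instruction may write. -/
def RatInstr.writesVar : RatInstr → ℕ → Bool
  | .const x _, z => x == z
  | .copy x _, z => x == z
  | .add x _ _, z => x == z
  | .sub x _ _, z => x == z
  | .mul x _ _, z => x == z
  | .div x _ _, z => x == z
  | .floor x _, z => x == z
  | .query x _ _, z => x == z
  | .load x _ _, z => x == z
  | .store _ _ _, _ => false

/-- The arrays that an instruction may write. -/
def RatInstr.writesArr : RatInstr → ℕ → Bool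
  | .store a _ _, z => a == z
  | _, _ => false

namespace RatProg

/-- The scalar variables that a program may write. -/
def writesVar : RatProg → ℕ → Bool
  | skip, _ => false
  | instr c, z => c.writesVar z
  | seq p q, z => p.writesVar z || q.writesVar z
  | branch _ p q, z => p.writesVar z || q.writesVar z
  | loop _ p, z => p.writesVar z

/-- The arrays that a program may write. -/
def writesArr : RatProg → ℕ → Bool
  | skip, _ => false
  | instr c, z => c.writesArr z
  | seq p q, z => p.writesArr z || q.writesArr z
  | branch _ p q, z => p.writesArr z || q.writesArr z
  | loop _ p, z => p.writesArr z

/-- The states `s` and `s'` agree on everything that `p` does not write. -/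
def Frame (p : RatProg) (s s' : RatState) : Prop :=
  (∀ x, p.writesVar x = false → s'.var x = s.var x) ∧
    ∀ a, p.writesArr a = false → s'.arr a = s.arr a

theorem Frame.refl (p : RatProg) (s : RatState) : p.Frame s s :=
  ⟨fun _ _ => rfl, fun _ _ => rfl⟩

theorem Frame.trans {p : RatProg} {s s₁ s₂ : RatState} (h₁ : p.Frame s s₁)
    (h₂ : p.Frame s₁ s₂) : p.Frame s s₂ :=
  ⟨fun x hx => (h₂.1 x hx).trans (h₁.1 x hx), fun a ha => (h₂.2 a ha).trans (h₁.2 a ha)⟩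

end RatProg

@[simp] theorem RatState.setVar_var (s : RatState) (x : ℕ) (v : ℚ) (y : ℕ) :
    (s.setVar x v).var y = if y = x then v else s.var y := by
  simp [RatState.setVar, Function.update_apply]

@[simp] theorem RatState.setVar_arr (s : RatState) (x : ℕ) (v : ℚ) :
    (s.setVar x v).arr = s.arr := rfl

@[simp] theorem RatState.setArr_var (s : RatState) (a k : ℕ) (v : ℚ) :
    (s.setArr a k v).var = s.var := rfl

@[simp] theorem RatState.setArr_arr (s : RatState) (a k : ℕ) (v : ℚ) (a' k' : ℕ) :
    (s.setArr a k v).arr a' k' = if a' = a ∧ k' = k then v else s.arr a' k' := by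
  by_cases h : a' = a
  · subst h; simp [RatState.setArr, Function.update_apply]
  · simp [RatState.setArr, h]

theorem RatInstr.Step.frame {n : ℕ} {f : Fin n → ℝ → ℝ} {B : ℕ} {c : RatInstr}
    {s s' : RatState} (h : c.Step f B s s') : (RatProg.instr c).Frame s s' := by
  refine ⟨fun z hz => ?_, fun a ha => ?_⟩
  · cases h <;> simp_all [RatProg.writesVar, RatInstr.writesVar] <;>
      (intro h; exact absurd h.symm hz)
  · cases h <;> simp_all [RatProg.writesArr, RatInstr.writesArr, RatState.setArr]
    rw [Function.update_of_ne (Ne.symm ha)]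

namespace RatProg

variable {n : ℕ} {f : Fin n → ℝ → ℝ} {B : ℕ} {p q : RatProg} {ps : List RatProg}
  {s s' : RatState} {t T T₁ T₂ : ℕ} {Q R : RatState → Prop} {g : RatTest}

/-- The written variables are computed from the program text, so for a concrete program every fact
about an untouched variable or array follows from this lemma and `rfl`. -/
theorem Exec.frame (h : p.Exec f B s s' t) : p.Frame s s' := by
  induction h with
  | skip s => exact Frame.refl _ _
  | instr c s s' h => exact h.frame
  | seq p q s s₁ s₂ t₁ t₂ _ _ ih₁ ih₂ =>
    refine ⟨fun x hx => ?_, fun x hx => ?_⟩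
    · simp only [writesVar, Bool.or_eq_false_iff] at hx
      exact (ih₂.1 x hx.2).trans (ih₁.1 x hx.1)
    · simp only [writesArr, Bool.or_eq_false_iff] at hx
      exact (ih₂.2 x hx.2).trans (ih₁.2 x hx.1)
  | branch_true g p q s s' t _ _ ih =>
    refine ⟨fun x hx => ?_, fun x hx => ?_⟩
    · simp only [writesVar, Bool.or_eq_false_iff] at hx
      exact ih.1 x hx.1
    · simp only [writesArr, Bool.or_eq_false_iff] at hx
      exact ih.2 x hx.1
  | branch_false g p q s s' t _ _ ih =>
    refine ⟨fun x hx => ?_, fun x hx => ?_⟩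
    · simp only [writesVar, Bool.or_eq_false_iff] at hx
      exact ih.1 x hx.2
    · simp only [writesArr, Bool.or_eq_false_iff] at hx
      exact ih.2 x hx.2
  | loop_true g p s s₁ s₂ t₁ t₂ _ _ _ ih₁ ih₂ => exact Frame.trans ih₁ ih₂
  | loop_false g p s _ => exact Frame.refl _ _

namespace Runs

theorem weaken (h : p.Runs f B s T₁ R) (hT : T₁ ≤ T) (hQ : ∀ s', p.Frame s s' → R s' → Q s') :
    p.Runs f B s T Q := by
  obtain ⟨s', t, he, ht, hR⟩ := h
  exact ⟨s', t, he, ht.trans hT, hQ s' he.frame hR⟩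

theorem time (h : p.Runs f B s T₁ Q) (hT : T₁ ≤ T) : p.Runs f B s T Q :=
  h.weaken hT fun _ _ h => h

theorem nil (h : Q s) : (block []).Runs f B s T Q := ⟨s, 0, .skip s, Nat.zero_le _, h⟩

theorem cons (T₁ T₂ : ℕ) (h : p.Runs f B s T₁ R)
    (k : ∀ s', p.Frame s s' → R s' → (block ps).Runs f B s' T₂ Q) (hT : T₁ + T₂ ≤ T) :
    (block (p :: ps)).Runs f B s T Q := by
  obtain ⟨s₁, t₁, h₁, ht₁, hR⟩ := h
  obtain ⟨s₂, t₂, h₂, ht₂, hQ⟩ := k s₁ h₁.frame hR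
  exact ⟨s₂, t₁ + t₂, .seq _ _ _ _ _ _ _ h₁ h₂, by omega, hQ⟩

theorem instr_cons {c : RatInstr} (h : c.Step f B s s')
    (k : (block ps).Runs f B s' T Q) : (block (.instr c :: ps)).Runs f B s (T + 1) Q :=
  cons (R := fun s'' => s'' = s') 1 T ⟨s', 1, .instr _ _ _ h, le_rfl, rfl⟩
    (fun _ _ h => h ▸ k) (by omega)

theorem const {x : ℕ} {v : ℚ} (hB : encLen v ≤ B)
    (k : (block ps).Runs f B (s.setVar x v) T Q) :
    (block (.instr (.const x v) :: ps)).Runs f B s (T + 1) Q :=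
  instr_cons (.const s x v hB) k

theorem copy {x y : ℕ} (v : ℚ) (hv : s.var y = v) (hB : encLen v ≤ B)
    (k : (block ps).Runs f B (s.setVar x v) T Q) :
    (block (.instr (.copy x y) :: ps)).Runs f B s (T + 1) Q := by
  subst hv; exact instr_cons (.copy s x y hB) k

theorem add {x y z : ℕ} (v : ℚ) (hv : s.var y + s.var z = v) (hB : encLen v ≤ B)
    (k : (block ps).Runs f B (s.setVar x v) T Q) :
    (block (.instr (.add x y z) :: ps)).Runs f B s (T + 1) Q := by
  subst hv; exact instr_cons (.add s x y z hB) k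

theorem sub {x y z : ℕ} (v : ℚ) (hv : s.var y - s.var z = v) (hB : encLen v ≤ B)
    (k : (block ps).Runs f B (s.setVar x v) T Q) :
    (block (.instr (.sub x y z) :: ps)).Runs f B s (T + 1) Q := by
  subst hv; exact instr_cons (.sub s x y z hB) k

theorem mul {x y z : ℕ} (v : ℚ) (hv : s.var y * s.var z = v) (hB : encLen v ≤ B)
    (k : (block ps).Runs f B (s.setVar x v) T Q) :
    (block (.instr (.mul x y z) :: ps)).Runs f B s (T + 1) Q := by
  subst hv; exact instr_cons (.mul s x y z hB) k

theorem div {x y z : ℕ} (v : ℚ) (hz : s.var z ≠ 0) (hv : s.var y / s.var z = v)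
    (hB : encLen v ≤ B) (k : (block ps).Runs f B (s.setVar x v) T Q) :
    (block (.instr (.div x y z) :: ps)).Runs f B s (T + 1) Q := by
  subst hv; exact instr_cons (.div s x y z hz hB) k

theorem floor {x y : ℕ} (v : ℚ) (hv : (⌊s.var y⌋ : ℚ) = v) (hB : encLen v ≤ B)
    (k : (block ps).Runs f B (s.setVar x v) T Q) :
    (block (.instr (.floor x y) :: ps)).Runs f B s (T + 1) Q := by
  subst hv; exact instr_cons (.floor s x y hB) k

theorem query {x i y : ℕ} (v : ℚ) (j : Fin n) (r : ℚ) (hj : s.var i = ((j : ℕ) : ℚ))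
    (hr : s.var y = r) (hmem : r ∈ Icc (0 : ℚ) 1) (hv : f j (r : ℝ) = (v : ℝ))
    (hB : encLen v ≤ B) (k : (block ps).Runs f B (s.setVar x v) T Q) :
    (block (.instr (.query x i y) :: ps)).Runs f B s (T + 1) Q := by
  subst hr; exact instr_cons (.query s x i y j v hj hmem hv hB) k

theorem load {x a i : ℕ} (k : ℕ) (v : ℚ) (hk : s.var i = (k : ℚ)) (hv : s.arr a k = v)
    (hB : encLen v ≤ B) (h : (block ps).Runs f B (s.setVar x v) T Q) :
    (block (.instr (.load x a i) :: ps)).Runs f B s (T + 1) Q := by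
  subst hv; exact instr_cons (.load s x a i k hk hB) h

theorem store {a i y : ℕ} (k : ℕ) (v : ℚ) (hk : s.var i = (k : ℚ)) (hv : s.var y = v)
    (hB : encLen v ≤ B) (h : (block ps).Runs f B (s.setArr a k v) T Q) :
    (block (.instr (.store a i y) :: ps)).Runs f B s (T + 1) Q := by
  subst hv; exact instr_cons (.store s a i y k hk hB) h

theorem branch (h₁ : g.Holds s → p.Runs f B s T Q) (h₂ : ¬ g.Holds s → q.Runs f B s T Q) :
    (RatProg.branch g p q).Runs f B s (T + 1) Q := by
  by_cases hg : g.Holds s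
  · obtain ⟨s', t, he, ht, hQ⟩ := h₁ hg
    exact ⟨s', t + 1, .branch_true _ _ _ _ _ _ hg he, by omega, hQ⟩
  · obtain ⟨s', t, he, ht, hQ⟩ := h₂ hg
    exact ⟨s', t + 1, .branch_false _ _ _ _ _ _ hg he, by omega, hQ⟩

theorem loop_true (hg : g.Holds s) (h : p.Runs f B s T₁ R)
    (k : ∀ s', p.Frame s s' → R s' → (RatProg.loop g p).Runs f B s' T₂ Q) :
    (RatProg.loop g p).Runs f B s (T₁ + T₂ + 1) Q := by
  obtain ⟨s₁, t₁, h₁, ht₁, hR⟩ := h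
  obtain ⟨s₂, t₂, h₂, ht₂, hQ⟩ := k s₁ h₁.frame hR
  exact ⟨s₂, t₁ + t₂ + 1, .loop_true _ _ _ _ _ _ _ hg h₁ h₂, by omega, hQ⟩

theorem loop_false (hg : ¬ g.Holds s) (h : Q s) : (RatProg.loop g p).Runs f B s 1 Q :=
  ⟨s, 1, .loop_false _ _ _ hg, le_rfl, h⟩

/-- A loop whose invariant is indexed by a decreasing natural number. -/
theorem loop_measure {I : ℕ → RatState → Prop} {c : ℕ} (s₀ : RatState)
    (step : ∀ k s, p.Frame s₀ s → I k s → g.Holds s → p.Runs f B s c (fun s' => ∃ k' < k, I k' s'))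
    (k : ℕ) (h : I k s₀) :
    (RatProg.loop g p).Runs f B s₀ (k * (c + 1) + 1) (fun s => (∃ k, I k s) ∧ ¬ g.Holds s) := by
  suffices H : ∀ k s, p.Frame s₀ s → I k s →
      (RatProg.loop g p).Runs f B s (k * (c + 1) + 1) (fun s => (∃ k, I k s) ∧ ¬ g.Holds s) from
    H k s₀ (Frame.refl _ _) h
  intro k
  induction k using Nat.strong_induction_on with
  | _ k ih =>
    intro s hf hI
    by_cases hg : g.Holds s
    · have hs := step k s hf hI hg
      -- A true guard excludes `k = 0`, because the body would have to reach a smaller index.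
      have hk : 0 < k := by
        obtain ⟨_, _, _, _, k', hk', _⟩ := hs
        omega
      refine (loop_true (T₂ := (k - 1) * (c + 1) + 1) hg hs ?_).time ?_
      · rintro s' hf' ⟨k', hk', hI'⟩
        refine (ih k' hk' s' (hf.trans hf') hI').time ?_
        gcongr
        omega
      · obtain ⟨m, rfl⟩ : ∃ m, k = m + 1 := ⟨k - 1, by omega⟩
        simp only [Nat.add_sub_cancel]
        ring_nf
        omega
    · exact (loop_false hg ⟨⟨k, hI⟩, hg⟩).time (by omega)

/-- A loop that is passed through exactly `N` times. -/
theorem loop_count {I : ℕ → RatState → Prop} {c : ℕ} (s₀ : RatState) (N : ℕ)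
    (guard : ∀ k ≤ N, ∀ s, p.Frame s₀ s → I k s → (g.Holds s ↔ k < N))
    (step : ∀ k < N, ∀ s, p.Frame s₀ s → I k s → p.Runs f B s c (I (k + 1)))
    (h : I 0 s₀) :
    (RatProg.loop g p).Runs f B s₀ (N * (c + 1) + 1) (I N) := by
  have := loop_measure (f := f) (B := B) (p := p) (g := g) (c := c)
    (I := fun m s => ∃ k, k ≤ N ∧ m = N - k ∧ I k s) s₀ ?_ N ⟨0, by omega, by omega, h⟩
  · refine this.weaken le_rfl ?_
    rintro s hf ⟨⟨m, k, hk, rfl, hI⟩, hg⟩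
    have : ¬ k < N := fun h => hg ((guard k hk s hf hI).2 h)
    obtain rfl : k = N := by omega
    exact hI
  · rintro m s hf ⟨k, hk, rfl, hI⟩ hg
    have hk' := (guard k hk s hf hI).1 hg
    refine (step k hk' s hf hI).weaken le_rfl ?_
    intro s' _ h'
    exact ⟨N - (k + 1), by omega, k + 1, hk', rfl, h'⟩

end Runs

end RatProg

/-! ### Encoding lengths -/

/-- Numerator and denominator are at most `2 ^ M` in absolute value. -/
def RatBits (M : ℕ) (r : ℚ) : Prop := r.num.natAbs ≤ 2 ^ M ∧ r.den ≤ 2 ^ M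

namespace RatBits

variable {M N : ℕ} {r t : ℚ}

theorem encLen_le (h : RatBits M r) : encLen r ≤ 2 * (M + 1) := by
  have key : ∀ x, x ≤ 2 ^ M → Nat.clog 2 (x + 1) ≤ M + 1 := fun x hx => by
    apply Nat.clog_le_of_le_pow
    have := Nat.one_le_two_pow (n := M)
    rw [pow_succ]; omega
  have h₁ := key _ h.1
  have h₂ := key _ h.2
  unfold encLen; omega

theorem of_encLen (h : encLen r ≤ M) : RatBits M r := by
  have key : ∀ x, Nat.clog 2 (x + 1) ≤ M → x ≤ 2 ^ M := fun x hx => by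
    have := (Nat.clog_le_iff_le_pow (by norm_num)).1 hx
    omega
  unfold encLen at h
  exact ⟨key _ (by omega), key _ (by omega)⟩

theorem mono (h : RatBits M r) (hMN : M ≤ N) : RatBits N r :=
  have := Nat.pow_le_pow_right (n := 2) (by norm_num) hMN
  ⟨h.1.trans this, h.2.trans this⟩

/-- Reduction to lowest terms only divides, so any representation as a fraction bounds the bits. All
closure properties below use this. -/
theorem of_div {a : ℤ} {c : ℕ} (hc : 0 < c) (ha : a.natAbs ≤ 2 ^ M) (hcM : c ≤ 2 ^ M)
    (hr : r = a / c) : RatBits M r := by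
  have hr' : r = (a : ℚ) / ((c : ℤ) : ℚ) := by rw [hr]; norm_cast
  constructor
  · rcases eq_or_ne a 0 with rfl | h0
    · simp [hr']
    · have := Rat.num_dvd a (b := (c : ℤ)) (by positivity)
      rw [Rat.divInt_eq_div, ← hr'] at this
      exact (Nat.le_of_dvd (by omega) (Int.natAbs_dvd_natAbs.2 this)).trans ha
  · have := Rat.den_dvd a (c : ℤ)
    rw [Rat.divInt_eq_div, ← hr'] at this
    exact (Nat.le_of_dvd hc (by exact_mod_cast this)).trans hcM

theorem natCast {k : ℕ} (h : k ≤ 2 ^ M) : RatBits M (k : ℚ) := by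
  refine ⟨by simpa using h, by simpa using Nat.one_le_two_pow⟩

theorem mul (hr : RatBits M r) (ht : RatBits N t) : RatBits (M + N) (r * t) := by
  refine of_div (a := r.num * t.num) (c := r.den * t.den)
    (Nat.mul_pos r.den_pos t.den_pos) ?_ ?_ ?_
  · rw [Int.natAbs_mul, pow_add]; exact Nat.mul_le_mul hr.1 ht.1
  · rw [pow_add]; exact Nat.mul_le_mul hr.2 ht.2
  · conv_lhs => rw [← Rat.num_div_den r, ← Rat.num_div_den t]
    push_cast
    rw [div_mul_div_comm]

theorem add (hr : RatBits M r) (ht : RatBits N t) : RatBits (M + N + 1) (r + t) := by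
  have hd : r.den * t.den ≤ 2 ^ (M + N) := by
    rw [pow_add]; exact Nat.mul_le_mul hr.2 ht.2
  refine of_div (a := r.num * t.den + r.den * t.num) (c := r.den * t.den)
    (Nat.mul_pos r.den_pos t.den_pos) ?_ ?_ ?_
  · refine (Int.natAbs_add_le _ _).trans ?_
    rw [Int.natAbs_mul, Int.natAbs_mul, pow_succ, pow_add, mul_two]
    simp only [Int.natAbs_natCast]
    exact Nat.add_le_add (Nat.mul_le_mul hr.1 ht.2) (Nat.mul_le_mul hr.2 ht.1)
  · exact hd.trans (Nat.pow_le_pow_right (by norm_num) (by omega))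
  · conv_lhs => rw [← Rat.num_div_den r, ← Rat.num_div_den t]
    push_cast
    rw [div_add_div _ _ (by simp) (by simp)]

theorem neg (hr : RatBits M r) : RatBits M (-r) := by
  simpa [RatBits] using hr

theorem sub (hr : RatBits M r) (ht : RatBits N t) : RatBits (M + N + 1) (r - t) := by
  rw [sub_eq_add_neg]; exact hr.add ht.neg

theorem inv (hr : RatBits M r) : RatBits M r⁻¹ := by
  rcases eq_or_ne r 0 with rfl | h0
  · simpa using hr
  · have hn : 0 < r.num.natAbs := by simpa [Int.natAbs_pos] using h0
    rcases lt_or_gt_of_ne h0 with h | h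
    · refine of_div (a := -r.den) (c := r.num.natAbs) hn (by simpa using hr.2) hr.1 ?_
      have e : ((r.num.natAbs : ℕ) : ℚ) = -r.num := by
        rw [Nat.cast_natAbs, Int.cast_abs, abs_of_neg (by exact_mod_cast Rat.num_neg.2 h)]
      rw [e]
      conv_lhs => rw [← Rat.num_div_den r]
      push_cast
      rw [neg_div_neg_eq, inv_div]
    · refine of_div (a := r.den) (c := r.num.natAbs) hn (by simpa using hr.2) hr.1 ?_
      have e : ((r.num.natAbs : ℕ) : ℚ) = r.num := by
        rw [Nat.cast_natAbs, Int.cast_abs, abs_of_pos (by exact_mod_cast Rat.num_pos.2 h)]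
      rw [e]
      conv_lhs => rw [← Rat.num_div_den r]
      push_cast
      rw [inv_div]

theorem div (hr : RatBits M r) (ht : RatBits N t) : RatBits (M + N) (r / t) := by
  rw [div_eq_mul_inv]; exact hr.mul ht.inv

theorem abs_le (hr : RatBits M r) : |r| ≤ 2 ^ M := by
  have h1 : |r| ≤ (r.num.natAbs : ℚ) := by
    conv_lhs => rw [← Rat.num_div_den r]
    rw [abs_div, Nat.cast_natAbs]
    push_cast
    refine div_le_self (abs_nonneg _) ?_
    rw [Nat.abs_cast]
    exact_mod_cast r.den_pos
  exact h1.trans (by exact_mod_cast hr.1)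

end RatBits

/-! ### The discretized recursion -/

/-- The step function with jump `G (i + 1) - G i` at `T i`. -/
def stepFun (G : ℕ → ℚ) (S : ℕ) (T : ℕ → ℕ) (y : ℕ) : ℚ :=
  ∑ i ∈ Finset.range S, if T i ≤ y then G (i + 1) - G i else 0

/-- The first `m` terms of the discretized convolution at `y` of the step functions with jumps at
`T i` and at `F l`. -/
def convSum (G : ℕ → ℚ) (S : ℕ) (F T : ℕ → ℕ) (y m : ℕ) : ℚ :=
  ∑ i ∈ Finset.range m, (G (i + 1) - G i) * stepFun G S (fun l => F l + T i) y

/-- The cut-off makes the search total, even when the convolution never exceeds `G i`. It is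
harmless, since only arguments below `Y` are evaluated later. -/
theorem exists_threshold (G : ℕ → ℚ) (S : ℕ) (F T : ℕ → ℕ) (Y i : ℕ) :
    ∃ y, Y ≤ y ∨ G i < convSum G S F T y S := ⟨Y, Or.inl le_rfl⟩

open Classical in
/-- The least argument, cut off at `Y`, at which the convolution exceeds `G i`. -/
noncomputable def threshold (G : ℕ → ℚ) (S : ℕ) (F T : ℕ → ℕ) (Y i : ℕ) : ℕ :=
  Nat.find (exists_threshold G S F T Y i)

/-- `G 0 = 0 ≤ G 1 ≤ ⋯ ≤ G S = 1` are integer multiples of `1 / N`. -/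
structure IsGrid (G : ℕ → ℚ) (S N : ℕ) : Prop where
  pos : 0 < N
  zero : G 0 = 0
  one : G S = 1
  mono : Monotone G
  le_one : ∀ i, G i ≤ 1
  mult : ∀ i, ∃ k : ℕ, G i = k / N

namespace IsGrid

variable {G : ℕ → ℚ} {S N : ℕ} {T F : ℕ → ℕ} {Y M : ℕ}

theorem nonneg (hG : IsGrid G S N) (i : ℕ) : 0 ≤ G i := hG.zero ▸ hG.mono (Nat.zero_le i)

theorem jump_nonneg (hG : IsGrid G S N) (i : ℕ) : 0 ≤ G (i + 1) - G i :=
  sub_nonneg.2 (hG.mono (Nat.le_succ i))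

theorem sum_jump (G : ℕ → ℚ) (m : ℕ) :
    ∑ i ∈ Finset.range m, (G (i + 1) - G i) = G m - G 0 := Finset.sum_range_sub G m

theorem stepFun_nonneg (hG : IsGrid G S N) (T : ℕ → ℕ) (y : ℕ) : 0 ≤ stepFun G S T y :=
  Finset.sum_nonneg fun i _ => by split_ifs <;> [exact hG.jump_nonneg i; rfl]

theorem stepFun_le_one (hG : IsGrid G S N) (T : ℕ → ℕ) (y : ℕ) : stepFun G S T y ≤ 1 := by
  calc stepFun G S T y ≤ ∑ i ∈ Finset.range S, (G (i + 1) - G i) :=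
        Finset.sum_le_sum fun i _ => by split_ifs <;> [rfl; exact hG.jump_nonneg i]
    _ = 1 := by rw [sum_jump, hG.one, hG.zero, sub_zero]

theorem stepFun_mono (hG : IsGrid G S N) (T : ℕ → ℕ) : Monotone (stepFun G S T) := by
  intro y y' h
  refine Finset.sum_le_sum fun i _ => ?_
  split_ifs with h₁ h₂ h₂
  · rfl
  · omega
  · exact hG.jump_nonneg i
  · rfl

theorem convSum_nonneg (hG : IsGrid G S N) (y m : ℕ) : 0 ≤ convSum G S F T y m :=
  Finset.sum_nonneg fun i _ => mul_nonneg (hG.jump_nonneg i) (hG.stepFun_nonneg _ _)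

theorem convSum_le_one (hG : IsGrid G S N) (y m : ℕ) : convSum G S F T y m ≤ 1 := by
  calc convSum G S F T y m ≤ ∑ i ∈ Finset.range m, (G (i + 1) - G i) :=
        Finset.sum_le_sum fun i _ =>
          mul_le_of_le_one_right (hG.jump_nonneg i) (hG.stepFun_le_one _ _)
    _ ≤ 1 := by rw [sum_jump, hG.zero, sub_zero]; exact hG.le_one m

theorem convSum_mono (hG : IsGrid G S N) (m : ℕ) : Monotone fun y => convSum G S F T y m :=
  fun _ _ h => Finset.sum_le_sum fun i _ =>
    mul_le_mul_of_nonneg_left (hG.stepFun_mono _ h) (hG.jump_nonneg i)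

/-- A step function whose jumps up to the argument form an initial segment. -/
theorem stepFun_eq (hG : IsGrid G S N) {y lam : ℕ} (hlam : lam ≤ S)
    (h₁ : ∀ l < lam, T l ≤ y) (h₂ : ∀ l, lam ≤ l → l < S → y < T l) :
    stepFun G S T y = G lam := by
  have : stepFun G S T y = ∑ i ∈ Finset.range lam, (G (i + 1) - G i) := by
    unfold stepFun
    rw [← Finset.sum_subset (Finset.range_mono hlam)]
    · exact Finset.sum_congr rfl fun i hi => if_pos (h₁ i (Finset.mem_range.1 hi))
    · intro i hi hi'
      simp only [Finset.mem_range, not_lt] at hi hi'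
      exact if_neg (not_le.2 (h₂ i hi' hi))
  rw [this, sum_jump, hG.zero, sub_zero]

theorem jump_mult (hG : IsGrid G S N) (i : ℕ) : ∃ k : ℤ, G (i + 1) - G i = k / N := by
  obtain ⟨a, ha⟩ := hG.mult i
  obtain ⟨b, hb⟩ := hG.mult (i + 1)
  exact ⟨b - a, by rw [ha, hb]; push_cast; ring⟩

theorem stepFun_mult (hG : IsGrid G S N) (T : ℕ → ℕ) (y : ℕ) :
    ∃ k : ℤ, stepFun G S T y = k / N := by
  choose c hc using hG.jump_mult
  refine ⟨∑ i ∈ Finset.range S, if T i ≤ y then c i else 0, ?_⟩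
  unfold stepFun
  push_cast
  rw [Finset.sum_div]
  refine Finset.sum_congr rfl fun i _ => ?_
  split_ifs <;> simp [hc]

/-- The common denominator `N * N` does not depend on the number of summands. With values in `[0,
1]` this keeps every partial sum at `2 * M` bits, where adding bit lengths term by term would not.
-/
theorem convSum_mult (hG : IsGrid G S N) (y m : ℕ) :
    ∃ k : ℤ, convSum G S F T y m = k / ((N * N : ℕ) : ℚ) := by
  choose c hc using hG.jump_mult
  choose d hd using fun i => hG.stepFun_mult (fun l => F l + T i) y
  refine ⟨∑ i ∈ Finset.range m, c i * d i, ?_⟩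
  unfold convSum
  push_cast
  rw [Finset.sum_div]
  refine Finset.sum_congr rfl fun i _ => ?_
  rw [hc, hd, div_mul_div_comm]

theorem bits_of_mult {r : ℚ} {k : ℤ} {c : ℕ} (hc : 0 < c) (hr : r = k / c) (h0 : 0 ≤ r)
    (h1 : r ≤ 1) (hcM : c ≤ 2 ^ M) : RatBits M r := by
  refine RatBits.of_div hc ?_ hcM hr
  have hc' : (0 : ℚ) < c := by exact_mod_cast hc
  rw [hr] at h0 h1
  have hk0 : (0 : ℚ) ≤ k := by
    by_contra h
    exact absurd h0 (not_le.2 (div_neg_of_neg_of_pos (not_le.1 h) hc'))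
  have hk1 : (k : ℚ) ≤ c := (div_le_one hc').1 h1
  have a0 : 0 ≤ k := by exact_mod_cast hk0
  have a1 : k ≤ c := by exact_mod_cast hk1
  omega

theorem bits (hG : IsGrid G S N) (hN : N ≤ 2 ^ M) (i : ℕ) : RatBits M (G i) := by
  obtain ⟨k, hk⟩ := hG.mult i
  exact bits_of_mult (k := k) hG.pos (by simpa using hk) (hG.nonneg i) (hG.le_one i) hN

theorem convSum_bits (hG : IsGrid G S N) (hN : N ≤ 2 ^ M) (y m : ℕ) :
    RatBits (2 * M) (convSum G S F T y m) := by
  obtain ⟨k, hk⟩ := hG.convSum_mult (F := F) (T := T) y m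
  refine bits_of_mult (Nat.mul_pos hG.pos hG.pos) hk (hG.convSum_nonneg y m)
    (hG.convSum_le_one y m) ?_
  rw [two_mul, pow_add]
  exact Nat.mul_le_mul hN hN

theorem threshold_le (i : ℕ) : threshold G S F T Y i ≤ Y :=
  Nat.find_min' _ (Or.inl le_rfl)

/-- The convolution is monotone in its argument, so the condition defining the threshold is
inherited by larger arguments. This justifies the bisection. -/
theorem threshold_le_iff (hG : IsGrid G S N) {y i : ℕ} :
    threshold G S F T Y i ≤ y ↔ (Y ≤ y ∨ G i < convSum G S F T y S) := by
  unfold threshold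
  rw [Nat.find_le_iff]
  constructor
  · rintro ⟨m, hm, h | h⟩
    · exact Or.inl (h.trans hm)
    · exact Or.inr (h.trans_le (hG.convSum_mono S hm))
  · exact fun h => ⟨y, le_rfl, h⟩

theorem threshold_mono (hG : IsGrid G S N) : Monotone (threshold G S F T Y) := by
  intro i i' h
  rw [hG.threshold_le_iff]
  rcases hG.threshold_le_iff.1 (le_refl (threshold G S F T Y i')) with h' | h'
  · exact Or.inl h'
  · exact Or.inr ((hG.mono h).trans_lt h')

end IsGrid

/-! ### The program

Scalar variables: `0` the dimension (at the end, the output), `1` the bound `b`, `2` the accuracy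
`ε`, `3`, `4`, `5`, `6` the constants `1`, `2`, `1 / 2`, `0`, `8` the fineness `D` of the grid, `9`
the reciprocal `P` of its first positive point, `14` the number `S` of its cells, `16` the least
positive increment, `22` the scaling factor of the functions, `23` the scaled bound, `24` its
successor. Arrays: `0` the grid, `1` the scaled function values, `2` the thresholds, `3` the new
thresholds. -/

namespace VolProg

open RatProg RatInstr

/-- Variable `31` becomes the convolution at the argument in variable `28`. -/
def conv : RatProg := block [
  instr (copy 29 6), instr (copy 30 14), instr (copy 31 6),
  loop (.lt 29 14) (block [
    branch (.lt 6 30)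
      (block [instr (sub 33 30 3), instr (load 32 1 33), instr (load 34 2 29),
        instr (add 32 32 34)])
      (block [instr (copy 32 28)]),
    branch (.lt 28 32)
      (block [instr (sub 30 30 3)])
      (block [instr (load 33 0 29), instr (add 29 29 3), instr (load 34 0 29),
        instr (sub 34 34 33), instr (load 33 0 30), instr (mul 34 34 33),
        instr (add 31 31 34)])])]

/-- Variable `26` becomes the threshold for the level in variable `36`, by bisection. -/
def bisect : RatProg := block [
  instr (copy 26 6), instr (copy 27 24),
  loop (.lt 26 27) (block [
    instr (add 28 26 27), instr (mul 28 28 5), instr (floor 28 28),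
    conv,
    branch (.lt 36 31)
      (block [instr (copy 27 28)])
      (block [instr (add 26 28 3)])])]

/-- Array `3` becomes the new thresholds. -/
def newThresholds : RatProg := block [
  instr (copy 25 6),
  loop (.lt 25 14) (block [
    instr (load 36 0 25),
    bisect,
    instr (store 3 25 26), instr (add 25 25 3)])]

/-- Array `3` is copied to array `2`. -/
def copyThresholds : RatProg := block [
  instr (copy 25 6),
  loop (.lt 25 14) (block [
    instr (load 33 3 25), instr (store 2 25 33), instr (add 25 25 3)])]

/-- Array `1` becomes the scaled values of the function with the index in variable `17`. -/
def scaledValues : RatProg := block [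
  instr (copy 19 6),
  loop (.lt 19 14) (block [
    instr (load 20 0 19), instr (query 21 17 20), instr (mul 21 21 22), instr (floor 21 21),
    instr (store 1 19 21), instr (add 19 19 3)])]

/-- The thresholds are initialized and then updated once for each function. -/
def stages : RatProg := block [
  instr (copy 25 6),
  loop (.lt 25 14) (block [instr (store 2 25 6), instr (add 25 25 3)]),
  instr (copy 17 6),
  loop (.lt 17 0) (block [
    scaledValues, newThresholds, copyThresholds, instr (add 17 17 3)])]

/-- Variable `12` becomes the value of the step function of the thresholds at the scaled bound. -/
def evaluate : RatProg := block [
  instr (copy 12 6), instr (copy 25 6),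
  loop (.lt 25 14) (block [
    instr (load 33 2 25), instr (load 34 0 25), instr (add 25 25 3),
    branch (.le 33 23)
      (block [instr (load 33 0 25), instr (sub 34 33 34), instr (add 12 12 34)])
      (block [])])]

/-- The grid is written to array `0`, and the number of its cells to variable `14`. -/
def grid : RatProg := block [
  instr (mul 35 9 8), instr (store 0 6 6), instr (div 13 3 9), instr (copy 14 3),
  loop (.lt 13 3) (block [
    instr (store 0 14 13), instr (add 14 14 3), instr (mul 15 13 9), instr (floor 15 15),
    instr (div 15 15 35), instr (add 13 13 15)]),
  instr (store 0 14 3)]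

/-- Variable `16` becomes the least positive increment of a function from `0` to a grid point, or
`1` if this is less. -/
def increment : RatProg := block [
  instr (copy 16 3), instr (copy 17 6),
  loop (.lt 17 0) (block [
    instr (query 18 17 6), instr (copy 19 6),
    loop (.lt 19 14) (block [
      instr (load 20 0 19), instr (query 21 17 20), instr (sub 21 21 18),
      branch (.lt 6 21)
        (block [branch (.lt 21 16) (block [instr (copy 16 21)]) (block [])])
        (block []),
      instr (add 19 19 3)]),
    instr (add 17 17 3)])]

/-- The scaling factor and the scaled bound. -/
def scale : RatProg := block [
  instr (mul 22 8 8), instr (div 22 22 16), instr (mul 23 1 22), instr (floor 23 23),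
  instr (add 24 23 3)]

/-- One round: variable `12` becomes the approximation for the grid given by variables `8`
and `9`. -/
def round : RatProg := block [grid, increment, scale, stages, evaluate]

/-- The constants, and the fineness of the grid. -/
def setup : RatProg := block [
  instr (const 3 1), instr (const 4 2), instr (const 5 (1 / 2)), instr (const 6 0),
  instr (const 7 24), instr (mul 7 7 0), instr (const 8 1),
  loop (.lt 3 7) (block [instr (mul 7 7 5), instr (mul 8 8 4)]),
  loop (.lt 2 7) (block [instr (mul 7 7 5), instr (mul 8 8 4)]),
  instr (mul 10 0 4), instr (mul 10 10 8), instr (const 9 2), instr (const 11 0)]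

/-- Rounds with finer and finer grids, until the approximation is known to be good enough. -/
def main : RatProg := block [
  setup,
  loop (.lt 11 10) (block [instr (mul 9 9 9), round, instr (mul 11 12 9)]),
  instr (copy 0 12)]

end VolProg

/-! ### The sweep that evaluates a convolution -/

namespace VolProg

open RatProg RatInstr

/-- The variables that stay fixed during the stages of a round. -/
structure Base (n : ℕ) (G : ℕ → ℚ) (S : ℕ) (E : ℚ) (Bd : ℕ) (s : RatState) : Prop where
  v0 : s.var 0 = n
  v3 : s.var 3 = 1
  v5 : s.var 5 = 1 / 2
  v6 : s.var 6 = 0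
  v14 : s.var 14 = S
  v22 : s.var 22 = E
  v23 : s.var 23 = Bd
  v24 : s.var 24 = ((Bd + 1 : ℕ) : ℚ)
  grid : ∀ i ≤ S, s.arr 0 i = G i

/-- The program leaves `Base` intact. -/
def keepsBase (p : RatProg) : Bool :=
  !p.writesVar 0 && !p.writesVar 3 && !p.writesVar 5 && !p.writesVar 6 && !p.writesVar 14 &&
    !p.writesVar 22 && !p.writesVar 23 && !p.writesVar 24 && !p.writesArr 0

theorem Base.frame {n S Bd : ℕ} {G : ℕ → ℚ} {E : ℚ} {p : RatProg} {s s' : RatState}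
    (h : Base n G S E Bd s) (hf : p.Frame s s') (hp : keepsBase p = true) :
    Base n G S E Bd s' := by
  simp only [keepsBase, Bool.and_eq_true, Bool.not_eq_true'] at hp
  obtain ⟨⟨⟨⟨⟨⟨⟨⟨h0, h3⟩, h5⟩, h6⟩, h14⟩, h22⟩, h23⟩, h24⟩, ha⟩ := hp
  exact ⟨(hf.1 _ h0).trans h.v0, (hf.1 _ h3).trans h.v3, (hf.1 _ h5).trans h.v5,
    (hf.1 _ h6).trans h.v6, (hf.1 _ h14).trans h.v14, (hf.1 _ h22).trans h.v22,
    (hf.1 _ h23).trans h.v23, (hf.1 _ h24).trans h.v24,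
    fun i hi => by rw [hf.2 _ ha]; exact h.grid i hi⟩

/-- All numbers of `40 * M` bits may be written, and the data have at most `M` bits each. -/
structure Room (B M S N Bd : ℕ) : Prop where
  enc : ∀ r : ℚ, RatBits (40 * M) r → encLen r ≤ B
  one_le : 1 ≤ M
  cells : S ≤ 2 ^ M
  denom : N ≤ 2 ^ M
  bound : Bd + 1 ≤ 2 ^ (8 * M)

namespace Room

variable {B M S N Bd : ℕ}

theorem nat (h : Room B M S N Bd) {k e : ℕ} (hk : k ≤ 2 ^ e) (he : e ≤ 40 * M) :
    encLen (k : ℚ) ≤ B := h.enc _ ((RatBits.natCast hk).mono he)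

theorem nat_cells (h : Room B M S N Bd) {k : ℕ} (hk : k ≤ S) : encLen (k : ℚ) ≤ B :=
  h.nat (hk.trans h.cells) (by omega)

theorem nat_bound (h : Room B M S N Bd) {k : ℕ} (hk : k ≤ Bd + 1) : encLen (k : ℚ) ≤ B :=
  h.nat (hk.trans h.bound) (by omega)

theorem zero (h : Room B M S N Bd) : encLen 0 ≤ B := by
  simpa using h.nat_cells (Nat.zero_le _)

end Room

variable {n : ℕ} {f : Fin n → ℝ → ℝ} {B M S N Bd : ℕ} {G : ℕ → ℚ} {E : ℚ} {F T : ℕ → ℕ}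
  {s : RatState}

/-- As `i` grows, `T i` grows, so the number of `l` with `F l + T i ≤ y` can only drop. The pointer
`lam` starts at `S` and never moves up; all `l ≥ lam` are known to be too large. Each pass lowers
`lam` or raises `i`, so the measure `(S - i) + lam` allows at most `2 * S` passes. -/
theorem runs_conv (hG : IsGrid G S N) (hR : Room B M S N Bd) (hF : Monotone F) (hT : Monotone T)
    (hFb : ∀ l < S, F l ≤ 2 ^ (8 * M)) (hTb : ∀ i < S, T i ≤ Bd + 1) {y : ℕ} (hy : y ≤ Bd + 1)
    (hs : Base n G S E Bd s) (h1 : ∀ l < S, s.arr 1 l = F l) (h2 : ∀ i < S, s.arr 2 i = T i)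
    (h28 : s.var 28 = y) :
    conv.Runs f B s (28 * S + 4) (fun s' => s'.var 31 = convSum G S F T y S) := by
  unfold conv
  refine Runs.copy (T := 28 * S + 3) 0 hs.v6 hR.zero ?_
  refine Runs.copy (T := 28 * S + 2) (S : ℚ) (by simp [hs.v14]) (hR.nat_cells le_rfl) ?_
  refine Runs.copy (T := 28 * S + 1) 0 (by simp [hs.v6]) hR.zero ?_
  set s₀ := ((s.setVar 29 0).setVar 30 (S : ℚ)).setVar 31 0 with hs₀
  have hb₀ : Base n G S E Bd s₀ :=
    ⟨by simp [hs₀, hs.v0], by simp [hs₀, hs.v3], by simp [hs₀, hs.v5], by simp [hs₀, hs.v6],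
      by simp [hs₀, hs.v14], by simp [hs₀, hs.v22], by simp [hs₀, hs.v23], by simp [hs₀, hs.v24],
      fun i hi => by simp [hs₀, hs.grid i hi]⟩
  have h1₀ : ∀ l < S, s₀.arr 1 l = F l := fun l hl => by simp [hs₀, h1 l hl]
  have h2₀ : ∀ l < S, s₀.arr 2 l = T l := fun l hl => by simp [hs₀, h2 l hl]
  have h28₀ : s₀.var 28 = y := by simp [hs₀, h28]
  refine Runs.cons (T₂ := 0) ((S + S) * (13 + 1) + 1) (Runs.loop_measure (I := fun m s =>
      ∃ i lam : ℕ, i ≤ S ∧ lam ≤ S ∧ m = (S - i) + lam ∧ s.var 29 = i ∧ s.var 30 = lam ∧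
        s.var 31 = convSum G S F T y i ∧ ∀ l, lam ≤ l → l < S → y < F l + T i) _ ?_ (S + S)
      ⟨0, S, by omega, le_rfl, by omega, by simp [hs₀], by simp [hs₀], by simp [hs₀, convSum],
        fun l hl hl' => by omega⟩) ?_ (by omega)
  · rintro m s₁ hf ⟨i, lam, hi, hlam, rfl, h29, h30, h31, hout⟩ hg
    have hb := hb₀.frame hf rfl
    have h1₁ : ∀ l < S, s₁.arr 1 l = F l := fun l hl => by rw [hf.2 1 rfl, h1₀ l hl]
    have h2₁ : ∀ l < S, s₁.arr 2 l = T l := fun l hl => by rw [hf.2 2 rfl, h2₀ l hl]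
    have h28₁ : s₁.var 28 = y := by rw [hf.1 28 rfl, h28₀]
    have hi' : i < S := by
      have : s₁.var 29 < s₁.var 14 := hg
      rw [h29, hb.v14] at this
      exact_mod_cast this
    have hp : (0 : ℕ) < 2 ^ (8 * M) := by positivity
    -- For `lam = 0` there is no entry to inspect; the stand-in `y` makes the test `y < y` fail, and
    -- the sweep goes on to the next `i`.
    refine Runs.cons (R := fun s' => s'.var 32 =
      ((if lam = 0 then y else F (lam - 1) + T i : ℕ) : ℚ)) (4 + 1) (T₂ := 8) ?_ ?_ (by omega)
    · refine Runs.branch (fun hg => ?_) (fun hg => ?_)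
      · have hl : 0 < lam := by
          have : s₁.var 6 < s₁.var 30 := hg
          rw [h30, hb.v6] at this
          exact_mod_cast this
        refine Runs.sub ((lam - 1 : ℕ) : ℚ) (by rw [h30, hb.v3]; push_cast [hl]; ring)
          (hR.nat_cells (by omega)) ?_
        refine Runs.load (lam - 1) (F (lam - 1) : ℚ) (by simp)
          (by simp [h1₁ _ (show lam - 1 < S by omega)])
          (hR.nat (hFb _ (by omega)) (by omega)) ?_
        refine Runs.load i (T i : ℚ) (by simp [h29]) (by simp [h2₁ _ hi'])
          (hR.nat_bound (hTb i hi')) ?_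
        refine Runs.add ((F (lam - 1) + T i : ℕ) : ℚ) (by simp)
          (hR.nat (e := 8 * M + 1) ?_ (by have := hR.one_le; omega)) ?_
        · have := hFb (lam - 1) (by omega)
          have := hTb i hi'
          have := hR.bound
          rw [pow_succ]; omega
        · exact Runs.nil (by simp [hl.ne'])
      · have hl : lam = 0 := by
          have : ¬ s₁.var 6 < s₁.var 30 := hg
          rw [h30, hb.v6] at this
          have : ¬ 0 < lam := fun h => this (by exact_mod_cast h)
          omega
        refine Runs.copy (y : ℚ) h28₁ (hR.nat_bound hy) (Runs.nil (by simp [hl]))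
    · intro s₂ hf₂ h32
      have hb₂ := hb.frame hf₂ rfl
      have h28₂ : s₂.var 28 = y := by rw [hf₂.1 28 rfl, h28₁]
      have h29₂ : s₂.var 29 = i := by rw [hf₂.1 29 rfl, h29]
      have h30₂ : s₂.var 30 = lam := by rw [hf₂.1 30 rfl, h30]
      have h31₂ : s₂.var 31 = convSum G S F T y i := by rw [hf₂.1 31 rfl, h31]
      refine Runs.cons (7 + 1) (T₂ := 0) (Runs.branch (Q := fun s' => ∃ k' < S - i + lam,
        ∃ i lam : ℕ, i ≤ S ∧ lam ≤ S ∧ k' = (S - i) + lam ∧ s'.var 29 = i ∧ s'.var 30 = lam ∧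
        s'.var 31 = convSum G S F T y i ∧ ∀ l, lam ≤ l → l < S → y < F l + T i)
        (fun hg => ?_) (fun hg => ?_)) (fun s' _ h => Runs.nil h) (by omega)
      · have hlt : y < if lam = 0 then y else F (lam - 1) + T i := by
          have : s₂.var 28 < s₂.var 32 := hg
          rw [h28₂, h32] at this
          exact_mod_cast this
        have hl : lam ≠ 0 := by
          rintro rfl
          simp at hlt
        rw [if_neg hl] at hlt
        refine Runs.sub ((lam - 1 : ℕ) : ℚ) (by
          rw [h30₂, hb₂.v3]; push_cast [Nat.pos_of_ne_zero hl]; ring)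
          (hR.nat_cells (by omega)) (Runs.nil ?_)
        refine ⟨S - i + (lam - 1), by omega, i, lam - 1, hi, by omega, rfl, by simp [h29₂],
          by simp, by simp [h31₂], fun l hl₁ hl₂ => ?_⟩
        rcases Nat.lt_or_ge l lam with h | h
        · obtain rfl : l = lam - 1 := by omega
          exact hlt
        · exact hout l h hl₂
      · have hge : (if lam = 0 then y else F (lam - 1) + T i) ≤ y := by
          have : ¬ s₂.var 28 < s₂.var 32 := hg
          rw [h28₂, h32] at this
          exact_mod_cast not_lt.1 this
        -- The failed test puts index `lam - 1`, hence all smaller ones, below `y`, and the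
        -- invariant excludes the others. So `lam` is now the exact count and the inner sum
        -- telescopes.
        have hstep : stepFun G S (fun l => F l + T i) y = G lam := by
          refine hG.stepFun_eq hlam (fun l hl => ?_) hout
          rw [if_neg (by omega)] at hge
          exact (Nat.add_le_add_right (hF (by omega : l ≤ lam - 1)) _).trans hge
        have hc := hG.bits hR.denom
        refine Runs.load i (G i) (by simp [h29₂]) (hb₂.grid i hi)
          (hR.enc _ ((hc i).mono (by omega))) ?_
        refine Runs.add ((i + 1 : ℕ) : ℚ) (by simp [h29₂, hb₂.v3]) (hR.nat_cells hi') ?_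
        refine Runs.load (i + 1) (G (i + 1)) (by simp) (by simp [hb₂.grid (i + 1) hi'])
          (hR.enc _ ((hc _).mono (by omega))) ?_
        refine Runs.sub (G (i + 1) - G i) (by simp)
          (hR.enc _ (((hc _).sub (hc _)).mono (by have := hR.one_le; omega))) ?_
        refine Runs.load lam (G lam) (by simp [h30₂]) (by simp [hb₂.grid lam hlam])
          (hR.enc _ ((hc _).mono (by omega))) ?_
        refine Runs.mul ((G (i + 1) - G i) * G lam) (by simp)
          (hR.enc _ ((((hc _).sub (hc _)).mul (hc _)).mono (by have := hR.one_le; omega))) ?_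
        have hsum : convSum G S F T y (i + 1)
            = convSum G S F T y i + (G (i + 1) - G i) * G lam := by
          unfold convSum
          rw [Finset.sum_range_succ, hstep]
        refine Runs.add (convSum G S F T y (i + 1)) (by simp [h31₂, hsum])
          (hR.enc _ ((hG.convSum_bits hR.denom y _).mono (by omega))) (Runs.nil ?_)
        refine ⟨S - (i + 1) + lam, by omega, i + 1, lam, hi', hlam, rfl, by simp, by simp [h30₂],
          by simp, fun l hl₁ hl₂ => ?_⟩
        have := hout l hl₁ hl₂
        have := hT (Nat.le_succ i)
        simp only [Nat.succ_eq_add_one] at this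
        omega
  · rintro s' hf ⟨⟨m, i, lam, hi, hlam, rfl, h29, h30, h31, hout⟩, hg⟩
    have hb := hb₀.frame hf rfl
    refine Runs.nil ?_
    have : i = S := by
      have : ¬ s'.var 29 < s'.var 14 := hg
      rw [h29, hb.v14] at this
      have : ¬ i < S := fun h => this (by exact_mod_cast h)
      omega
    rw [h31, this]

end VolProg

/-! ### Bisection for the thresholds, and the tables of one stage -/

namespace VolProg

open RatProg RatInstr

variable {n : ℕ} {f : Fin n → ℝ → ℝ} {B M S N Bd : ℕ} {G : ℕ → ℚ} {E : ℚ} {F T : ℕ → ℕ}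
  {s : RatState}

theorem floor_half (a : ℕ) : (⌊(a : ℚ) * (1 / 2)⌋ : ℚ) = ((a / 2 : ℕ) : ℚ) := by
  have : ⌊(a : ℚ) * (1 / 2)⌋ = ((a / 2 : ℕ) : ℤ) := by
    rw [Int.floor_eq_iff]
    have h1 : ((a / 2 * 2 : ℕ) : ℚ) ≤ a := by exact_mod_cast Nat.div_mul_le_self a 2
    have h2 : (a : ℚ) < ((a / 2 * 2 + 2 : ℕ) : ℚ) := by exact_mod_cast (by omega)
    simp only [Nat.cast_mul, Nat.cast_add, Nat.cast_ofNat] at h1 h2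
    rw [Int.cast_natCast]
    constructor <;> linarith
  rw [this]; norm_cast

theorem runs_bisect (hG : IsGrid G S N) (hR : Room B M S N Bd) (hF : Monotone F) (hT : Monotone T)
    (hFb : ∀ l < S, F l ≤ 2 ^ (8 * M)) (hTb : ∀ i < S, T i ≤ Bd + 1) {q : ℕ}
    (hq : Bd + 1 < 2 ^ q) {i : ℕ}
    (hs : Base n G S E Bd s) (h1 : ∀ l < S, s.arr 1 l = F l) (h2 : ∀ i < S, s.arr 2 i = T i)
    (h36 : s.var 36 = G i) :
    bisect.Runs f B s (q * (28 * S + 10) + 3)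
      (fun s' => s'.var 26 = threshold G S F T (Bd + 1) i) := by
  unfold bisect
  set th := threshold G S F T (Bd + 1) i with hth
  refine Runs.copy (T := q * (28 * S + 10) + 2) 0 hs.v6 hR.zero ?_
  refine Runs.copy (T := q * (28 * S + 10) + 1) ((Bd + 1 : ℕ) : ℚ) (by simp [hs.v24])
    (hR.nat_bound le_rfl) ?_
  set s₀ := (s.setVar 26 0).setVar 27 ((Bd + 1 : ℕ) : ℚ) with hs₀
  have hb₀ : Base n G S E Bd s₀ :=
    ⟨by simp [hs₀, hs.v0], by simp [hs₀, hs.v3], by simp [hs₀, hs.v5], by simp [hs₀, hs.v6],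
      by simp [hs₀, hs.v14], by simp [hs₀, hs.v22], by simp [hs₀, hs.v23], by simp [hs₀, hs.v24],
      fun i hi => by simp [hs₀, hs.grid i hi]⟩
  have h1₀ : ∀ l < S, s₀.arr 1 l = F l := fun l hl => by simp [hs₀, h1 l hl]
  have h2₀ : ∀ l < S, s₀.arr 2 l = T l := fun l hl => by simp [hs₀, h2 l hl]
  have h36₀ : s₀.var 36 = G i := by simp [hs₀, h36]
  -- The measure `k` bounds the binary length of `hi - lo`. The midpoint rounded down is below `hi`,
  -- so both branches at least halve the length.
  refine Runs.cons (T₂ := 0) (q * (28 * S + 9 + 1) + 1) (Runs.loop_measure (I := fun k s =>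
      ∃ lo hi : ℕ, hi ≤ Bd + 1 ∧ hi - lo < 2 ^ k ∧ s.var 26 = lo ∧ s.var 27 = hi ∧ lo ≤ th ∧
        th ≤ hi) _ ?_ q
      ⟨0, Bd + 1, le_rfl, by omega, by simp [hs₀], by simp [hs₀], Nat.zero_le _,
        IsGrid.threshold_le i⟩) ?_ (le_of_eq (by ring))
  · rintro k s₁ hf ⟨lo, hi, hhi, hk, h26, h27, hlo, hle⟩ hg
    have hb := hb₀.frame hf rfl
    have hlt : lo < hi := by
      have : s₁.var 26 < s₁.var 27 := hg
      rw [h26, h27] at this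
      exact_mod_cast this
    have hB := hR.bound
    have hM := hR.one_le
    have hk0 : k ≠ 0 := by rintro rfl; simp at hk; omega
    obtain ⟨k, rfl⟩ := Nat.exists_eq_succ_of_ne_zero hk0
    rw [pow_succ] at hk
    refine Runs.add (T := 28 * S + 8) ((lo + hi : ℕ) : ℚ) (by simp [h26, h27])
      (hR.nat (e := 8 * M + 1) (by rw [pow_succ]; omega) (by omega)) ?_
    refine Runs.mul (T := 28 * S + 7) (((lo + hi : ℕ) : ℚ) * (1 / 2)) (by simp [hb.v5]) ?_ ?_
    · refine hR.enc _ (RatBits.of_div (a := (lo + hi : ℕ)) (c := 2) (by norm_num) (M := 8 * M + 1)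
        ?_ ?_ ?_ |>.mono (by omega))
      · simp only [Int.natAbs_natCast]; rw [pow_succ]; omega
      · exact le_trans (by norm_num) (Nat.pow_le_pow_right (by norm_num) (by omega : 1 ≤ 8 * M + 1))
      · push_cast; ring
    refine Runs.floor (T := 28 * S + 6) (((lo + hi) / 2 : ℕ) : ℚ) (by
      rw [RatState.setVar_var, if_pos rfl, floor_half]) (hR.nat_bound (by omega)) ?_
    refine Runs.cons (28 * S + 4) 2 (runs_conv (Bd := Bd) (y := (lo + hi) / 2) (n := n) (E := E)
      hG hR hF hT hFb hTb
      (by omega) ?_ ?_ ?_ (by simp)) ?_ (by omega)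
    · exact ⟨by simp [hb.v0], by simp [hb.v3], by simp [hb.v5], by simp [hb.v6],
        by simp [hb.v14], by simp [hb.v22], by simp [hb.v23], by simp [hb.v24],
        fun i hi => by simp [hb.grid i hi]⟩
    · intro l hl
      simp [hf.2 1 rfl, h1₀ l hl]
    · intro l hl
      simp [hf.2 2 rfl, h2₀ l hl]
    · intro s₂ hf₂ h31
      have h28₂ : s₂.var 28 = ((lo + hi) / 2 : ℕ) := by rw [hf₂.1 28 rfl]; simp
      have h26₂ : s₂.var 26 = lo := by rw [hf₂.1 26 rfl]; simp [h26]
      have h27₂ : s₂.var 27 = hi := by rw [hf₂.1 27 rfl]; simp [h27]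
      have h3₂ : s₂.var 3 = 1 := by rw [hf₂.1 3 rfl]; simp [hb.v3]
      have h36₂ : s₂.var 36 = G i := by rw [hf₂.1 36 rfl]; simp [hf.1 36 rfl, h36₀]
      refine Runs.cons (1 + 1) (T₂ := 0) (Runs.branch (Q := fun s' => ∃ k' < k + 1, ∃ lo hi : ℕ,
        hi ≤ Bd + 1 ∧ hi - lo < 2 ^ k' ∧ s'.var 26 = lo ∧ s'.var 27 = hi ∧ lo ≤ th ∧ th ≤ hi)
        (fun hg => ?_) (fun hg => ?_)) (fun s' _ h => Runs.nil h) (by omega)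
      · have hgt : G i < convSum G S F T ((lo + hi) / 2) S := by
          have : s₂.var 36 < s₂.var 31 := hg
          rwa [h36₂, h31] at this
        refine Runs.copy _ h28₂ (hR.nat_bound (by omega)) (Runs.nil ?_)
        exact ⟨k, by omega, lo, (lo + hi) / 2, by omega, by omega, by simp [h26₂], by simp, hlo,
          hG.threshold_le_iff.2 (Or.inr hgt)⟩
      · have hgt : ¬ G i < convSum G S F T ((lo + hi) / 2) S := by
          have : ¬ s₂.var 36 < s₂.var 31 := hg
          rwa [h36₂, h31] at this
        refine Runs.add (((lo + hi) / 2 + 1 : ℕ) : ℚ) (by rw [h28₂, h3₂]; push_cast; rfl)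
          (hR.nat_bound (by omega)) (Runs.nil ?_)
        have hnot : ¬ th ≤ (lo + hi) / 2 := fun h => by
          rcases hG.threshold_le_iff.1 h with h | h
          · omega
          · exact hgt h
        exact ⟨k, by omega, (lo + hi) / 2 + 1, hi, by omega, by omega, by simp, by simp [h27₂],
          by omega, hle⟩
  · rintro s' hf ⟨⟨k, lo, hi, hhi, hk, h26, h27, hlo, hle⟩, hg⟩
    refine Runs.nil ?_
    have : ¬ lo < hi := fun h => hg (by
      change s'.var 26 < s'.var 27
      rw [h26, h27]; exact_mod_cast h)
    rw [h26, show th = lo by omega]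

theorem runs_newThresholds (hG : IsGrid G S N) (hR : Room B M S N Bd) (hF : Monotone F)
    (hT : Monotone T)
    (hFb : ∀ l < S, F l ≤ 2 ^ (8 * M)) (hTb : ∀ i < S, T i ≤ Bd + 1) {q : ℕ}
    (hq : Bd + 1 < 2 ^ q)
    (hs : Base n G S E Bd s) (h1 : ∀ l < S, s.arr 1 l = F l) (h2 : ∀ i < S, s.arr 2 i = T i) :
    newThresholds.Runs f B s (S * (q * (28 * S + 10) + 7) + 2)
      (fun s' => ∀ i < S, s'.arr 3 i = threshold G S F T (Bd + 1) i) := by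
  unfold newThresholds
  refine Runs.copy (T := S * (q * (28 * S + 10) + 7) + 1) 0 hs.v6 hR.zero ?_
  set s₀ := s.setVar 25 0 with hs₀
  have hb₀ : Base n G S E Bd s₀ :=
    ⟨by simp [hs₀, hs.v0], by simp [hs₀, hs.v3], by simp [hs₀, hs.v5], by simp [hs₀, hs.v6],
      by simp [hs₀, hs.v14], by simp [hs₀, hs.v22], by simp [hs₀, hs.v23], by simp [hs₀, hs.v24],
      fun i hi => by simp [hs₀, hs.grid i hi]⟩
  have h1₀ : ∀ l < S, s₀.arr 1 l = F l := fun l hl => by simp [hs₀, h1 l hl]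
  have h2₀ : ∀ l < S, s₀.arr 2 l = T l := fun l hl => by simp [hs₀, h2 l hl]
  refine Runs.cons (T₂ := 0) (S * (q * (28 * S + 10) + 6 + 1) + 1) (Runs.loop_count (I := fun k s =>
      s.var 25 = k ∧ ∀ i < k, s.arr 3 i = threshold G S F T (Bd + 1) i) _ S ?_ ?_
      ⟨by simp [hs₀], fun i hi => by omega⟩) (fun s' _ h => Runs.nil h.2) (le_of_eq (by ring))
  · rintro k hk s' hf ⟨h25, -⟩
    change s'.var 25 < s'.var 14 ↔ _
    rw [h25, (hb₀.frame hf rfl).v14]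
    exact_mod_cast Iff.rfl
  · rintro k hk s₁ hf ⟨h25, h3⟩
    have hb := hb₀.frame hf rfl
    have h1₁ : ∀ l < S, s₁.arr 1 l = F l := fun l hl => by rw [hf.2 1 rfl, h1₀ l hl]
    have h2₁ : ∀ l < S, s₁.arr 2 l = T l := fun l hl => by rw [hf.2 2 rfl, h2₀ l hl]
    refine Runs.load (T := q * (28 * S + 10) + 5) k (G k) h25 (hb.grid k hk.le)
      (hR.enc _ ((hG.bits hR.denom k).mono (by omega))) ?_
    refine Runs.cons (q * (28 * S + 10) + 3) 2 (runs_bisect (n := n) (E := E) (i := k)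
      hG hR hF hT hFb hTb hq ?_ ?_ ?_ (by simp)) ?_ (by omega)
    · exact ⟨by simp [hb.v0], by simp [hb.v3], by simp [hb.v5], by simp [hb.v6],
        by simp [hb.v14], by simp [hb.v22], by simp [hb.v23], by simp [hb.v24],
        fun i hi => by simp [hb.grid i hi]⟩
    · exact fun l hl => by simp [h1₁ l hl]
    · exact fun l hl => by simp [h2₁ l hl]
    · intro s₂ hf₂ h26
      have h25₂ : s₂.var 25 = k := by rw [hf₂.1 25 rfl]; simp [h25]
      have h3₂ : s₂.var 3 = 1 := by rw [hf₂.1 3 rfl]; simp [hb.v3]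
      refine Runs.store k _ h25₂ h26 (hR.nat_bound (IsGrid.threshold_le k)) ?_
      refine Runs.add ((k + 1 : ℕ) : ℚ) (by simp [h25₂, h3₂]) (hR.nat_cells hk) (Runs.nil ?_)
      refine ⟨by simp, fun i hi => ?_⟩
      rcases Nat.lt_succ_iff_lt_or_eq.1 hi with h | rfl
      · simp [h.ne, hf₂.2 3 rfl, h3 i h]
      · simp

/-- The new thresholds are kept in a separate array until the stage is over, because every bisection
of the stage still reads the old ones. -/
theorem runs_copyThresholds (hR : Room B M S N Bd) (hTb : ∀ i < S, T i ≤ Bd + 1)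
    (hs : Base n G S E Bd s) (h3 : ∀ i < S, s.arr 3 i = T i) :
    copyThresholds.Runs f B s (S * 4 + 2) (fun s' => ∀ i < S, s'.arr 2 i = T i) := by
  unfold copyThresholds
  refine Runs.copy (T := S * 4 + 1) 0 hs.v6 hR.zero ?_
  refine Runs.cons (T₂ := 0) (S * (3 + 1) + 1) (Runs.loop_count (I := fun k s =>
      s.var 25 = k ∧ ∀ i < k, s.arr 2 i = T i) _ S ?_ ?_
      ⟨by simp, fun i hi => by omega⟩) (fun s' _ h => Runs.nil h.2) (by omega)
  · rintro k hk s' hf ⟨h25, -⟩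
    change s'.var 25 < s'.var 14 ↔ _
    rw [h25, hf.1 14 rfl]
    simp [hs.v14]
  · rintro k hk s₁ hf ⟨h25, h2⟩
    have h33 : s₁.arr 3 k = T k := by rw [hf.2 3 rfl]; simp [h3 k hk]
    have h31 : s₁.var 3 = 1 := by rw [hf.1 3 rfl]; simp [hs.v3]
    refine Runs.load k (T k : ℚ) h25 h33 (hR.nat_bound (hTb k hk)) ?_
    refine Runs.store k (T k : ℚ) (by simp [h25]) (by simp) (hR.nat_bound (hTb k hk)) ?_
    refine Runs.add ((k + 1 : ℕ) : ℚ) (by simp [h25, h31]) (hR.nat_cells hk) (Runs.nil ?_)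
    refine ⟨by simp, fun i hi => ?_⟩
    rcases Nat.lt_succ_iff_lt_or_eq.1 hi with h | rfl
    · simp [h.ne, h2 i h]
    · simp

theorem runs_scaledValues (hG : IsGrid G S N) (hR : Room B M S N Bd) {j : Fin n} {v : ℕ → ℚ}
    (hv : ∀ l < S, f j (G l : ℝ) = (v l : ℝ)) (hvM : ∀ l < S, RatBits M (v l))
    (hEM : RatBits (7 * M) E) (hF : ∀ l < S, (⌊v l * E⌋ : ℚ) = F l)
    (hFb : ∀ l < S, F l ≤ 2 ^ (8 * M))
    (hs : Base n G S E Bd s) (h17 : s.var 17 = ((j : ℕ) : ℚ)) :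
    scaledValues.Runs f B s (S * 7 + 2) (fun s' => ∀ l < S, s'.arr 1 l = F l) := by
  unfold scaledValues
  refine Runs.copy (T := S * 7 + 1) 0 hs.v6 hR.zero ?_
  refine Runs.cons (T₂ := 0) (S * (6 + 1) + 1) (Runs.loop_count (I := fun k s =>
      s.var 19 = k ∧ ∀ i < k, s.arr 1 i = F i) _ S ?_ ?_
      ⟨by simp, fun i hi => by omega⟩) (fun s' _ h => Runs.nil h.2) (by omega)
  · rintro k hk s' hf ⟨h19, -⟩
    change s'.var 19 < s'.var 14 ↔ _
    rw [h19, hf.1 14 rfl]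
    simp [hs.v14]
  · rintro k hk s₁ hf ⟨h19, h1⟩
    have h03 : s₁.var 3 = 1 := by rw [hf.1 3 rfl]; simp [hs.v3]
    have h017 : s₁.var 17 = ((j : ℕ) : ℚ) := by rw [hf.1 17 rfl]; simp [h17]
    have h022 : s₁.var 22 = E := by rw [hf.1 22 rfl]; simp [hs.v22]
    have h0 : s₁.arr 0 k = G k := by rw [hf.2 0 rfl]; simp [hs.grid k hk.le]
    refine Runs.load k (G k) h19 h0 (hR.enc _ ((hG.bits hR.denom k).mono (by omega))) ?_
    refine Runs.query (v k) j (G k) (by simp [h017]) (by simp) ⟨hG.nonneg k, hG.le_one k⟩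
      (hv k hk) (hR.enc _ ((hvM k hk).mono (by omega))) ?_
    refine Runs.mul (v k * E) (by simp [h022])
      (hR.enc _ (((hvM k hk).mul hEM).mono (by omega))) ?_
    refine Runs.floor (F k : ℚ) (by simp [← hF k hk]) (hR.nat (hFb k hk) (by omega)) ?_
    refine Runs.store k (F k : ℚ) (by simp [h19]) (by simp) (hR.nat (hFb k hk) (by omega)) ?_
    refine Runs.add ((k + 1 : ℕ) : ℚ) (by simp [h19, h03]) (hR.nat_cells hk) (Runs.nil ?_)
    refine ⟨by simp, fun i hi => ?_⟩
    rcases Nat.lt_succ_iff_lt_or_eq.1 hi with h | rfl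
    · simp [h.ne, h1 i h]
    · simp

end VolProg

/-- The thresholds after `j` stages. -/
noncomputable def stageThreshold (G : ℕ → ℚ) (S : ℕ) (F : ℕ → ℕ → ℕ) (Y : ℕ) : ℕ → ℕ → ℕ
  | 0 => fun _ => 0
  | j + 1 => threshold G S (F j) (stageThreshold G S F Y j) Y

theorem stageThreshold_mono {G : ℕ → ℚ} {S N : ℕ} {F : ℕ → ℕ → ℕ} {Y : ℕ} (hG : IsGrid G S N)
    (j : ℕ) : Monotone (stageThreshold G S F Y j) := by
  cases j with
  | zero => exact monotone_const
  | succ j => exact hG.threshold_mono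

theorem stageThreshold_le {G : ℕ → ℚ} {S : ℕ} {F : ℕ → ℕ → ℕ} {Y : ℕ} (j i : ℕ) :
    stageThreshold G S F Y j i ≤ Y := by
  cases j with
  | zero => exact Nat.zero_le _
  | succ j => exact IsGrid.threshold_le i

/-! ### All stages, and reading off the result -/

namespace VolProg

open RatProg RatInstr

variable {n : ℕ} {f : Fin n → ℝ → ℝ} {B M S N Bd : ℕ} {G : ℕ → ℚ} {E : ℚ} {F : ℕ → ℕ → ℕ}
  {T : ℕ → ℕ} {s : RatState}

theorem runs_stages (hG : IsGrid G S N) (hR : Room B M S N Bd) {v : Fin n → ℕ → ℚ}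
    (hn : n ≤ 2 ^ M)
    (hv : ∀ j, ∀ l < S, f j (G l : ℝ) = (v j l : ℝ)) (hvM : ∀ j, ∀ l < S, RatBits M (v j l))
    (hEM : RatBits (7 * M) E) (hF : ∀ j : Fin n, ∀ l < S, (⌊v j l * E⌋ : ℚ) = F j l)
    (hFb : ∀ j < n, ∀ l < S, F j l ≤ 2 ^ (8 * M)) (hFm : ∀ j < n, Monotone (F j)) {q : ℕ}
    (hq : Bd + 1 < 2 ^ q) (hs : Base n G S E Bd s) :
    stages.Runs f B s (n * (S * (q * (28 * S + 10) + 18) + 8) + S * 3 + 4)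
      (fun s' => ∀ i < S, s'.arr 2 i = stageThreshold G S F (Bd + 1) n i) := by
  unfold stages
  refine Runs.copy (T := n * (S * (q * (28 * S + 10) + 18) + 8) + S * 3 + 3) 0 hs.v6 hR.zero ?_
  refine Runs.cons (S * (2 + 1) + 1) (n * (S * (q * (28 * S + 10) + 18) + 8) + 2)
    (Runs.loop_count (I := fun k s =>
      s.var 25 = k ∧ ∀ i < k, s.arr 2 i = 0) _ S ?_ ?_ ⟨by simp, fun i hi => by omega⟩) ?_ (by omega)
  · rintro k hk s' hf ⟨h25, -⟩
    change s'.var 25 < s'.var 14 ↔ _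
    rw [h25, hf.1 14 rfl]
    simp [hs.v14]
  · rintro k hk s₁ hf ⟨h25, h2⟩
    have h6 : s₁.var 6 = 0 := by rw [hf.1 6 rfl]; simp [hs.v6]
    have h3 : s₁.var 3 = 1 := by rw [hf.1 3 rfl]; simp [hs.v3]
    refine Runs.store k 0 h25 h6 hR.zero ?_
    refine Runs.add ((k + 1 : ℕ) : ℚ) (by simp [h25, h3]) (hR.nat_cells hk) (Runs.nil ?_)
    refine ⟨by simp, fun i hi => ?_⟩
    rcases Nat.lt_succ_iff_lt_or_eq.1 hi with h | rfl
    · simp [h.ne, h2 i h]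
    · simp
  · intro s₁ hf ⟨_, h2⟩
    have hb : Base n G S E Bd s₁ := by
      refine Base.frame ?_ hf rfl
      exact ⟨by simp [hs.v0], by simp [hs.v3], by simp [hs.v5], by simp [hs.v6],
        by simp [hs.v14], by simp [hs.v22], by simp [hs.v23], by simp [hs.v24],
        fun i hi => by simp [hs.grid i hi]⟩
    refine Runs.copy (T := n * (S * (q * (28 * S + 10) + 18) + 8) + 1) 0 hb.v6 hR.zero ?_
    have hb₀ : Base n G S E Bd (s₁.setVar 17 0) :=
      ⟨by simp [hb.v0], by simp [hb.v3], by simp [hb.v5], by simp [hb.v6],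
        by simp [hb.v14], by simp [hb.v22], by simp [hb.v23], by simp [hb.v24],
        fun i hi => by simp [hb.grid i hi]⟩
    refine Runs.cons (T₂ := 0) (n * (S * (q * (28 * S + 10) + 18) + 7 + 1) + 1)
      (Runs.loop_count (I := fun k s => s.var 17 = k ∧
        ∀ i < S, s.arr 2 i = stageThreshold G S F (Bd + 1) k i) _ n ?_ ?_
        ⟨by simp, fun i hi => by simp [h2 i hi, stageThreshold]⟩) (fun s' _ h => Runs.nil h.2)
      (le_of_eq (by ring))
    · rintro k hk s' hf ⟨h17, -⟩
      change s'.var 17 < s'.var 0 ↔ _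
      rw [h17, (hb₀.frame hf rfl).v0]
      exact_mod_cast Iff.rfl
    · rintro k hk s₂ hf₂ ⟨h17, h2₂⟩
      have hb₂ := hb₀.frame hf₂ rfl
      refine Runs.cons (S * 7 + 2) (S * (q * (28 * S + 10) + 11) + 5)
        (runs_scaledValues (F := F k) hG hR (hv ⟨k, hk⟩) (hvM ⟨k, hk⟩) hEM (hF ⟨k, hk⟩) (hFb k hk)
          hb₂ h17) ?_ (by ring_nf; omega)
      intro s₃ hf₃ h1₃
      refine Runs.cons (S * (q * (28 * S + 10) + 7) + 2) (S * 4 + 3)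
        (runs_newThresholds hG hR (hFm k hk) (stageThreshold_mono hG k) (hFb k hk)
          (fun i _ => stageThreshold_le k i) hq (hb₂.frame hf₃ rfl) h1₃
          (fun i hi => by rw [hf₃.2 2 rfl, h2₂ i hi])) ?_ (by ring_nf; omega)
      intro s₄ hf₄ h3₄
      have hb₄ := (hb₂.frame hf₃ rfl).frame hf₄ rfl
      refine Runs.cons (S * 4 + 2) 1
        (runs_copyThresholds (T := stageThreshold G S F (Bd + 1) (k + 1)) hR
          (fun i _ => stageThreshold_le (k + 1) i) hb₄ h3₄) ?_ (by omega)
      intro s₅ hf₅ h2₅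
      refine Runs.add ((k + 1 : ℕ) : ℚ) ?_ (hR.nat (Nat.le_trans hk hn) (by omega)) (Runs.nil ?_)
      · rw [hf₅.1 17 rfl, hf₄.1 17 rfl, hf₃.1 17 rfl, h17, (hb₄.frame hf₅ rfl).v3]
        push_cast; rfl
      · exact ⟨by simp, fun i hi => by simp [h2₅ i hi]⟩

theorem runs_evaluate (hG : IsGrid G S N) (hR : Room B M S N Bd) (hTb : ∀ i < S, T i ≤ Bd + 1)
    (hs : Base n G S E Bd s) (h2 : ∀ i < S, s.arr 2 i = T i) :
    evaluate.Runs f B s (S * 8 + 3) (fun s' => s'.var 12 = stepFun G S T Bd) := by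
  unfold evaluate
  refine Runs.copy (T := S * 8 + 2) 0 hs.v6 hR.zero ?_
  refine Runs.copy (T := S * 8 + 1) 0 (by simp [hs.v6]) hR.zero ?_
  have hc := hG.bits hR.denom
  have hM := hR.one_le
  refine Runs.cons (T₂ := 0) (S * (7 + 1) + 1) (Runs.loop_count (I := fun k s =>
      s.var 25 = k ∧ s.var 12 = stepFun G k T Bd) _ S ?_ ?_
      ⟨by simp, by simp [stepFun]⟩) (fun s' _ h => Runs.nil h.2) (by omega)
  · rintro k hk s' hf ⟨h25, -⟩
    change s'.var 25 < s'.var 14 ↔ _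
    rw [h25, hf.1 14 rfl]
    simp [hs.v14]
  · rintro k hk s₁ hf ⟨h25, h12⟩
    have h3 : s₁.var 3 = 1 := by rw [hf.1 3 rfl]; simp [hs.v3]
    have h23 : s₁.var 23 = Bd := by rw [hf.1 23 rfl]; simp [hs.v23]
    have h2₁ : s₁.arr 2 k = T k := by rw [hf.2 2 rfl]; simp [h2 k hk]
    have h0 : ∀ i ≤ S, s₁.arr 0 i = G i := fun i hi => by
      rw [hf.2 0 rfl]; simp [hs.grid i hi]
    refine Runs.load (T := 6) k (T k : ℚ) h25 h2₁ (hR.nat_bound (hTb k hk)) ?_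
    refine Runs.load k (G k) (by simp [h25]) (by simp [h0 k hk.le])
      (hR.enc _ ((hc k).mono (by omega))) ?_
    refine Runs.add ((k + 1 : ℕ) : ℚ) (by simp [h25, h3]) (hR.nat_cells hk) ?_
    refine Runs.cons (R := fun s' => s'.var 25 = ((k + 1 : ℕ) : ℚ) ∧
      s'.var 12 = stepFun G (k + 1) T Bd) (3 + 1) (T₂ := 0) ?_ (fun s' _ h => Runs.nil h) (by omega)
    have hsum : stepFun G (k + 1) T Bd
        = stepFun G k T Bd + if T k ≤ Bd then G (k + 1) - G k else 0 :=
      Finset.sum_range_succ _ _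
    refine Runs.branch (fun hg => ?_) (fun hg => ?_)
    · have hle : T k ≤ Bd := by
        simpa [RatTest.Holds, h23] using hg
      rw [if_pos hle] at hsum
      refine Runs.load (k + 1) (G (k + 1)) (by simp) (by simp [h0 (k + 1) hk])
        (hR.enc _ ((hc _).mono (by omega))) ?_
      refine Runs.sub (G (k + 1) - G k) (by simp)
        (hR.enc _ (((hc _).sub (hc _)).mono (by omega))) ?_
      refine Runs.add (stepFun G (k + 1) T Bd) (by simp [h12, hsum]) ?_ (Runs.nil (by simp))
      -- `stepFun_mult` concerns all `S` cells of the grid; the partial sums need the same argument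
      -- again.
      obtain ⟨a, ha⟩ : ∃ a : ℤ, stepFun G (k + 1) T Bd = a / N := by
        choose c hc using hG.jump_mult
        refine ⟨∑ i ∈ Finset.range (k + 1), if T i ≤ Bd then c i else 0, ?_⟩
        unfold stepFun
        push_cast
        rw [Finset.sum_div]
        refine Finset.sum_congr rfl fun i _ => ?_
        split_ifs <;> simp [hc]
      refine hR.enc _ ((IsGrid.bits_of_mult hG.pos ha ?_ ?_ hR.denom).mono (by omega))
      · exact Finset.sum_nonneg fun i _ => by split_ifs <;> [exact hG.jump_nonneg i; rfl]
      · refine le_trans ?_ (hG.stepFun_le_one T Bd)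
        refine Finset.sum_le_sum_of_subset_of_nonneg (Finset.range_mono hk) fun i _ _ => ?_
        split_ifs <;> [exact hG.jump_nonneg i; rfl]
    · have hle : ¬ T k ≤ Bd := by
        simpa [RatTest.Holds, h23] using hg
      rw [if_neg hle] at hsum
      exact Runs.nil ⟨by simp, by simp [h12, hsum]⟩

end VolProg

/-! ### The grid -/

/-- The positive points of the grid, continued beyond `1`. -/
def gridAux (P D : ℕ) : ℕ → ℚ
  | 0 => 1 / P
  | i + 1 => gridAux P D i + (⌊gridAux P D i * P⌋ : ℚ) / ((P * D : ℕ) : ℚ)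

/-- The points of the grid. -/
def gridPt (P D : ℕ) : ℕ → ℚ
  | 0 => 0
  | i + 1 => min 1 (gridAux P D i)

section Grid

variable {P D : ℕ}

theorem le_gridAux (hP : 0 < P) (i : ℕ) : 1 / (P : ℚ) ≤ gridAux P D i := by
  induction i with
  | zero => exact le_rfl
  | succ i ih =>
    rw [gridAux]
    have : (0 : ℚ) ≤ ⌊gridAux P D i * P⌋ := by
      have h : 0 ≤ gridAux P D i * P :=
        mul_nonneg ((by positivity : (0 : ℚ) ≤ 1 / P).trans ih) (Nat.cast_nonneg _)
      exact_mod_cast Int.floor_nonneg.2 h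
    have : (0 : ℚ) ≤ (⌊gridAux P D i * P⌋ : ℚ) / ((P * D : ℕ) : ℚ) := by positivity
    linarith

theorem gridAux_pos (hP : 0 < P) (i : ℕ) : 0 < gridAux P D i :=
  lt_of_lt_of_le (by positivity) (le_gridAux hP i)

theorem one_le_gridAux_mul (hP : 0 < P) (i : ℕ) : 1 ≤ gridAux P D i * P := by
  have hP' : (0 : ℚ) < P := by exact_mod_cast hP
  exact (div_le_iff₀ hP').1 (le_gridAux hP i)

theorem gridAux_mult (hP : 0 < P) (hD : 0 < D) (i : ℕ) :
    ∃ k : ℕ, gridAux P D i = k / ((P * D : ℕ) : ℚ) := by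
  have hP' : (P : ℚ) ≠ 0 := by exact_mod_cast hP.ne'
  have hD' : (D : ℚ) ≠ 0 := by exact_mod_cast hD.ne'
  induction i with
  | zero => exact ⟨D, by rw [gridAux]; push_cast; field_simp⟩
  | succ i ih =>
    obtain ⟨k, hk⟩ := ih
    have h0 : 0 ≤ ⌊gridAux P D i * P⌋ :=
      Int.floor_nonneg.2 (zero_le_one.trans (one_le_gridAux_mul hP i))
    obtain ⟨m, hm⟩ := Int.eq_ofNat_of_zero_le h0
    refine ⟨k + m, ?_⟩
    rw [gridAux, hm, hk]
    push_cast
    rw [add_div]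

theorem gridAux_succ_le (hP : 0 < P) (hD : 0 < D) (i : ℕ) :
    gridAux P D (i + 1) ≤ (1 + 1 / D) * gridAux P D i := by
  have hP' : (0 : ℚ) < P := by exact_mod_cast hP
  have hD' : (0 : ℚ) < D := by exact_mod_cast hD
  have h : (⌊gridAux P D i * P⌋ : ℚ) / ((P * D : ℕ) : ℚ) ≤ gridAux P D i / D := by
    push_cast
    rw [div_le_div_iff₀ (by positivity) hD']
    have := Int.floor_le (gridAux P D i * P)
    nlinarith
  rw [gridAux]
  calc _ ≤ gridAux P D i + gridAux P D i / D := by linarith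
    _ = _ := by ring

/-- Rounding the step down to a multiple of `1 / (P D)` loses at most half of it, because `gridAux P
D i * P ≥ 1`. -/
theorem le_gridAux_succ (hP : 0 < P) (hD : 0 < D) (i : ℕ) :
    (1 + 1 / ((2 * D : ℕ) : ℚ)) * gridAux P D i ≤ gridAux P D (i + 1) := by
  have hP' : (0 : ℚ) < P := by exact_mod_cast hP
  have hD' : (0 : ℚ) < D := by exact_mod_cast hD
  have h : gridAux P D i / ((2 * D : ℕ) : ℚ)
      ≤ (⌊gridAux P D i * P⌋ : ℚ) / ((P * D : ℕ) : ℚ) := by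
    push_cast
    rw [div_le_div_iff₀ (by positivity) (by positivity)]
    have h1 := one_le_gridAux_mul (D := D) hP i
    have h2 := Int.lt_floor_add_one (gridAux P D i * P)
    have h3 : (1 : ℚ) ≤ ⌊gridAux P D i * P⌋ := by exact_mod_cast Int.le_floor.2 (by simpa using h1)
    have h4 : gridAux P D i * P ≤ 2 * ⌊gridAux P D i * P⌋ := by linarith
    calc gridAux P D i * (P * D) = (gridAux P D i * P) * D := by ring
      _ ≤ (2 * ⌊gridAux P D i * P⌋) * D := by gcongr
      _ = _ := by ring
  rw [gridAux]
  calc _ = gridAux P D i + gridAux P D i / ((2 * D : ℕ) : ℚ) := by ring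
    _ ≤ _ := by linarith

theorem gridAux_mono (hP : 0 < P) (hD : 0 < D) : Monotone (gridAux P D) := by
  refine monotone_nat_of_le_succ fun i => le_trans ?_ (le_gridAux_succ hP hD i)
  have : (0 : ℚ) ≤ 1 / ((2 * D : ℕ) : ℚ) := by positivity
  have := gridAux_pos (D := D) hP i
  nlinarith

theorem pow_mul_gridAux_le (hP : 0 < P) (hD : 0 < D) (i m : ℕ) :
    (1 + 1 / ((2 * D : ℕ) : ℚ)) ^ m * gridAux P D i ≤ gridAux P D (i + m) := by
  induction m with
  | zero => simp
  | succ m ih =>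
    refine le_trans ?_ (le_gridAux_succ hP hD (i + m))
    rw [pow_succ', mul_assoc]
    exact mul_le_mul_of_nonneg_left ih (by positivity)

/-- By Bernoulli's inequality `2 * D` steps at least double the point. Hence `2 * D * K` steps lead
from `1 / 2 ^ K` to `1`. -/
theorem two_pow_le_gridAux (hP : 0 < P) (hD : 0 < D) (k : ℕ) :
    2 ^ k / (P : ℚ) ≤ gridAux P D (2 * D * k) := by
  induction k with
  | zero => simp [gridAux]
  | succ k ih =>
    have h2 : (2 : ℚ) ≤ (1 + 1 / ((2 * D : ℕ) : ℚ)) ^ (2 * D) := by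
      have := one_add_mul_le_pow (a := 1 / ((2 * D : ℕ) : ℚ))
        (by have : (0 : ℚ) ≤ 1 / ((2 * D : ℕ) : ℚ) := by positivity
            linarith) (2 * D)
      rw [mul_one_div_cancel (by positivity)] at this
      linarith
    refine le_trans ?_ (pow_mul_gridAux_le hP hD (2 * D * k) (2 * D))
    calc 2 ^ (k + 1) / (P : ℚ) = 2 * (2 ^ k / P) := by ring
      _ ≤ _ := mul_le_mul h2 ih (by positivity) (by positivity)

theorem gridPt_nonneg (hP : 0 < P) (i : ℕ) : 0 ≤ gridPt P D i := by
  cases i with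
  | zero => exact le_rfl
  | succ i => exact le_min zero_le_one (gridAux_pos hP i).le

theorem gridPt_le_one (i : ℕ) : gridPt P D i ≤ 1 := by
  cases i with
  | zero => exact zero_le_one
  | succ i => exact min_le_left _ _

theorem gridPt_one (hP : 0 < P) : gridPt P D 1 = 1 / P := by
  refine min_eq_right ?_
  have : (1 : ℚ) ≤ P := by exact_mod_cast hP
  exact (div_le_one (by linarith)).2 this

/-- The first cell starts at `0` and admits no ratio bound; it is the source of all additive errors.
-/
theorem gridPt_succ_le (hP : 0 < P) (hD : 0 < D) {i : ℕ} (hi : i ≠ 0) :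
    gridPt P D (i + 1) ≤ (1 + 1 / D) * gridPt P D i := by
  obtain ⟨i, rfl⟩ := Nat.exists_eq_succ_of_ne_zero hi
  have h := gridAux_succ_le hP hD i
  have h1 : (0 : ℚ) ≤ 1 / D := by positivity
  simp only [gridPt]
  rcases le_total 1 (gridAux P D i) with h2 | h2
  · rw [min_eq_left h2]
    exact (min_le_left _ _).trans (by linarith)
  · rw [min_eq_right h2]
    exact (min_le_right _ _).trans h

theorem isGrid_gridPt (hP : 0 < P) (hD : 0 < D) {m : ℕ} (hm : 1 ≤ gridAux P D m) :
    IsGrid (gridPt P D) (m + 1) (P * D) where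
  pos := Nat.mul_pos hP hD
  zero := rfl
  one := min_eq_left hm
  mono := by
    refine monotone_nat_of_le_succ fun i => ?_
    cases i with
    | zero => exact gridPt_nonneg hP _
    | succ i => exact min_le_min_left _ (gridAux_mono hP hD (Nat.le_succ i))
  le_one := gridPt_le_one
  mult := fun i => by
    cases i with
    | zero => exact ⟨0, by simp [gridPt]⟩
    | succ i =>
      simp only [gridPt]
      rcases min_choice 1 (gridAux P D i) with h | h
      · refine ⟨P * D, ?_⟩
        have : ((P * D : ℕ) : ℚ) ≠ 0 := by exact_mod_cast (Nat.mul_pos hP hD).ne'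
        rw [h, div_self this]
      · rw [h]; exact gridAux_mult hP hD i

end Grid

/-! ### Running the grid construction and finding the least increment -/

namespace VolProg

open RatProg RatInstr

variable {n : ℕ} {f : Fin n → ℝ → ℝ} {B M S N : ℕ} {G : ℕ → ℚ} {s : RatState}

theorem runs_grid {P D m : ℕ} (henc : ∀ r : ℚ, RatBits (40 * M) r → encLen r ≤ B) (hM : 1 ≤ M)
    (hP : 0 < P) (hD : 0 < D) (hPD : P * D ≤ 2 ^ M) (hmM : m + 1 ≤ 2 ^ M)
    (hm : 1 ≤ gridAux P D m) (hlt : ∀ i < m, gridAux P D i < 1)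
    (h3 : s.var 3 = 1) (h6 : s.var 6 = 0) (h8 : s.var 8 = D) (h9 : s.var 9 = P) :
    grid.Runs f B s (m * 7 + 6) (fun s' => s'.var 14 = ((m + 1 : ℕ) : ℚ) ∧
      ∀ i ≤ m + 1, s'.arr 0 i = gridPt P D i) := by
  have hP' : (0 : ℚ) < P := by exact_mod_cast hP
  have hD' : (0 : ℚ) < D := by exact_mod_cast hD
  have hPM : P ≤ 2 ^ M := (Nat.le_mul_of_pos_right P hD).trans hPD
  have hDM : D ≤ 2 ^ M := (Nat.le_mul_of_pos_left D hP).trans hPD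
  have hnat : ∀ k : ℕ, k ≤ 2 ^ M → encLen (k : ℚ) ≤ B := fun k hk =>
    henc _ ((RatBits.natCast hk).mono (by omega))
  have h0B : encLen 0 ≤ B := by simpa using hnat 0 (Nat.zero_le _)
  -- The last point computed may overshoot `1`, but at most by the factor `1 + 1 / D ≤ 2`, which
  -- costs one bit.
  have hle2 : ∀ i ≤ m, gridAux P D i ≤ 2 := by
    intro i hi
    cases i with
    | zero =>
      rw [gridAux]
      refine ((div_le_one hP').2 (by exact_mod_cast hP)).trans (by norm_num)
    | succ i =>
      have h1 := gridAux_succ_le hP hD i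
      have h2 := hlt i (by omega)
      have h3 : (1 : ℚ) / D ≤ 1 := (div_le_one hD').2 (by exact_mod_cast hD)
      have h4 := gridAux_pos (D := D) hP i
      nlinarith
  have hbits : ∀ i ≤ m, RatBits (M + 1) (gridAux P D i) := by
    intro i hi
    obtain ⟨k, hk⟩ := gridAux_mult hP hD i
    have hpos : (0 : ℚ) < ((P * D : ℕ) : ℚ) := by exact_mod_cast Nat.mul_pos hP hD
    refine RatBits.of_div (a := k) (Nat.mul_pos hP hD) ?_ (hPD.trans
      (Nat.pow_le_pow_right (by norm_num) (by omega))) (by simpa using hk)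
    have h2 := hle2 i hi
    rw [hk, div_le_iff₀ hpos] at h2
    have : k ≤ 2 * (P * D) := by exact_mod_cast h2
    rw [Int.natAbs_natCast, pow_succ]
    omega
  unfold grid
  refine Runs.mul (T := m * 7 + 5) ((P * D : ℕ) : ℚ) (by rw [h9, h8]; push_cast; rfl) (hnat _ hPD) ?_
  refine Runs.store (T := m * 7 + 4) 0 0 (by simp [h6]) (by simp [h6]) h0B ?_
  refine Runs.div (T := m * 7 + 3) (1 / (P : ℚ)) (by simp [h9, hP.ne']) (by simp [h3, h9]) ?_ ?_
  · exact henc _ ((hbits 0 (Nat.zero_le _)).mono (by omega))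
  refine Runs.copy (T := m * 7 + 2) 1 (by simp [h3])
    (by simpa using hnat 1 Nat.one_le_two_pow) ?_
  refine Runs.cons (m * (6 + 1) + 1) 1 (Runs.loop_count (I := fun k s =>
      s.var 13 = gridAux P D k ∧ s.var 14 = ((k + 1 : ℕ) : ℚ) ∧ s.arr 0 0 = 0 ∧
      ∀ i < k, s.arr 0 (i + 1) = gridAux P D i) _ m ?_ ?_
      ⟨by simp [gridAux], by simp, by simp, fun i hi => by omega⟩) ?_ (by omega)
  · rintro k hk s' hf ⟨h13, -⟩
    change s'.var 13 < s'.var 3 ↔ _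
    rw [h13, hf.1 3 rfl]
    simp only [RatState.setVar_var, RatState.setArr_var]
    norm_num
    rw [h3]
    rcases hk.lt_or_eq with h | rfl
    · exact ⟨fun _ => h, fun _ => hlt k h⟩
    · exact ⟨fun h => absurd hm (not_le.2 h), fun h => absurd h (lt_irrefl _)⟩
  · rintro k hk s₁ hf ⟨h13, h14, h00, h0⟩
    have e3 : s₁.var 3 = 1 := by rw [hf.1 3 rfl]; simp [h3]
    have e9 : s₁.var 9 = P := by rw [hf.1 9 rfl]; simp [h9]
    have e35 : s₁.var 35 = ((P * D : ℕ) : ℚ) := by rw [hf.1 35 rfl]; simp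
    have hb := hbits k hk.le
    have hfl : (⌊gridAux P D k * P⌋ : ℚ) = ((⌊gridAux P D k * P⌋₊ : ℕ) : ℚ) := by
      rw [natCast_floor_eq_intCast_floor]
      exact zero_le_one.trans (one_le_gridAux_mul hP k)
    have hfl' : ⌊gridAux P D k * P⌋₊ ≤ 2 ^ M := by
      have h1 : gridAux P D k * P ≤ P := mul_le_of_le_one_left hP'.le (hlt k hk).le
      exact (Nat.floor_le_of_le h1).trans hPM
    refine Runs.store (k + 1) (gridAux P D k) h14 h13 (henc _ (hb.mono (by omega))) ?_
    refine Runs.add ((k + 1 + 1 : ℕ) : ℚ) (by simp [h14, e3]) (hnat _ (by omega)) ?_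
    refine Runs.mul (gridAux P D k * P) (by simp [h13, e9])
      (henc _ ((hb.mul (RatBits.natCast hPM)).mono (by omega))) ?_
    refine Runs.floor (⌊gridAux P D k * P⌋ : ℚ) (by simp) (by rw [hfl]; exact hnat _ hfl') ?_
    refine Runs.div ((⌊gridAux P D k * P⌋ : ℚ) / ((P * D : ℕ) : ℚ)) ?_ (by simp [e35]) ?_ ?_
    · simp [e35, hP.ne', hD.ne']
    · rw [hfl]
      exact henc _ (((RatBits.natCast hfl').div (RatBits.natCast hPD)).mono (by omega))
    refine Runs.add (gridAux P D (k + 1)) (by simp [h13, gridAux])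
      (henc _ ((hbits _ hk).mono (by omega))) (Runs.nil ?_)
    refine ⟨by simp, by simp, by simp [h00], fun i hi => ?_⟩
    rcases Nat.lt_succ_iff_lt_or_eq.1 hi with h | rfl
    · simp [h.ne, h0 i h]
    · simp
  · rintro s₁ hf ⟨h13, h14, h00, h0⟩
    have e3 : s₁.var 3 = 1 := by rw [hf.1 3 rfl]; simp [h3]
    refine Runs.store (m + 1) 1 h14 e3 (by simpa using hnat 1 Nat.one_le_two_pow) (Runs.nil ?_)
    refine ⟨by simpa using h14, fun i hi => ?_⟩
    rcases hi.lt_or_eq with h | rfl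
    · cases i with
      | zero => simp [h00, gridPt]
      | succ i =>
        have hi' : i < m := by omega
        have hne : i ≠ m := by omega
        simp [hne, h0 i hi', gridPt, (hlt i hi').le]
    · simp [gridPt, hm]

/-- A positive lower bound for the positive increments of the functions on the grid. -/
structure IsIncrement (n S M : ℕ) (v : Fin n → ℕ → ℚ) (θ : ℚ) : Prop where
  pos : 0 < θ
  le_one : θ ≤ 1
  bits : RatBits (2 * M + 1) θ
  le_sub : ∀ j, ∀ l < S, v j 0 < v j l → θ ≤ v j l - v j 0

/-- The running minimum is always `1` or a single difference of two `M`-bit values, so it never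
needs more than `2 * M + 1` bits. -/
theorem runs_increment (henc : ∀ r : ℚ, RatBits (40 * M) r → encLen r ≤ B) (hM : 1 ≤ M)
    (hG : IsGrid G S N) (hN : N ≤ 2 ^ M) (hS : S ≤ 2 ^ M) (hn : n ≤ 2 ^ M)
    {v : Fin n → ℕ → ℚ}
    (hv : ∀ j l, f j (G l : ℝ) = (v j l : ℝ)) (hvM : ∀ j l, RatBits M (v j l))
    (h0 : s.var 0 = n) (h3 : s.var 3 = 1) (h6 : s.var 6 = 0) (h14 : s.var 14 = S)
    (ha : ∀ i ≤ S, s.arr 0 i = G i) :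
    increment.Runs f B s (n * (S * 8 + 5) + 3)
      (fun s' => ∃ θ, s'.var 16 = θ ∧ IsIncrement n S M v θ) := by
  have hnat : ∀ k : ℕ, k ≤ 2 ^ M → encLen (k : ℚ) ≤ B := fun k hk =>
    henc _ ((RatBits.natCast hk).mono (by omega))
  have h0B : encLen 0 ≤ B := by simpa using hnat 0 (Nat.zero_le _)
  have hbits1 : RatBits M (1 : ℚ) := by simpa using RatBits.natCast (k := 1) Nat.one_le_two_pow
  unfold increment
  refine Runs.copy (T := n * (S * 8 + 5) + 2) 1 h3 (henc _ (hbits1.mono (by omega))) ?_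
  refine Runs.copy (T := n * (S * 8 + 5) + 1) 0 (by simp [h6]) h0B ?_
  refine Runs.cons (T₂ := 0) (n * (S * 8 + 4 + 1) + 1) (Runs.loop_count (I := fun k s =>
      s.var 17 = k ∧ ∃ θ, s.var 16 = θ ∧ 0 < θ ∧ θ ≤ 1 ∧ RatBits (2 * M + 1) θ ∧
        ∀ j : Fin n, (j : ℕ) < k → ∀ l < S, v j 0 < v j l → θ ≤ v j l - v j 0) _ n ?_ ?_
      ⟨by simp, 1, by simp, one_pos, le_rfl, hbits1.mono (by omega), fun j hj => by omega⟩) ?_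
      (le_of_eq (by ring))
  · rintro k hk s' hf ⟨h17, -⟩
    change s'.var 17 < s'.var 0 ↔ _
    rw [h17, hf.1 0 rfl]
    simp [h0]
  · rintro k hk s₁ hf ⟨h17, θ, h16, hθ, hθ1, hθb, hθl⟩
    have e3 : s₁.var 3 = 1 := by rw [hf.1 3 rfl]; simp [h3]
    have e6 : s₁.var 6 = 0 := by rw [hf.1 6 rfl]; simp [h6]
    have e14 : s₁.var 14 = S := by rw [hf.1 14 rfl]; simp [h14]
    have ea : ∀ i ≤ S, s₁.arr 0 i = G i := fun i hi => by rw [hf.2 0 rfl]; simp [ha i hi]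
    refine Runs.query (T := S * 8 + 3) (v ⟨k, hk⟩ 0) ⟨k, hk⟩ 0 h17 e6 (by simp)
      (by rw [← hv, hG.zero]) (henc _ ((hvM _ _).mono (by omega))) ?_
    refine Runs.copy (T := S * 8 + 2) 0 (by simp [e6]) h0B ?_
    refine Runs.cons (T₂ := 1) (S * (7 + 1) + 1) (Runs.loop_count (I := fun m s =>
      s.var 19 = m ∧ ∃ θ, s.var 16 = θ ∧ 0 < θ ∧ θ ≤ 1 ∧ RatBits (2 * M + 1) θ ∧
        (∀ j : Fin n, (j : ℕ) < k → ∀ l < S, v j 0 < v j l → θ ≤ v j l - v j 0) ∧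
        ∀ l < m, v ⟨k, hk⟩ 0 < v ⟨k, hk⟩ l → θ ≤ v ⟨k, hk⟩ l - v ⟨k, hk⟩ 0) _ S ?_ ?_
      ⟨by simp, θ, by simp [h16], hθ, hθ1, hθb, hθl, fun l hl => by omega⟩) ?_ (by omega)
    · rintro m hm s' hf' ⟨h19, -⟩
      change s'.var 19 < s'.var 14 ↔ _
      rw [h19, hf'.1 14 rfl]
      simp [e14]
    · rintro m hm s₂ hf₂ ⟨h19, θ, h16, hθ, hθ1, hθb, hθl, hθk⟩
      have d3 : s₂.var 3 = 1 := by rw [hf₂.1 3 rfl]; simp [e3]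
      have d6 : s₂.var 6 = 0 := by rw [hf₂.1 6 rfl]; simp [e6]
      have d17 : s₂.var 17 = k := by rw [hf₂.1 17 rfl]; simp [h17]
      have d18 : s₂.var 18 = v ⟨k, hk⟩ 0 := by rw [hf₂.1 18 rfl]; simp
      have da : s₂.arr 0 m = G m := by rw [hf₂.2 0 rfl]; simp [ea m hm.le]
      have hdb : RatBits (2 * M + 1) (v ⟨k, hk⟩ m - v ⟨k, hk⟩ 0) :=
        ((hvM ⟨k, hk⟩ m).sub (hvM ⟨k, hk⟩ 0)).mono (by omega)
      refine Runs.load (T := 6) m (G m) h19 da (henc _ ((hG.bits hN m).mono (by omega))) ?_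
      refine Runs.query (v ⟨k, hk⟩ m) ⟨k, hk⟩ (G m) (by simp [d17]) (by simp)
        ⟨hG.nonneg m, hG.le_one m⟩ (hv _ _) (henc _ ((hvM _ _).mono (by omega))) ?_
      refine Runs.sub (v ⟨k, hk⟩ m - v ⟨k, hk⟩ 0) (by simp [d18]) (henc _ (hdb.mono (by omega))) ?_
      set s₃ := ((s₂.setVar 20 (G m)).setVar 21 (v ⟨k, hk⟩ m)).setVar 21
        (v ⟨k, hk⟩ m - v ⟨k, hk⟩ 0) with hs₃
      have c6 : s₃.var 6 = 0 := by simp [hs₃, d6]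
      have c21 : s₃.var 21 = v ⟨k, hk⟩ m - v ⟨k, hk⟩ 0 := by simp [hs₃]
      have c16 : s₃.var 16 = θ := by simp [hs₃, h16]
      refine Runs.cons (2 + 1) (T₂ := 1) (R := fun s' => ∃ θ', s'.var 16 = θ' ∧ 0 < θ' ∧ θ' ≤ θ ∧
        RatBits (2 * M + 1) θ' ∧ (v ⟨k, hk⟩ 0 < v ⟨k, hk⟩ m → θ' ≤ v ⟨k, hk⟩ m - v ⟨k, hk⟩ 0))
        ?_ ?_ (by omega)
      · refine Runs.branch (fun hg => ?_) (fun hg => Runs.nil ⟨θ, c16, hθ, le_rfl, hθb, fun h => ?_⟩)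
        · have hpos : 0 < v ⟨k, hk⟩ m - v ⟨k, hk⟩ 0 := by
            simpa only [RatTest.Holds, c6, c21] using hg
          refine Runs.cons (1 + 1) (T₂ := 0) (Runs.branch (fun hg => ?_) (fun hg => ?_))
            (fun s' _ h => Runs.nil h) le_rfl
          · have hlt : v ⟨k, hk⟩ m - v ⟨k, hk⟩ 0 < θ := by
              simpa only [RatTest.Holds, c16, c21] using hg
            refine Runs.copy _ c21 (henc _ (hdb.mono (by omega))) (Runs.nil ?_)
            exact ⟨_, by simp, hpos, hlt.le, hdb, fun _ => le_rfl⟩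
          · have hlt : ¬ v ⟨k, hk⟩ m - v ⟨k, hk⟩ 0 < θ := by
              simpa only [RatTest.Holds, c16, c21] using hg
            exact Runs.nil ⟨θ, c16, hθ, le_rfl, hθb, fun _ => not_lt.1 hlt⟩
        · refine absurd (sub_pos.2 h) ?_
          simpa only [RatTest.Holds, c6, c21] using hg
      · rintro s₄ hf₄ ⟨θ', h16', hθ', hle, hb', hm'⟩
        have b19 : s₄.var 19 = m := by rw [hf₄.1 19 rfl]; simp [hs₃, h19]
        have b3 : s₄.var 3 = 1 := by rw [hf₄.1 3 rfl]; simp [hs₃, d3]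
        refine Runs.add ((m + 1 : ℕ) : ℚ) (by simp [b19, b3]) (hnat _ (by omega)) (Runs.nil ?_)
        refine ⟨by simp, θ', by simp [h16'], hθ', hle.trans hθ1, hb',
          fun j hj l hl h => hle.trans (hθl j hj l hl h), fun l hl h => ?_⟩
        rcases Nat.lt_succ_iff_lt_or_eq.1 hl with h' | rfl
        · exact hle.trans (hθk l h' h)
        · exact hm' h
    · rintro s₂ hf₂ ⟨h19, θ, h16, hθ, hθ1, hθb, hθl, hθk⟩
      have d3 : s₂.var 3 = 1 := by rw [hf₂.1 3 rfl]; simp [e3]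
      have d17 : s₂.var 17 = k := by rw [hf₂.1 17 rfl]; simp [h17]
      refine Runs.add ((k + 1 : ℕ) : ℚ) (by simp [d17, d3]) (hnat _ (by omega)) (Runs.nil ?_)
      refine ⟨by simp, θ, by simp [h16], hθ, hθ1, hθb, fun j hj l hl h => ?_⟩
      rcases Nat.lt_succ_iff_lt_or_eq.1 hj with h' | h'
      · exact hθl j h' l hl h
      · obtain rfl : j = ⟨k, hk⟩ := Fin.ext h'
        exact hθk l hl h
  · rintro s' hf ⟨-, θ, h16, hθ, hθ1, hθb, hθl⟩
    exact Runs.nil ⟨θ, h16, hθ, hθ1, hθb, fun j => hθl j j.2⟩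

end VolProg

/-- The scaled and rounded function values. -/
def scaledVal {n : ℕ} (v : Fin n → ℕ → ℚ) (E : ℚ) (j l : ℕ) : ℕ :=
  if h : j < n then ⌊v ⟨j, h⟩ l * E⌋₊ else 0

/-- The result of a round. -/
noncomputable def approxValue {n : ℕ} (v : Fin n → ℕ → ℚ) (G : ℕ → ℚ) (S : ℕ) (E b : ℚ) : ℚ :=
  stepFun G S (stageThreshold G S (scaledVal v E) (⌊b * E⌋₊ + 1) n) ⌊b * E⌋₊

/-! ### One round, the setup, and the doubling of the grid exponent -/

namespace VolProg

open RatProg RatInstr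

variable {n : ℕ} {f : Fin n → ℝ → ℝ} {B M : ℕ} {s : RatState} {b : ℚ}

/-- The leading term comes from `n` stages with `S` bisections of `8 * M + 1` sweeps each. Every
monomial on the left divides `n * S ^ 2 * M`, and `420` is the sum of the coefficients. -/
theorem round_time {n S M : ℕ} (hn : 0 < n) (hS : 0 < S) (hM : 0 < M) :
    (S * 7 + 6) + ((n * (S * 8 + 5) + 3) + (5 +
      ((n * (S * ((8 * M + 1) * (28 * S + 10) + 18) + 8) + S * 3 + 4) + (S * 8 + 3))))
      ≤ 420 * (n * S ^ 2 * M) := by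
  obtain ⟨n, rfl⟩ := Nat.exists_eq_succ_of_ne_zero hn.ne'
  obtain ⟨S, rfl⟩ := Nat.exists_eq_succ_of_ne_zero hS.ne'
  obtain ⟨M, rfl⟩ := Nat.exists_eq_succ_of_ne_zero hM.ne'
  simp only [Nat.succ_eq_add_one]
  ring_nf
  omega

theorem runs_scale {D : ℕ} {θ : ℚ} (henc : ∀ r : ℚ, RatBits (40 * M) r → encLen r ≤ B)
    (hM : 1 ≤ M) (hDM : D ≤ 2 ^ M) (hθ : 0 < θ) (hθb : RatBits (2 * M + 1) θ) (hb0 : 0 ≤ b)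
    (hb : RatBits M b) (h1 : s.var 1 = b) (h3 : s.var 3 = 1) (h8 : s.var 8 = D)
    (h16 : s.var 16 = θ) :
    scale.Runs f B s 5 (fun s' => s'.var 22 = ((D * D : ℕ) : ℚ) / θ ∧
      s'.var 23 = ⌊b * (((D * D : ℕ) : ℚ) / θ)⌋₊ ∧
      s'.var 24 = ((⌊b * (((D * D : ℕ) : ℚ) / θ)⌋₊ + 1 : ℕ) : ℚ)) := by
  set E := ((D * D : ℕ) : ℚ) / θ with hE
  have hE0 : 0 ≤ E := by positivity
  have hDD : RatBits (M + M) ((D * D : ℕ) : ℚ) := RatBits.natCast (by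
    rw [pow_add]; exact Nat.mul_le_mul hDM hDM)
  have hEb := hDD.div hθb
  have hbE := hb.mul hEb
  have hfl : (⌊b * E⌋ : ℚ) = (⌊b * E⌋₊ : ℚ) :=
    (natCast_floor_eq_intCast_floor (mul_nonneg hb0 hE0)).symm
  have hle : ⌊b * E⌋₊ ≤ 2 ^ (M + (M + M + (2 * M + 1))) := by
    refine Nat.floor_le_of_le ?_
    push_cast
    exact (le_abs_self _).trans hbE.abs_le
  unfold scale
  refine Runs.mul ((D * D : ℕ) : ℚ) (by rw [h8]; push_cast; rfl)
    (henc _ (hDD.mono (by omega))) ?_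
  refine Runs.div E (by simp [h16, hθ.ne']) (by simp [h16, hE]) (henc _ (hEb.mono (by omega))) ?_
  refine Runs.mul (b * E) (by simp [h1]) (henc _ (hbE.mono (by omega))) ?_
  refine Runs.floor (⌊b * E⌋₊ : ℚ) (by simp [hfl])
    (henc _ ((RatBits.natCast hle).mono (by omega))) ?_
  refine Runs.add ((⌊b * E⌋₊ + 1 : ℕ) : ℚ) (by simp [h3])
    (henc _ ((RatBits.natCast (M := M + (M + M + (2 * M + 1)) + 1) ?_).mono (by omega))) ?_
  · have := Nat.one_le_two_pow (n := M + (M + M + (2 * M + 1)))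
    rw [pow_succ]
    omega
  · exact Runs.nil ⟨by simp, by simp, by simp⟩

theorem runs_round {P D m : ℕ} {v : Fin n → ℕ → ℚ}
    (henc : ∀ r : ℚ, RatBits (40 * M) r → encLen r ≤ B) (hM : 1 ≤ M)
    (hn0 : 0 < n) (hn : n ≤ 2 ^ M) (hP : 0 < P) (hD : 0 < D) (hPD : P * D ≤ 2 ^ M)
    (hmM : m + 1 ≤ 2 ^ M) (hm : 1 ≤ gridAux P D m) (hlt : ∀ i < m, gridAux P D i < 1)
    (hv : ∀ j l, f j (gridPt P D l : ℝ) = (v j l : ℝ)) (hvM : ∀ j l, RatBits M (v j l))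
    (hv0 : ∀ j l, 0 ≤ v j l) (hvm : ∀ j, Monotone (v j)) (hb0 : 0 ≤ b) (hb : RatBits M b)
    (h0 : s.var 0 = n) (h1 : s.var 1 = b) (h3 : s.var 3 = 1) (h5 : s.var 5 = 1 / 2)
    (h6 : s.var 6 = 0) (h8 : s.var 8 = D) (h9 : s.var 9 = P) :
    round.Runs f B s (420 * (n * (m + 1) ^ 2 * M)) (fun s' => ∃ θ,
      IsIncrement n (m + 1) M v θ ∧
      s'.var 12 = approxValue v (gridPt P D) (m + 1) (((D * D : ℕ) : ℚ) / θ) b) := by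
  have hG := isGrid_gridPt hP hD hm
  have hDM : D ≤ 2 ^ M := (Nat.le_mul_of_pos_left D hP).trans hPD
  unfold round
  refine Runs.cons ((m + 1) * 7 + 6) _ ((runs_grid (s := s) henc hM hP hD hPD hmM hm hlt h3 h6 h8
    h9).time (by omega)) ?_ (round_time hn0 (Nat.succ_pos m) hM)
  rintro s₁ hf₁ ⟨h14, hg⟩
  refine Runs.cons _ _ (runs_increment (s := s₁) henc hM hG hPD hmM hn hv hvM
    ((hf₁.1 0 rfl).trans h0) ((hf₁.1 3 rfl).trans h3) ((hf₁.1 6 rfl).trans h6) h14 hg) ?_ le_rfl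
  rintro s₂ hf₂ ⟨θ, h16, hθ⟩
  have hθ0 := hθ.pos
  refine Runs.cons _ _ (runs_scale (s := s₂) henc hM hDM hθ.pos hθ.bits hb0 hb
    ((hf₂.1 1 rfl).trans ((hf₁.1 1 rfl).trans h1)) ((hf₂.1 3 rfl).trans ((hf₁.1 3 rfl).trans h3))
    ((hf₂.1 8 rfl).trans ((hf₁.1 8 rfl).trans h8)) h16) ?_ le_rfl
  rintro s₃ hf₃ ⟨h22, h23, h24⟩
  set E := ((D * D : ℕ) : ℚ) / θ with hE
  have hE0 : 0 ≤ E := by positivity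
  have hDD : RatBits (M + M) ((D * D : ℕ) : ℚ) := RatBits.natCast (by
    rw [pow_add]; exact Nat.mul_le_mul hDM hDM)
  -- `D * D` has `2 * M` bits and `θ` has `2 * M + 1`, so the quotient has `4 * M + 1`. A product
  -- with `M`-bit data then has `5 * M + 1`, which leaves room for the successor below `2 ^ (8 *
  -- M)`.
  have hEb : RatBits (7 * M) E := (hDD.div hθ.bits).mono (by omega)
  have hfloor : ∀ r : ℚ, RatBits M r → ⌊r * E⌋₊ + 1 ≤ 2 ^ (8 * M) := fun r hr => by
    have h := (hr.mul (hDD.div hθ.bits)).abs_le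
    have hle : ⌊r * E⌋₊ ≤ 2 ^ (M + (M + M + (2 * M + 1))) := by
      refine Nat.floor_le_of_le ?_
      push_cast
      exact (le_abs_self _).trans h
    have h1 : (1 : ℕ) ≤ 2 ^ (M + (M + M + (2 * M + 1))) := Nat.one_le_two_pow
    calc ⌊r * E⌋₊ + 1 ≤ 2 ^ (M + (M + M + (2 * M + 1)) + 1) := by rw [pow_succ]; omega
      _ ≤ _ := Nat.pow_le_pow_right (by norm_num) (by omega)
  have hR : Room B M (m + 1) (P * D) ⌊b * E⌋₊ := ⟨henc, hM, hmM, hPD, hfloor b hb⟩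
  have hB : Base n (gridPt P D) (m + 1) E ⌊b * E⌋₊ s₃ := by
    refine ⟨?_, ?_, ?_, ?_, ?_, h22, h23, h24, fun i hi => ?_⟩
    · rw [hf₃.1 0 rfl, hf₂.1 0 rfl, hf₁.1 0 rfl, h0]
    · rw [hf₃.1 3 rfl, hf₂.1 3 rfl, hf₁.1 3 rfl, h3]
    · rw [hf₃.1 5 rfl, hf₂.1 5 rfl, hf₁.1 5 rfl, h5]
    · rw [hf₃.1 6 rfl, hf₂.1 6 rfl, hf₁.1 6 rfl, h6]
    · rw [hf₃.1 14 rfl, hf₂.1 14 rfl, h14]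
    · rw [hf₃.2 0 rfl, hf₂.2 0 rfl, hg i hi]
  refine Runs.cons _ _ (runs_stages (F := scaledVal v E) (q := 8 * M + 1) hG hR hn
    (fun j l _ => hv j l) (fun j l _ => hvM j l) hEb ?_ ?_ ?_ ?_ hB) ?_ le_rfl
  · intro j l _
    rw [scaledVal, dif_pos j.2, natCast_floor_eq_intCast_floor (mul_nonneg (hv0 j l) hE0)]
  · intro j hj l _
    rw [scaledVal, dif_pos hj]
    exact (Nat.le_succ _).trans (hfloor _ (hvM _ _))
  · intro j hj l l' hll
    simp only [scaledVal, dif_pos hj]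
    exact Nat.floor_mono (mul_le_mul_of_nonneg_right (hvm _ hll) hE0)
  · have := hfloor b hb
    rw [pow_succ]; omega
  intro s₄ hf₄ h2
  refine Runs.cons (T₂ := 0) (T := (m + 1) * 8 + 3) _ (runs_evaluate hG hR
    (fun i _ => stageThreshold_le n i) (hB.frame hf₄ rfl) h2) ?_ le_rfl
  intro s₅ _ h12
  exact Runs.nil ⟨θ, hθ, h12⟩

/-- The product of variables `7` and `8` stays `24 * n`. The exponent `d₀` is known only to the
analysis: it suffices for the test, so it bounds the number of halvings. The setup uses the loop
twice, against `1` and then against `ε`, which amounts to `min ε 1`. -/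
theorem runs_halve {x d d₀ : ℕ} {e : ℚ} (henc : ∀ r : ℚ, RatBits (40 * M) r → encLen r ≤ B)
    (hd₀ : d₀ ≤ M) (hn : 24 * n ≤ 2 ^ d₀) (he : 24 * (n : ℚ) / 2 ^ d₀ ≤ e) (hd : d ≤ d₀)
    (hx : (block [instr (mul 7 7 5), instr (mul 8 8 4)]).writesVar x = false)
    (h4 : s.var 4 = 2) (h5 : s.var 5 = 1 / 2) (hs : s.var x = e)
    (h7 : s.var 7 = 24 * (n : ℚ) / 2 ^ d) (h8 : s.var 8 = 2 ^ d) :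
    (loop (.lt x 7) (block [instr (mul 7 7 5), instr (mul 8 8 4)])).Runs f B s (d₀ * 3 + 1)
      (fun s' => ∃ d', d ≤ d' ∧ d' ≤ d₀ ∧ s'.var 7 = 24 * (n : ℚ) / 2 ^ d' ∧ s'.var 8 = 2 ^ d' ∧
        24 * (n : ℚ) / 2 ^ d' ≤ e) := by
  have hpow : ∀ d ≤ d₀, 2 ^ d ≤ 2 ^ M := fun d h =>
    Nat.pow_le_pow_right (by norm_num) (h.trans hd₀)
  refine (Runs.loop_measure (c := 2) (I := fun k s => ∃ d', d ≤ d' ∧ d' ≤ d₀ ∧ k = d₀ - d' ∧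
    s.var 7 = 24 * (n : ℚ) / 2 ^ d' ∧ s.var 8 = 2 ^ d') s ?_ (d₀ - d)
    ⟨d, le_rfl, hd, rfl, h7, h8⟩).weaken (by omega) ?_
  · rintro k s₁ hf ⟨d', hd', hle, rfl, h7, h8⟩ hg
    have e5 : s₁.var 5 = 1 / 2 := (hf.1 5 rfl).trans h5
    have e4 : s₁.var 4 = 2 := (hf.1 4 rfl).trans h4
    have hlt : d' < d₀ := by
      refine lt_of_le_of_ne hle ?_
      rintro rfl
      have : s₁.var x < s₁.var 7 := hg
      rw [h7, hf.1 x hx, hs] at this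
      exact absurd he (not_le.2 this)
    refine Runs.mul (24 * (n : ℚ) / 2 ^ (d' + 1)) (by rw [h7, e5, pow_succ]; field_simp) ?_ ?_
    · refine henc _ ((RatBits.of_div (M := M) (a := (24 * n : ℕ)) (c := 2 ^ (d' + 1)) (by positivity)
        ?_ (hpow _ hlt) (by push_cast; rfl)).mono (by omega))
      rw [Int.natAbs_natCast]
      exact hn.trans (hpow _ le_rfl)
    refine Runs.mul (2 ^ (d' + 1)) (by simp [h8, e4, pow_succ]) ?_ (Runs.nil ?_)
    · have := henc _ ((RatBits.natCast (hpow _ hlt)).mono (by omega))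
      simpa using this
    · exact ⟨d₀ - (d' + 1), by omega, d' + 1, by omega, hlt, rfl, by simp, by simp⟩
  · rintro s' hf ⟨⟨k, d', hd', hle, rfl, h7, h8⟩, hg⟩
    refine ⟨d', hd', hle, h7, h8, ?_⟩
    have : ¬ s'.var x < s'.var 7 := hg
    rw [h7, hf.1 x hx, hs] at this
    exact not_lt.1 this

theorem runs_setup {d₀ : ℕ} {ε : ℚ} (henc : ∀ r : ℚ, RatBits (40 * M) r → encLen r ≤ B)
    (hM : 5 ≤ M)
    (hd₀ : 2 * d₀ ≤ M) (hn0 : 0 < n) (hn : 24 * n ≤ 2 ^ d₀) (he : 24 * (n : ℚ) / 2 ^ d₀ ≤ ε)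
    (h0 : s.var 0 = n) (h2 : s.var 2 = ε) :
    setup.Runs f B s (d₀ * 6 + 13) (fun s' => ∃ d ≤ d₀, 24 * n ≤ 2 ^ d ∧
      24 * (n : ℚ) / 2 ^ d ≤ ε ∧ s'.var 3 = 1 ∧ s'.var 5 = 1 / 2 ∧ s'.var 6 = 0 ∧
      s'.var 8 = ((2 ^ d : ℕ) : ℚ) ∧ s'.var 9 = 2 ∧ s'.var 10 = ((n * 2 * 2 ^ d : ℕ) : ℚ) ∧
      s'.var 11 = 0) := by
  have h2M : 2 ^ 5 ≤ 2 ^ M := Nat.pow_le_pow_right (by norm_num) hM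
  have hnat : ∀ k : ℕ, k ≤ 2 ^ M → encLen (k : ℚ) ≤ B := fun k hk =>
    henc _ ((RatBits.natCast hk).mono (by omega))
  have h24 : 24 * n ≤ 2 ^ M := hn.trans (Nat.pow_le_pow_right (by norm_num) (by omega))
  have e1 : encLen 1 ≤ B := by simpa using hnat 1 (by omega)
  have e0 : encLen 0 ≤ B := by simpa using hnat 0 (by omega)
  have e2 : encLen 2 ≤ B := by simpa using hnat 2 (by omega)
  have e24 : encLen 24 ≤ B := by simpa using hnat 24 (by omega)
  have eh : encLen (1 / 2) ≤ B := henc _ ((RatBits.of_div (M := M) (a := 1) (c := 2) (by norm_num)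
    (by simpa using Nat.one_le_two_pow) (by omega) (by norm_num)).mono (by omega))
  unfold setup
  refine Runs.const (T := d₀ * 6 + 12) e1 ?_
  refine Runs.const (T := d₀ * 6 + 11) e2 ?_
  refine Runs.const (T := d₀ * 6 + 10) eh ?_
  refine Runs.const (T := d₀ * 6 + 9) e0 ?_
  refine Runs.const (T := d₀ * 6 + 8) e24 ?_
  refine Runs.mul (T := d₀ * 6 + 7) ((24 * n : ℕ) : ℚ) (by simp [h0]) (hnat _ h24) ?_
  refine Runs.const (T := d₀ * 6 + 6) e1 ?_
  refine Runs.cons (d₀ * 3 + 1) (d₀ * 3 + 5) (runs_halve (x := 3) (d := 0) (e := 1) henc (by omega) hn ?_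
    (Nat.zero_le _) rfl (by simp) (by simp) (by simp) (by simp) (by simp)) ?_ (by omega)
  · rw [div_le_one (by positivity)]
    exact_mod_cast hn
  rintro s₁ hf₁ ⟨d₁, -, hd₁, h7, h8, hle₁⟩
  refine Runs.cons (d₀ * 3 + 1) 4 (runs_halve (x := 2) (d := d₁) (e := ε) henc (by omega) hn he
    hd₁ rfl ((hf₁.1 4 rfl).trans (by simp)) ((hf₁.1 5 rfl).trans (by simp))
    ((hf₁.1 2 rfl).trans (by simp [h2])) h7 h8) ?_ (by omega)
  rintro s₂ hf₂ ⟨d₂, hd₂, hd₂', h7', h8', hle₂⟩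
  have hn2 : 24 * n ≤ 2 ^ d₂ := by
    have h := (div_le_one (by positivity : (0 : ℚ) < 2 ^ d₁)).1 hle₁
    have : 24 * n ≤ 2 ^ d₁ := by exact_mod_cast h
    exact this.trans (Nat.pow_le_pow_right (by norm_num) hd₂)
  have hnM : n * 2 * 2 ^ d₂ ≤ 2 ^ M := by
    calc n * 2 * 2 ^ d₂ ≤ 2 ^ d₂ * 2 ^ d₂ := Nat.mul_le_mul_right _ (by omega)
      _ = 2 ^ (2 * d₂) := by rw [two_mul, pow_add]
      _ ≤ 2 ^ M := Nat.pow_le_pow_right (by norm_num) (by omega)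
  have g0 : s₂.var 0 = n := by rw [hf₂.1 0 rfl, hf₁.1 0 rfl]; simp [h0]
  have g4 : s₂.var 4 = 2 := by rw [hf₂.1 4 rfl, hf₁.1 4 rfl]; simp
  have g3 : s₂.var 3 = 1 := by rw [hf₂.1 3 rfl, hf₁.1 3 rfl]; simp
  have g5 : s₂.var 5 = 1 / 2 := by rw [hf₂.1 5 rfl, hf₁.1 5 rfl]; simp
  have g6 : s₂.var 6 = 0 := by rw [hf₂.1 6 rfl, hf₁.1 6 rfl]; simp
  refine Runs.mul ((n * 2 : ℕ) : ℚ) (by simp [g0, g4]) (hnat _ (by omega)) ?_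
  refine Runs.mul ((n * 2 * 2 ^ d₂ : ℕ) : ℚ) (by simp [h8']) (hnat _ hnM) ?_
  refine Runs.const e2 (Runs.const e0 (Runs.nil ?_))
  exact ⟨d₂, hd₂', hn2, hle₂, by simp [g3], by simp [g5], by simp [g6], by simp [h8'],
    by simp, by simp, by simp⟩

/-- `Z` is the result of the round with parameters `d` and `K`. -/
def IsRoundResult {n : ℕ} (val : Fin n → ℚ → ℚ) (b : ℚ) (M d K : ℕ) (Z : ℚ) : Prop :=
  ∃ (m : ℕ) (θ : ℚ), 1 ≤ gridAux (2 ^ K) (2 ^ d) m ∧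
    IsIncrement n (m + 1) M (fun j l => val j (gridPt (2 ^ K) (2 ^ d) l)) θ ∧
    Z = approxValue (fun j l => val j (gridPt (2 ^ K) (2 ^ d) l)) (gridPt (2 ^ K) (2 ^ d)) (m + 1)
      (((2 ^ d * 2 ^ d : ℕ) : ℚ) / θ) b

theorem IsRoundResult.bits {val : Fin n → ℚ → ℚ} {d K : ℕ} {Z : ℚ}
    (h : IsRoundResult val b M d K Z) (hKd : K + d ≤ M) : RatBits M Z := by
  obtain ⟨m, θ, hm, -, rfl⟩ := h
  have hG := isGrid_gridPt (P := 2 ^ K) (D := 2 ^ d) (by positivity) (by positivity) hm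
  unfold approxValue
  obtain ⟨k, hk⟩ := hG.stepFun_mult (stageThreshold (gridPt (2 ^ K) (2 ^ d)) (m + 1)
    (scaledVal (fun j l => val j (gridPt (2 ^ K) (2 ^ d) l)) (((2 ^ d * 2 ^ d : ℕ) : ℚ) / θ))
    (⌊b * (((2 ^ d * 2 ^ d : ℕ) : ℚ) / θ)⌋₊ + 1) n) ⌊b * (((2 ^ d * 2 ^ d : ℕ) : ℚ) / θ)⌋₊
  refine IsGrid.bits_of_mult hG.pos hk (hG.stepFun_nonneg _ _) (hG.stepFun_le_one _ _) ?_
  rw [← pow_add]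
  exact Nat.pow_le_pow_right (by norm_num) hKd

theorem exists_cells {P D : ℕ} (hD : 0 < D) {K : ℕ} (hP : P = 2 ^ K) :
    ∃ m ≤ 2 * D * K, 1 ≤ gridAux P D m ∧ ∀ i < m, gridAux P D i < 1 := by
  classical
  have h : 1 ≤ gridAux P D (2 * D * K) := by
    have hP0 : 0 < P := by rw [hP]; positivity
    have := two_pow_le_gridAux (P := P) hP0 hD K
    have e : (2 : ℚ) ^ K / P = 1 := by
      rw [hP]; push_cast; exact div_self (by positivity)
    rwa [e] at this
  have hex : ∃ i, 1 ≤ gridAux P D i := ⟨_, h⟩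
  exact ⟨Nat.find hex, Nat.find_min' hex h, Nat.find_spec hex,
    fun i hi => not_le.1 (Nat.find_min hex hi)⟩

/-- There are at most `3 * D * K` cells, and `420 * 9 = 3780`; the rest of `3800` covers the single
operations. -/
theorem cells_time {n D K M m : ℕ} (hn : 0 < n) (hD : 0 < D) (hK : 0 < K) (hM : 0 < M)
    (hm : m ≤ 2 * D * K) :
    1 + (420 * (n * (m + 1) ^ 2 * M) + 1) + 1 ≤ 3800 * (n * D ^ 2 * M) * K ^ 2 := by
  have hDK : 1 ≤ D * K := Nat.mul_pos hD hK
  have h1 : m + 1 ≤ 3 * (D * K) := by nlinarith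
  have h2 : (m + 1) ^ 2 ≤ 9 * (D * K) ^ 2 := by
    calc (m + 1) ^ 2 ≤ (3 * (D * K)) ^ 2 := Nat.pow_le_pow_left h1 2
      _ = _ := by ring
  have h3 : n * (m + 1) ^ 2 * M ≤ n * (9 * (D * K) ^ 2) * M := by gcongr
  have h4 : 1 ≤ n * (D * K) ^ 2 * M := Nat.mul_pos (Nat.mul_pos hn (by positivity)) hM
  calc 1 + (420 * (n * (m + 1) ^ 2 * M) + 1) + 1
      ≤ 3800 * (n * (D * K) ^ 2 * M) := by nlinarith
    _ = _ := by ring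

/-- The parameters of a run: at most `M` bits are needed for the data, and `Ks` bits for the
reciprocal of the first grid point are known to be sufficient. -/
structure RunData {n : ℕ} (f : Fin n → ℝ → ℝ) (val : Fin n → ℚ → ℚ) (b : ℚ)
    (B M Lo d Ks : ℕ) : Prop where
  enc : ∀ r : ℚ, RatBits (40 * M) r → encLen r ≤ B
  n_pos : 0 < n
  n_le : 24 * n ≤ 2 ^ d
  size : 2 * Ks + d + 2 ≤ M
  Ks_ge : Lo + 2 * d ≤ Ks
  val_eq : ∀ j, ∀ x ∈ Icc (0 : ℚ) 1, f j (x : ℝ) = (val j x : ℝ)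
  val_bits : ∀ j K l, K ≤ 2 * Ks → RatBits M (val j (gridPt (2 ^ K) (2 ^ d) l))
  val_nonneg : ∀ j, ∀ x ∈ Icc (0 : ℚ) 1, 0 ≤ val j x
  val_mono : ∀ j, MonotoneOn (val j) (Icc 0 1)
  b_nonneg : 0 ≤ b
  b_bits : RatBits M b
  low : ∀ K Z, IsRoundResult val b M d K Z → 1 ≤ Z * 2 ^ Lo

/-- The state between two rounds. -/
structure RoundState {n : ℕ} (val : Fin n → ℚ → ℚ) (b : ℚ) (M d K : ℕ) (s : RatState) : Prop where
  v0 : s.var 0 = n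
  v1 : s.var 1 = b
  v3 : s.var 3 = 1
  v5 : s.var 5 = 1 / 2
  v6 : s.var 6 = 0
  v8 : s.var 8 = ((2 ^ d : ℕ) : ℚ)
  v9 : s.var 9 = 2 ^ K
  v10 : s.var 10 = ((n * 2 * 2 ^ d : ℕ) : ℚ)
  result : (K = 1 ∧ s.var 11 = 0) ∨
    ∃ Z, IsRoundResult val b M d K Z ∧ s.var 12 = Z ∧ s.var 11 = Z * 2 ^ K

/-- The number `k` is fuel for the induction, and `y` is a time budget in units of `3800 * n * D ^ 2
* M`. The round with exponent `2 * K` spends `(2 * K) ^ 2` units. As these costs form a geometric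
series, a budget of `8 * Ks ^ 2 - 2 * K ^ 2` lasts from exponent `K` on. -/
theorem runs_rounds {val : Fin n → ℚ → ℚ} {Lo d Ks : ℕ} (hR : RunData f val b B M Lo d Ks)
    (k K y : ℕ) (hk : 2 * Ks < K + k) (hK0 : 0 < K) (hK : K ≤ 2 * Ks)
    (hy : 8 * Ks ^ 2 ≤ y + 2 * K ^ 2) (hs : RoundState val b M d K s) :
    (loop (.lt 11 10) (block [instr (mul 9 9 9), round, instr (mul 11 12 9)])).Runs f B s
      (3800 * (n * (2 ^ d) ^ 2 * M) * y + 1) (fun s' => ∃ K Z, K ≤ 2 * Ks ∧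
        IsRoundResult val b M d K Z ∧ s'.var 12 = Z ∧ 2 * (n : ℚ) * 2 ^ d ≤ Z * 2 ^ K) := by
  induction k generalizing K y s with
  | zero => omega
  | succ k ih =>
    have hM := hR.size
    have hnp : 0 < n := hR.n_pos
    have hd2 : 24 * n ≤ 2 ^ d := hR.n_le
    have hd0 : 0 < d := by
      rcases Nat.eq_zero_or_pos d with h | h
      · rw [h] at hd2; omega
      · exact h
    have hKs := hR.Ks_ge
    by_cases hg : (RatTest.lt 11 10).Holds s
    swap
    · refine (Runs.loop_false hg ?_).time (by omega)
      have h' : ¬ s.var 11 < s.var 10 := hg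
      rcases hs.result with ⟨-, h11⟩ | ⟨Z, hZ, h12, h11⟩
      · refine absurd ?_ h'
        rw [h11, hs.v10]
        positivity
      · refine ⟨K, Z, hK, hZ, h12, ?_⟩
        rw [h11, hs.v10] at h'
        push_cast at h'
        rw [mul_comm 2 (n : ℚ)]
        exact not_lt.1 h'
    · have hKlt : K < Ks := by
        have h' : s.var 11 < s.var 10 := hg
        rcases hs.result with ⟨rfl, -⟩ | ⟨Z, hZ, h12, h11⟩
        · omega
        · by_contra hge
          have hge : Lo + 2 * d ≤ K := by omega
          rw [h11, hs.v10] at h'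
          refine absurd h' (not_lt.2 ?_)
          have h1 := hR.low K Z hZ
          have hZ0 : 0 < Z := by
            by_contra h
            have h2 : (0 : ℚ) < 2 ^ Lo := by positivity
            nlinarith [not_lt.1 h]
          have h3 : ((n * 2 * 2 ^ d : ℕ) : ℚ) ≤ 2 ^ (2 * d) := by
            have : n * 2 * 2 ^ d ≤ 2 ^ (2 * d) := by
              rw [two_mul, pow_add]
              exact Nat.mul_le_mul_right _ (by omega)
            exact_mod_cast this
          calc ((n * 2 * 2 ^ d : ℕ) : ℚ) ≤ 1 * 2 ^ (2 * d) := by rw [one_mul]; exact h3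
            _ ≤ (Z * 2 ^ Lo) * 2 ^ (2 * d) := by gcongr
            _ = Z * 2 ^ (Lo + 2 * d) := by rw [pow_add]; ring
            _ ≤ Z * 2 ^ K := by gcongr; norm_num
      obtain ⟨m, hmle, hm, hlt⟩ := exists_cells (P := 2 ^ (2 * K)) (D := 2 ^ d) (K := 2 * K)
        (by positivity) rfl
      have hpow : ∀ e ≤ M, 2 ^ e ≤ 2 ^ M := fun e he => Nat.pow_le_pow_right (by norm_num) he
      have hmM : m + 1 ≤ 2 ^ M := by
        have h1 : 2 * K + 1 ≤ 2 ^ (2 * K) := Nat.lt_two_pow_self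
        have h2 : (1 : ℕ) ≤ 2 ^ d := Nat.one_le_two_pow
        calc m + 1 ≤ 2 * 2 ^ d * (2 * K) + 1 := by omega
          _ ≤ 2 * 2 ^ d * (2 * K + 1) := by nlinarith
          _ ≤ 2 * 2 ^ d * 2 ^ (2 * K) := Nat.mul_le_mul_left _ h1
          _ = 2 ^ (1 + d + 2 * K) := by rw [pow_add, pow_add]; ring
          _ ≤ 2 ^ M := hpow _ (by omega)
      have hP2 : ((2 ^ (2 * K) : ℕ) : ℚ) = 2 ^ (2 * K) := by push_cast; rfl
      have hPb : RatBits M ((2 ^ (2 * K) : ℕ) : ℚ) := RatBits.natCast (hpow _ (by omega))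
      have hmem : ∀ l, gridPt (2 ^ (2 * K)) (2 ^ d) l ∈ Icc (0 : ℚ) 1 := fun l =>
        ⟨gridPt_nonneg (by positivity) l, gridPt_le_one l⟩
      have hG := isGrid_gridPt (P := 2 ^ (2 * K)) (D := 2 ^ d) (by positivity) (by positivity) hm
      have hy1 : 4 * K ^ 2 ≤ y := by nlinarith
      have htime := cells_time (M := M) hnp (Nat.two_pow_pos d) (K := 2 * K) (by omega) (by omega)
        hmle
      refine (Runs.loop_true (T₁ := 1 + (420 * (n * (m + 1) ^ 2 * M) + 1))
        (T₂ := 3800 * (n * (2 ^ d) ^ 2 * M) * (y - 4 * K ^ 2) + 1)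
        (R := RoundState val b M d (2 * K)) hg ?_ ?_).time ?_
      · rw [Nat.add_comm 1]
        refine Runs.mul ((2 ^ (2 * K) : ℕ) : ℚ) (by rw [hs.v9, hP2, two_mul, pow_add])
          (hR.enc _ (hPb.mono (by omega))) ?_
        refine Runs.cons _ 1 (runs_round (P := 2 ^ (2 * K)) (D := 2 ^ d) (b := b)
          (v := fun j l => val j (gridPt (2 ^ (2 * K)) (2 ^ d) l)) hR.enc (by omega) hnp
          ((by omega : n ≤ 2 ^ d).trans (hpow _ (by omega))) (by positivity) (by positivity)
          (by rw [← pow_add]; exact hpow _ (by omega)) hmM hm hlt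
          (fun j l => hR.val_eq j _ (hmem l)) (fun j l => hR.val_bits j _ l (by omega))
          (fun j l => hR.val_nonneg j _ (hmem l))
          (fun j l l' hll => hR.val_mono j (hmem l) (hmem l') (hG.mono hll)) hR.b_nonneg hR.b_bits
          (by simp [hs.v0]) (by simp [hs.v1]) (by simp [hs.v3]) (by simp [hs.v5]) (by simp [hs.v6])
          (by simp [hs.v8]) (by simp)) ?_ le_rfl
        rintro s₂ hf₂ ⟨θ, hθ, h12⟩
        have hZ : IsRoundResult val b M d (2 * K) (s₂.var 12) := ⟨m, θ, hm, hθ, h12⟩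
        have e9 : s₂.var 9 = 2 ^ (2 * K) := by rw [hf₂.1 9 rfl]; simp
        refine Runs.mul (s₂.var 12 * 2 ^ (2 * K)) (by rw [e9])
          (hR.enc _ (((hZ.bits (by omega)).mul (hP2 ▸ hPb)).mono (by omega))) (Runs.nil ?_)
        refine ⟨?_, ?_, ?_, ?_, ?_, ?_, ?_, ?_, Or.inr ⟨s₂.var 12, hZ, by simp, by simp⟩⟩
        · simp [hf₂.1 0 rfl, hs.v0]
        · simp [hf₂.1 1 rfl, hs.v1]
        · simp [hf₂.1 3 rfl, hs.v3]
        · simp [hf₂.1 5 rfl, hs.v5]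
        · simp [hf₂.1 6 rfl, hs.v6]
        · simp [hf₂.1 8 rfl, hs.v8]
        · simp [e9]
        · simp [hf₂.1 10 rfl, hs.v10]
      · intro s' _ hs'
        refine ih (2 * K) (y - 4 * K ^ 2) (by omega) (by omega) (by omega) ?_ hs'
        have : (2 * K) ^ 2 = 4 * K ^ 2 := by ring
        rw [this]
        omega
      · have e : 3800 * (n * (2 ^ d) ^ 2 * M) * y = 3800 * (n * (2 ^ d) ^ 2 * M) * (2 * K) ^ 2
            + 3800 * (n * (2 ^ d) ^ 2 * M) * (y - 4 * K ^ 2) := by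
          rw [← mul_add]
          congr 1
          have : (2 * K) ^ 2 = 4 * K ^ 2 := by ring
          omega
        rw [e]
        omega

theorem runs_main {val : Fin n → ℚ → ℚ} {Lo d₀ Ks : ℕ} {ε : ℚ}
    (hR : ∀ d ≤ d₀, 24 * n ≤ 2 ^ d → RunData f val b B M Lo d Ks) (hLo : 1 ≤ Lo)
    (hn : 24 * n ≤ 2 ^ d₀) (he : 24 * (n : ℚ) / 2 ^ d₀ ≤ ε) :
    main.Runs f B (RatState.init n b ε)
      (d₀ * 6 + 15 + 3800 * (n * (2 ^ d₀) ^ 2 * M) * (8 * Ks ^ 2)) (fun s => ∃ d K Z, d ≤ d₀ ∧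
        24 * n ≤ 2 ^ d ∧ 24 * (n : ℚ) / 2 ^ d ≤ ε ∧ IsRoundResult val b M d K Z ∧
        s.output = Z ∧ 2 * (n : ℚ) * 2 ^ d ≤ Z * 2 ^ K) := by
  have hR₀ := hR d₀ le_rfl hn
  have h1 := hR₀.size
  have h2 := hR₀.Ks_ge
  have hnp := hR₀.n_pos
  have hd0 : 0 < d₀ := by
    rcases Nat.eq_zero_or_pos d₀ with h | h
    · rw [h] at hn; omega
    · exact h
  unfold main
  refine Runs.cons (d₀ * 6 + 13) (3800 * (n * (2 ^ d₀) ^ 2 * M) * (8 * Ks ^ 2) + 2)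
    (runs_setup hR₀.enc (by omega) (by omega) hnp hn he (by simp [RatState.init])
      (by simp [RatState.init])) ?_ (by omega)
  rintro s₁ hf₁ ⟨d, hd, hnd, hed, h3, h5, h6, h8, h9, h10, h11⟩
  have hRd := hR d hd hnd
  refine Runs.cons (3800 * (n * (2 ^ d₀) ^ 2 * M) * (8 * Ks ^ 2) + 1) 1
    ((runs_rounds hRd (2 * Ks) 1 (8 * Ks ^ 2) (by omega) one_pos (by omega) (by omega) ?_).time ?_)
    ?_ (by omega)
  · refine ⟨?_, ?_, h3, h5, h6, h8, by simpa using h9, h10, Or.inl ⟨rfl, h11⟩⟩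
    · rw [hf₁.1 0 rfl]; simp [RatState.init]
    · rw [hf₁.1 1 rfl]; simp [RatState.init]
  · gcongr
    norm_num
  · rintro s₂ hf₂ ⟨K, Z, hK, hZ, h12, hle⟩
    have hs := hRd.size
    refine Runs.copy Z h12 (hRd.enc _ ((hZ.bits (by omega)).mono (by omega))) (Runs.nil ?_)
    exact ⟨d, K, Z, hd, hnd, hed, hZ, by simp [RatState.output], hle⟩

end VolProg

/-! ### The accuracy of the recursion -/

/-- The recursion without rounding. -/
def exactSum (G : ℕ → ℚ) (S : ℕ) (F : ℕ → ℕ → ℕ) : ℕ → ℕ → ℚ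
  | 0, _ => 1
  | j + 1, y => ∑ l ∈ Finset.range S,
      if F j l ≤ y then (G (l + 1) - G l) * exactSum G S F j (y - F j l) else 0

namespace IsGrid

variable {G : ℕ → ℚ} {S N Y : ℕ} {F T : ℕ → ℕ} {δ : ℚ}

/-- For `y < Y` the threshold of level `i` is at most `y` exactly if `G i < U`. Hence the new step
function takes the least grid value `≥ U`, whose predecessor is below `U`. If that predecessor is
`0`, the value is `G 1`, which explains the additive term. -/
theorem stepFun_threshold (hG : IsGrid G S N) (hδ : 0 ≤ δ)
    (hr : ∀ i ≠ 0, G (i + 1) ≤ (1 + δ) * G i) {y : ℕ} (hy : y < Y) :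
    convSum G S F T y S ≤ stepFun G S (threshold G S F T Y) y ∧
      stepFun G S (threshold G S F T Y) y ≤ (1 + δ) * convSum G S F T y S + G 1 := by
  classical
  set U := convSum G S F T y S with hU
  have hU0 : 0 ≤ U := hG.convSum_nonneg y S
  have hex : ∃ i, S ≤ i ∨ U ≤ G i := ⟨S, Or.inl le_rfl⟩
  obtain ⟨lam, hlam⟩ : ∃ lam, lam = Nat.find hex := ⟨_, rfl⟩
  have hspec : S ≤ lam ∨ U ≤ G lam := hlam ▸ Nat.find_spec hex
  have hmin : ∀ i < lam, i < S ∧ G i < U := fun i hi => by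
    have := Nat.find_min hex (hlam ▸ hi)
    push Not at this
    exact this
  have hlamS : lam ≤ S := hlam ▸ Nat.find_min' hex (Or.inl le_rfl)
  have hW : stepFun G S (threshold G S F T Y) y = G lam := by
    refine hG.stepFun_eq hlamS (fun i hi => hG.threshold_le_iff.2 (Or.inr (hmin i hi).2)) ?_
    intro i hi hiS
    rw [← not_le, hG.threshold_le_iff]
    rintro (h | h)
    · omega
    · rcases hspec with h' | h'
      · omega
      · exact absurd (h'.trans (hG.mono hi)) (not_le.2 h)
  rw [hW]
  refine ⟨?_, ?_⟩
  · rcases hspec with h | h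
    · exact (hG.convSum_le_one y S).trans (hG.one ▸ hG.mono h)
    · exact h
  · have h1 : 0 ≤ (1 + δ) * U := mul_nonneg (by linarith) hU0
    have h2 := hG.nonneg 1
    cases lam with
    | zero => rw [hG.zero]; linarith
    | succ i =>
      rcases eq_or_ne i 0 with rfl | hi
      · simpa using h1
      · have h3 := hr i hi
        have h4 := mul_le_mul_of_nonneg_left (hmin i (Nat.lt_succ_self i)).2.le
          (by linarith : 0 ≤ 1 + δ)
        linarith

/-- Exchanging the sums turns the form that suits the sweep into the form of the recursion for
`exactSum`. -/
theorem convSum_eq (G : ℕ → ℚ) (S : ℕ) (F T : ℕ → ℕ) (y : ℕ) :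
    convSum G S F T y S = ∑ l ∈ Finset.range S,
      if F l ≤ y then (G (l + 1) - G l) * stepFun G S T (y - F l) else 0 := by
  unfold convSum stepFun
  simp_rw [Finset.mul_sum]
  rw [Finset.sum_comm]
  refine Finset.sum_congr rfl fun l _ => ?_
  split_ifs with h
  · refine Finset.sum_congr rfl fun i _ => ?_
    have : F l + T i ≤ y ↔ T i ≤ y - F l := by omega
    simp only [this]
    split_ifs <;> ring
  · refine Finset.sum_eq_zero fun i _ => ?_
    rw [if_neg (by omega), mul_zero]

/-- Each stage adds one factor `1 + δ` and one term `G 1`. The additive error of the earlier stages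
is averaged, not multiplied by the number of cells, because the jumps of the grid sum to `1`. -/
theorem exactSum_le (hG : IsGrid G S N) (hδ : 0 ≤ δ)
    (hr : ∀ i ≠ 0, G (i + 1) ≤ (1 + δ) * G i) (F : ℕ → ℕ → ℕ) (j : ℕ) {y : ℕ} (hy : y < Y) :
    exactSum G S F j y ≤ stepFun G S (stageThreshold G S F Y j) y ∧
      stepFun G S (stageThreshold G S F Y j) y ≤ (1 + δ) ^ j * (exactSum G S F j y + j * G 1) := by
  induction j generalizing y with
  | zero =>
    have : stepFun G S (stageThreshold G S F Y 0) y = 1 := by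
      simp only [stepFun, stageThreshold, Nat.zero_le, if_true]
      rw [sum_jump, hG.one, hG.zero, sub_zero]
    simp [this, exactSum]
  | succ j ih =>
    have hκ := hG.nonneg 1
    have h1 := hG.stepFun_threshold (F := F j) (T := stageThreshold G S F Y j) hδ hr hy
    rw [convSum_eq] at h1
    have hp : (1 : ℚ) ≤ (1 + δ) ^ (j + 1) := one_le_pow₀ (by linarith)
    refine ⟨le_trans (Finset.sum_le_sum fun l _ => ?_) h1.1, h1.2.trans ?_⟩
    · split_ifs
      · exact mul_le_mul_of_nonneg_left (ih (by omega)).1 (hG.jump_nonneg l)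
      · rfl
    · have h2 : (∑ l ∈ Finset.range S, if F j l ≤ y then
          (G (l + 1) - G l) * stepFun G S (stageThreshold G S F Y j) (y - F j l) else 0)
          ≤ (1 + δ) ^ j * (exactSum G S F (j + 1) y + j * G 1) := by
        calc _ ≤ ∑ l ∈ Finset.range S, ((1 + δ) ^ j * (if F j l ≤ y then
              (G (l + 1) - G l) * exactSum G S F j (y - F j l) else 0)
              + (1 + δ) ^ j * (j * G 1) * (G (l + 1) - G l)) := by
              refine Finset.sum_le_sum fun l _ => ?_
              have hj := hG.jump_nonneg l
              split_ifs
              · have := mul_le_mul_of_nonneg_left (ih (y := y - F j l) (by omega)).2 hj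
                linarith
              · have : 0 ≤ (1 + δ) ^ j * (j * G 1) * (G (l + 1) - G l) := by positivity
                linarith
          _ = _ := by
              rw [Finset.sum_add_distrib, ← Finset.mul_sum, ← Finset.mul_sum, sum_jump, hG.one,
                hG.zero, exactSum]
              ring
      have h3 := mul_le_mul_of_nonneg_left h2 (by linarith : 0 ≤ 1 + δ)
      have h4 := mul_le_mul_of_nonneg_right hp hκ
      push_cast
      calc _ ≤ (1 + δ) * ((1 + δ) ^ j * (exactSum G S F (j + 1) y + j * G 1)) + 1 * G 1 := by
            linarith
        _ ≤ (1 + δ) * ((1 + δ) ^ j * (exactSum G S F (j + 1) y + j * G 1))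
            + (1 + δ) ^ (j + 1) * G 1 := by linarith
        _ = _ := by ring

end IsGrid

/-- The recursion splits off the last coordinate, so a tuple of cells is decomposed by `Fin.snoc`.
-/
theorem exactSum_eq (G : ℕ → ℚ) (S : ℕ) (F : ℕ → ℕ → ℕ) (n y : ℕ) :
    exactSum G S F n y = ∑ t : Fin n → Fin S,
      if ∑ j : Fin n, F j (t j) ≤ y then ∏ j, (G (t j + 1) - G (t j)) else 0 := by
  induction n generalizing y with
  | zero => simp [exactSum]
  | succ n ih =>
    rw [exactSum, ← (Fin.snocEquiv fun _ => Fin S).sum_comp, Fintype.sum_prod_type,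
      Finset.sum_range]
    refine Finset.sum_congr rfl fun l _ => ?_
    simp only [Fin.snocEquiv_apply, Fin.sum_univ_castSucc, Fin.prod_univ_castSucc,
      Fin.snoc_castSucc, Fin.snoc_last, Fin.val_castSucc, Fin.val_last]
    split_ifs with h
    · rw [ih, Finset.mul_sum]
      refine Finset.sum_congr rfl fun t _ => ?_
      have : ∑ j : Fin n, F j (t j) ≤ y - F n l ↔ ∑ j : Fin n, F j (t j) + F n l ≤ y := by omega
      simp only [this]
      split_ifs <;> ring
    · refine (Finset.sum_eq_zero fun t _ => ?_).symm
      rw [if_neg (by omega)]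

/-! ### Comparison with the volume -/

section Volume

variable {n : ℕ} {f : Fin n → ℝ → ℝ} {G : ℕ → ℚ} {S N : ℕ}

theorem truncatedCube_subset (f : Fin n → ℝ → ℝ) (b : ℝ) :
    truncatedCube f b ⊆ Icc 0 1 :=
  fun _ hx => ⟨fun j => (hx.1 j).1, fun j => (hx.1 j).2⟩

theorem volume_cube_ne_top : volume (Icc (0 : Fin n → ℝ) 1) ≠ ⊤ :=
  isCompact_Icc.measure_ne_top

theorem IsGrid.exists_cell (hG : IsGrid G S N) {x : ℝ} (hx : x ∈ Icc (0 : ℝ) 1) :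
    ∃ l : Fin S, (G l : ℝ) ≤ x ∧ x ≤ (G (l + 1) : ℝ) := by
  classical
  have hS : S ≠ 0 := by
    rintro rfl
    have := hG.one
    rw [hG.zero] at this
    exact zero_ne_one this
  obtain ⟨m, rfl⟩ := Nat.exists_eq_succ_of_ne_zero hS
  have hm : x ≤ (G (m + 1) : ℝ) := by
    have h := hG.one
    simp only [Nat.succ_eq_add_one] at h
    rw [h]; simpa using hx.2
  have hex : ∃ l, x ≤ (G (l + 1) : ℝ) := ⟨m, hm⟩
  obtain ⟨k, hk⟩ : ∃ k, k = Nat.find hex := ⟨_, rfl⟩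
  refine ⟨⟨k, ?_⟩, ?_, hk ▸ Nat.find_spec hex⟩
  · have : k ≤ m := hk ▸ Nat.find_min' hex hm
    omega
  · cases k with
    | zero => simpa [hG.zero] using hx.1
    | succ k =>
      have := Nat.find_min hex (m := k) (by omega)
      exact (not_le.1 this).le

/-- The tuples of cells that count. -/
noncomputable def goodCells (n S : ℕ) (F : ℕ → ℕ → ℕ) (y : ℕ) : Finset (Fin n → Fin S) :=
  Finset.univ.filter fun t => ∑ j : Fin n, F j (t j) ≤ y

theorem cast_exactSum (G : ℕ → ℚ) (S : ℕ) (F : ℕ → ℕ → ℕ) (n y : ℕ) :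
    (exactSum G S F n y : ℝ)
      = ∑ t ∈ goodCells n S F y, ∏ j, ((G (t j + 1) : ℝ) - (G (t j) : ℝ)) := by
  rw [exactSum_eq, goodCells, Finset.sum_filter]
  push_cast
  refine Finset.sum_congr rfl fun t _ => ?_
  split_ifs <;> simp

/-- Passing to the lower corner of a cell and rounding down only decrease the sum of the values, so
every cell that meets the body is counted. Rounding the bound down loses nothing, since the sum is
an integer. -/
theorem volume_le_exactSum (hG : IsGrid G S N) (hmono : ∀ j, MonotoneOn (f j) (Icc 0 1))
    {v : Fin n → ℕ → ℚ} (hv : ∀ j l, f j (G l : ℝ) = (v j l : ℝ)) (hv0 : ∀ j l, 0 ≤ v j l)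
    {b E : ℚ} (hE : 0 ≤ E) :
    volume.real (truncatedCube f b) ≤ exactSum G S (scaledVal v E) n ⌊b * E⌋₊ := by
  have hGm : ∀ i, (G i : ℝ) ∈ Icc (0 : ℝ) 1 := fun i =>
    ⟨by exact_mod_cast hG.nonneg i, by exact_mod_cast hG.le_one i⟩
  have hle : ∀ i, (G i : ℝ) ≤ G (i + 1) := fun i => by exact_mod_cast hG.mono (Nat.le_succ i)
  have hsub : truncatedCube f b ⊆ ⋃ t ∈ goodCells n S (scaledVal v E) ⌊b * E⌋₊,
      Icc (fun j => (G (t j) : ℝ)) (fun j => (G (t j + 1) : ℝ)) := by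
    intro x hx
    choose t ht using fun j => hG.exists_cell (hx.1 j)
    refine mem_iUnion₂.2 ⟨t, ?_, ⟨fun j => (ht j).1, fun j => (ht j).2⟩⟩
    rw [goodCells, Finset.mem_filter]
    refine ⟨Finset.mem_univ _, Nat.le_floor ?_⟩
    have h1 : ∀ j : Fin n, ((scaledVal v E j (t j) : ℕ) : ℝ) ≤ f j (x j) * E := fun j => by
      rw [scaledVal, dif_pos j.2]
      have h2 : ((⌊v j (t j) * E⌋₊ : ℚ) : ℝ) ≤ ((v j (t j) * E : ℚ) : ℝ) := by
        exact_mod_cast Nat.floor_le (mul_nonneg (hv0 j _) hE)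
      push_cast at h2
      refine h2.trans (mul_le_mul_of_nonneg_right ?_ (by exact_mod_cast hE))
      rw [← hv]
      exact hmono j (hGm _) (hx.1 j) (ht j).1
    have h3 : ((∑ j : Fin n, scaledVal v E j (t j) : ℕ) : ℝ) ≤ ((b * E : ℚ) : ℝ) := by
      push_cast
      refine (Finset.sum_le_sum fun j _ => h1 j).trans ?_
      rw [← Finset.sum_mul]
      exact mul_le_mul_of_nonneg_right hx.2 (by exact_mod_cast hE)
    exact_mod_cast h3
  refine (measureReal_mono hsub ?_).trans ((measureReal_biUnion_finset_le _ _).trans ?_)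
  · exact ((Finset.finite_toSet _).isCompact_biUnion fun t _ => isCompact_Icc).measure_ne_top
  · rw [cast_exactSum]
    refine Finset.sum_le_sum fun t _ => le_of_eq ?_
    exact Real.volume_Icc_pi_toReal fun j => hle _

theorem measureReal_slab (j : Fin n) {κ : ℝ} (hκ : 0 ≤ κ) :
    volume.real (Icc (0 : Fin n → ℝ) fun i => if i = j then κ else 1) = κ := by
  have : (0 : Fin n → ℝ) ≤ fun i => if i = j then κ else 1 := fun i => by
    simp only [Pi.zero_apply]
    split_ifs <;> [exact hκ; exact zero_le_one]
  refine (Real.volume_Icc_pi_toReal this).trans ?_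
  simp

open scoped Pointwise in
-- With `r = 1 + 1 / D`, dividing a point of a counted box by `r` brings it below the lower corner,
-- provided that no coordinate is in the first cell. Rounding may have raised the sum at that corner
-- above `b`, by at most `n / E`. A second division by `r` brings it back, because convexity
-- contracts the increments over `f j 0`.
theorem exactSum_le_volume (hG : IsGrid G S N) {D : ℕ} (hn0 : 0 < n) (hn : 2 * n ≤ D)
    (hr : ∀ i ≠ 0, G (i + 1) ≤ (1 + 1 / D) * G i)
    (hmono : ∀ j, MonotoneOn (f j) (Icc 0 1)) (hconv : ∀ j, ConvexOn ℝ (Icc 0 1) (f j))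
    {v : Fin n → ℕ → ℚ} (hv : ∀ j l, f j (G l : ℝ) = (v j l : ℝ)) {M : ℕ} {b θ : ℚ}
    (hθ : VolProg.IsIncrement n S M v θ) (hb : 0 ≤ b) (hne : (truncatedCube f b).Nonempty) :
    (exactSum G S (scaledVal v (((D * D : ℕ) : ℚ) / θ)) n ⌊b * (((D * D : ℕ) : ℚ) / θ)⌋₊ : ℝ)
      ≤ (1 + 1 / (D : ℝ)) ^ (2 * n) * volume.real (truncatedCube f b) + n * (G 1 : ℝ) := by
  have hD : 0 < D := by omega
  have hD' : (0 : ℝ) < D := by exact_mod_cast hD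
  have hn' : (0 : ℝ) < n := by exact_mod_cast hn0
  have hθ0 : (0 : ℝ) < θ := by exact_mod_cast hθ.pos
  set E : ℚ := ((D * D : ℕ) : ℚ) / θ with hE
  have hE0 : 0 < E := div_pos (by exact_mod_cast Nat.mul_pos hD hD) hθ.pos
  have hE0' : (0 : ℝ) < E := by exact_mod_cast hE0
  have hEr : (E : ℝ) = (D : ℝ) * D / θ := by rw [hE]; push_cast; rfl
  set r : ℝ := (1 + 1 / (D : ℝ)) with hrdef
  have hr1 : 1 ≤ r := by rw [hrdef]; have : 0 < 1 / (D : ℝ) := by positivity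
                         linarith
  have hr0 : 0 < r := by linarith
  have hGm : ∀ i, (G i : ℝ) ∈ Icc (0 : ℝ) 1 := fun i =>
    ⟨by exact_mod_cast hG.nonneg i, by exact_mod_cast hG.le_one i⟩
  have hle : ∀ i, (G i : ℝ) ≤ G (i + 1) := fun i => by exact_mod_cast hG.mono (Nat.le_succ i)
  have h01 : (0 : ℝ) ∈ Icc (0 : ℝ) 1 := ⟨le_rfl, zero_le_one⟩
  have hf0 : ∀ j, f j 0 = (v j 0 : ℝ) := fun j => by rw [← hv, hG.zero]; simp
  -- every box lies in the dilated body or in a slab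
  have hsub : (⋃ t ∈ goodCells n S (scaledVal v E) ⌊b * E⌋₊,
      Set.pi univ fun j => Ioc (G (t j) : ℝ) (G (t j + 1) : ℝ)) ⊆
      ((r * r) • truncatedCube f b) ∪
        ⋃ j : Fin n, Icc (0 : Fin n → ℝ) fun i => if i = j then (G 1 : ℝ) else 1 := by
    intro x hx
    obtain ⟨t, ht, hxt⟩ := mem_iUnion₂.1 hx
    simp only [Set.mem_pi, mem_univ, true_imp_iff] at hxt
    have hx0 : ∀ j, 0 ≤ x j := fun j => (hGm _).1.trans (hxt j).1.le
    have hx1 : ∀ j, x j ≤ 1 := fun j => (hxt j).2.trans (hGm _).2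
    by_cases hzero : ∃ j, (t j : ℕ) = 0
    · obtain ⟨j, hj⟩ := hzero
      refine Or.inr (mem_iUnion.2 ⟨j, hx0, fun i => ?_⟩)
      by_cases hij : i = j
      · subst hij
        simpa [hj] using (hxt i).2
      · simpa [hij] using hx1 i
    · left
      push Not at hzero
      rw [Set.mem_smul_set_iff_inv_smul_mem₀ (by positivity)]
      have hsum : ∑ j, f j (G (t j)) ≤ b + n / E := by
        have h1 := (Finset.mem_filter.1 ht).2
        have h2 : ((∑ j : Fin n, scaledVal v E j (t j) : ℕ) : ℝ) ≤ b * E := by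
          have : ((∑ j : Fin n, scaledVal v E j (t j) : ℕ) : ℚ) ≤ b * E :=
            (Nat.cast_le.2 h1).trans (Nat.floor_le (mul_nonneg hb hE0.le))
          exact_mod_cast this
        have h3 : ∀ j : Fin n, f j (G (t j)) * E ≤ (scaledVal v E j (t j) : ℝ) + 1 := fun j => by
          rw [scaledVal, dif_pos j.2, hv]
          exact_mod_cast (Nat.lt_floor_add_one (v j (t j) * E)).le
        have h4 : (∑ j, f j (G (t j))) * E ≤ b * E + n := by
          rw [Finset.sum_mul]
          refine (Finset.sum_le_sum fun j _ => h3 j).trans ?_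
          rw [Finset.sum_add_distrib]
          push_cast at h2
          simpa using h2
        rw [← sub_nonneg]
        have : 0 ≤ (b * E + n - (∑ j, f j (G (t j))) * E) / E := by
          apply div_nonneg _ hE0'.le
          linarith
        convert this using 1
        field_simp
      -- This is where `E = D ^ 2 / θ` and `2 * n ≤ D` are needed.
      have hslack : (n : ℝ) / E ≤ θ / (2 * D) := by
        rw [hEr, div_div_eq_mul_div, div_le_div_iff₀ (by positivity) (by positivity)]
        have : 2 * (n : ℝ) ≤ D := by exact_mod_cast hn
        calc (n : ℝ) * θ * (2 * D) = (2 * n) * (θ * D) := by ring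
          _ ≤ D * (θ * D) := by gcongr
          _ = _ := by ring
      have hab : ∑ j, f j 0 ≤ b := by
        obtain ⟨z, hz⟩ := hne
        exact (Finset.sum_le_sum fun j _ => hmono j h01 (hz.1 j) (hz.1 j).1).trans hz.2
      have hyu : ∀ j, (r * r)⁻¹ * x j ≤ r⁻¹ * G (t j) := fun j => by
        have h1 : (G (t j + 1) : ℝ) ≤ r * G (t j) := by
          have h := (Rat.cast_le (K := ℝ)).2 (hr (t j) (hzero j))
          push_cast at h
          exact h
        have h2 : x j ≤ r * G (t j) := (hxt j).2.trans h1
        calc (r * r)⁻¹ * x j ≤ (r * r)⁻¹ * (r * G (t j)) := by gcongr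
          _ = _ := by field_simp
      have hy0 : ∀ j, 0 ≤ (r * r)⁻¹ * x j := fun j => mul_nonneg (by positivity) (hx0 j)
      have hru : ∀ j, r⁻¹ * G (t j) ∈ Icc (0 : ℝ) 1 := fun j =>
        ⟨mul_nonneg (by positivity) (hGm _).1,
          mul_le_one₀ (inv_le_one_of_one_le₀ hr1) (hGm _).1 (hGm _).2⟩
      have hyI : ∀ j, (r * r)⁻¹ * x j ∈ Icc (0 : ℝ) 1 := fun j =>
        ⟨hy0 j, (hyu j).trans (hru j).2⟩
      refine ⟨fun j => by simpa using hyI j, ?_⟩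
      simp only [Pi.smul_apply, smul_eq_mul]
      have hfy : ∀ j, f j ((r * r)⁻¹ * x j) ≤ f j (r⁻¹ * G (t j)) := fun j =>
        hmono j (hyI j) (hru j) (hyu j)
      refine (Finset.sum_le_sum fun j _ => hfy j).trans ?_
      -- If the slack at the origin is at least `θ / 2`, its `D`-th part, gained by convexity, pays
      -- for the rounding error `θ / (2 * D)`. Otherwise the increments at the corner sum to less
      -- than `θ`, so by the choice of `θ` all of them vanish.
      rcases le_or_gt ((θ : ℝ) / 2) (b - ∑ j, f j 0) with hcase | hcase
      · have hcv : ∀ j, r * f j (r⁻¹ * G (t j)) ≤ f j (G (t j)) + 1 / D * f j 0 := fun j => by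
          have h := (hconv j).2 (hGm (t j)) h01 (by positivity : 0 ≤ r⁻¹)
            (sub_nonneg.2 (inv_le_one_of_one_le₀ hr1)) (by ring : r⁻¹ + (1 - r⁻¹) = 1)
          simp only [smul_eq_mul, mul_zero, add_zero] at h
          have h2 := mul_le_mul_of_nonneg_left h hr0.le
          have h3 : r * (r⁻¹ * f j (G (t j)) + (1 - r⁻¹) * f j 0)
              = f j (G (t j)) + 1 / D * f j 0 := by
            have : r * r⁻¹ = 1 := mul_inv_cancel₀ hr0.ne'
            calc _ = (r * r⁻¹) * f j (G (t j)) + (r - r * r⁻¹) * f j 0 := by ring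
              _ = _ := by rw [this, hrdef]; ring
          linarith
        have h1 : r * ∑ j, f j (r⁻¹ * G (t j)) ≤ ∑ j, f j (G (t j)) + 1 / D * ∑ j, f j 0 := by
          rw [Finset.mul_sum, Finset.mul_sum, ← Finset.sum_add_distrib]
          exact Finset.sum_le_sum fun j _ => hcv j
        have h2 : (θ : ℝ) / (2 * D) ≤ 1 / D * (b - ∑ j, f j 0) := by
          calc (θ : ℝ) / (2 * D) = 1 / D * (θ / 2) := by field_simp
            _ ≤ _ := by gcongr
        have h3 : r * ∑ j, f j (r⁻¹ * G (t j)) ≤ r * b := by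
          calc _ ≤ b + 1 / D * (b - ∑ j, f j 0) + 1 / D * ∑ j, f j 0 := by linarith
            _ = r * b := by rw [hrdef]; ring
        exact le_of_mul_le_mul_left h3 hr0
      · have hle0 : ∀ j, f j 0 ≤ f j (G (t j)) := fun j => hmono j h01 (hGm _) (hGm _).1
        have h1 : (θ : ℝ) / (2 * D) ≤ θ / 2 := by
          have hD1 : (1 : ℝ) ≤ D := by exact_mod_cast hD
          refine div_le_div_of_nonneg_left hθ0.le (by norm_num) ?_
          linarith
        have h2 : ∑ j, (f j (G (t j)) - f j 0) < θ := by
          rw [Finset.sum_sub_distrib]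
          linarith
        have h3 : ∀ j, f j (G (t j)) = f j 0 := fun j => by
          have h4 : f j (G (t j)) - f j 0 < θ := lt_of_le_of_lt
            (Finset.single_le_sum (f := fun j => f j (G (t j)) - f j 0)
              (fun i _ => sub_nonneg.2 (hle0 i)) (Finset.mem_univ j)) h2
          by_contra hne'
          have h5 : f j 0 < f j (G (t j)) := lt_of_le_of_ne (hle0 j) (Ne.symm hne')
          rw [hf0, hv] at h4 h5
          have h6 := hθ.le_sub j (t j) (t j).2 (by exact_mod_cast h5)
          have h7 : (θ : ℝ) ≤ (v j (t j) : ℝ) - v j 0 := by exact_mod_cast h6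
          linarith
        refine (Finset.sum_le_sum fun j _ => ?_).trans hab
        rw [← h3 j]
        exact hmono j (hru j) (hGm _) (mul_le_of_le_one_left (hGm _).1 (inv_le_one_of_one_le₀ hr1))
  have hfin : volume (((r * r) • truncatedCube f b) ∪
      ⋃ j : Fin n, Icc (0 : Fin n → ℝ) fun i => if i = j then (G 1 : ℝ) else 1) ≠ ⊤ := by
    refine (measure_union_lt_top ?_ ?_).ne
    · rw [Measure.addHaar_smul]
      refine ENNReal.mul_lt_top ENNReal.ofReal_lt_top ?_
      exact lt_of_le_of_lt (measure_mono (truncatedCube_subset f b))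
        volume_cube_ne_top.lt_top
    · exact (isCompact_iUnion fun j => isCompact_Icc).measure_lt_top
  -- Half-open boxes are disjoint and have the same volumes as the closed ones used for the
  -- covering.
  have hdisj : (goodCells n S (scaledVal v E) ⌊b * E⌋₊ : Set (Fin n → Fin S)).PairwiseDisjoint
      fun t => Set.pi univ fun j => Ioc (G (t j) : ℝ) (G (t j + 1) : ℝ) := by
    intro t _ t' _ htt
    obtain ⟨j, hj⟩ := Function.ne_iff.1 htt
    refine Set.disjoint_univ_pi.2 ⟨j, ?_⟩
    have hm : Monotone fun i => (G i : ℝ) := fun i i' h => Rat.cast_le.2 (hG.mono h)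
    exact hm.pairwise_disjoint_on_Ioc_succ fun h => hj (Fin.ext h)
  have hbox : ∀ t ∈ goodCells n S (scaledVal v E) ⌊b * E⌋₊,
      volume (Set.pi univ fun j => Ioc (G (t j) : ℝ) (G (t j + 1) : ℝ)) ≠ ⊤ := fun t _ =>
    (lt_of_le_of_lt (measure_mono (Set.pi_mono fun j _ => Ioc_subset_Icc_self))
      (isCompact_univ_pi fun j => isCompact_Icc).measure_lt_top).ne
  calc (exactSum G S (scaledVal v E) n ⌊b * E⌋₊ : ℝ)
      = volume.real (⋃ t ∈ goodCells n S (scaledVal v E) ⌊b * E⌋₊,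
        Set.pi univ fun j => Ioc (G (t j) : ℝ) (G (t j + 1) : ℝ)) := by
        rw [measureReal_biUnion_finset hdisj (fun t _ => MeasurableSet.univ_pi fun j =>
          measurableSet_Ioc) hbox, cast_exactSum]
        exact Finset.sum_congr rfl fun t _ => (Real.volume_pi_Ioc_toReal fun j => hle _).symm
    _ ≤ _ := measureReal_mono hsub hfin
    _ ≤ volume.real ((r * r) • truncatedCube f b) +
        ∑ j : Fin n, volume.real (Icc (0 : Fin n → ℝ) fun i => if i = j then (G 1 : ℝ) else 1) :=
        (measureReal_union_le _ _).trans (add_le_add_right (measureReal_iUnion_fintype_le _) _)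
    _ = r ^ (2 * n) * volume.real (truncatedCube f b) + n * (G 1 : ℝ) := by
        congr 1
        · rw [measureReal_def, Measure.addHaar_smul, ENNReal.toReal_mul, Module.finrank_fin_fun,
            ENNReal.toReal_ofReal (abs_nonneg _), abs_of_nonneg (by positivity), ← pow_two,
            ← pow_mul, measureReal_def]
        · rw [Finset.sum_congr rfl fun j _ => measureReal_slab j (hGm 1).1]
          simp

end Volume

/-! ### Two-sided bounds for a round, the stopping certificate, and the resources -/

section Final

variable {n : ℕ} {f : Fin n → ℝ → ℝ} {val : Fin n → ℚ → ℚ} {b : ℚ} {M d K : ℕ} {Z : ℚ}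

/-- The exponent `3 * n` is `2 * n` for the dilation by `r ^ 2` in dimension `n`, and `n` for the
rounding of the stages. The additive terms of the slabs and of the stages are `n / 2 ^ K` each. -/
theorem VolProg.IsRoundResult.bounds (hZ : VolProg.IsRoundResult val b M d K Z) (hn0 : 0 < n)
    (hn : 24 * n ≤ 2 ^ d) (hmono : ∀ j, MonotoneOn (f j) (Icc 0 1))
    (hconv : ∀ j, ConvexOn ℝ (Icc 0 1) (f j))
    (hval : ∀ j, ∀ x ∈ Icc (0 : ℚ) 1, f j (x : ℝ) = (val j x : ℝ))
    (hval0 : ∀ j, ∀ x ∈ Icc (0 : ℚ) 1, 0 ≤ val j x) (hb : 0 ≤ b)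
    (hne : (truncatedCube f b).Nonempty) :
    volume.real (truncatedCube f b) ≤ Z ∧
      (Z : ℝ) ≤ (1 + 1 / (2 ^ d : ℝ)) ^ (3 * n) *
        (volume.real (truncatedCube f b) + 2 * n / 2 ^ K) := by
  obtain ⟨m, θ, hm, hθ, rfl⟩ := hZ
  have hP : 0 < 2 ^ K := Nat.two_pow_pos K
  have hD : 0 < 2 ^ d := Nat.two_pow_pos d
  have hG := isGrid_gridPt hP hD hm
  have hmem : ∀ l, gridPt (2 ^ K) (2 ^ d) l ∈ Icc (0 : ℚ) 1 := fun l =>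
    ⟨gridPt_nonneg hP l, gridPt_le_one l⟩
  set v : Fin n → ℕ → ℚ := fun j l => val j (gridPt (2 ^ K) (2 ^ d) l) with hvdef
  have hv : ∀ j l, f j (gridPt (2 ^ K) (2 ^ d) l : ℝ) = (v j l : ℝ) := fun j l => hval j _ (hmem l)
  have hv0 : ∀ j l, 0 ≤ v j l := fun j l => hval0 j _ (hmem l)
  have hE : (0 : ℚ) ≤ ((2 ^ d * 2 ^ d : ℕ) : ℚ) / θ := by
    have := hθ.pos
    positivity
  have hr : ∀ i ≠ 0, gridPt (2 ^ K) (2 ^ d) (i + 1)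
      ≤ (1 + 1 / ((2 ^ d : ℕ) : ℚ)) * gridPt (2 ^ K) (2 ^ d) i :=
    fun i hi => gridPt_succ_le hP hD hi
  have h1 := volume_le_exactSum hG hmono hv hv0 (b := b) hE
  have h2 := exactSum_le_volume hG hn0 (by omega) hr hmono hconv hv hθ hb hne
  have h3 := hG.exactSum_le (by positivity) hr (scaledVal v (((2 ^ d * 2 ^ d : ℕ) : ℚ) / θ)) n
    (Nat.lt_succ_self ⌊b * (((2 ^ d * 2 ^ d : ℕ) : ℚ) / θ)⌋₊)
  unfold approxValue
  generalize ((2 ^ d * 2 ^ d : ℕ) : ℚ) / θ = E at h1 h2 h3 ⊢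
  have h4 := (Rat.cast_le (K := ℝ)).2 h3.1
  have h5 := (Rat.cast_le (K := ℝ)).2 h3.2
  rw [gridPt_one hP] at h2 h5
  push_cast at h2 h4 h5
  refine ⟨h1.trans h4, ?_⟩
  set V := volume.real (truncatedCube f b) with hV
  have hV0 : 0 ≤ V := measureReal_nonneg
  set r : ℝ := 1 + 1 / (2 ^ d : ℝ) with hrdef
  have hr1 : 1 ≤ r := by
    have : 0 ≤ 1 / (2 ^ d : ℝ) := by positivity
    linarith
  have hr2 : 1 ≤ r ^ (2 * n) := one_le_pow₀ hr1
  have hn' : (0 : ℝ) ≤ n / 2 ^ K := by positivity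
  refine h5.trans ?_
  calc _ ≤ r ^ n * ((r ^ (2 * n) * V + n * (1 / 2 ^ K)) + n * (1 / 2 ^ K)) := by gcongr
    _ = r ^ n * (r ^ (2 * n) * V + 2 * n / 2 ^ K) := by ring
    _ ≤ r ^ n * (r ^ (2 * n) * V + r ^ (2 * n) * (2 * n / 2 ^ K)) := by
        have : 2 * (n : ℝ) / 2 ^ K ≤ r ^ (2 * n) * (2 * n / 2 ^ K) :=
          le_mul_of_one_le_left (by positivity) hr2
        gcongr
    _ = r ^ (3 * n) * (V + 2 * n / 2 ^ K) := by
        rw [show 3 * n = n + 2 * n by ring, pow_add]; ring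

/-- The certificate bounds the additive error by the relative one. -/
theorem le_of_certificate {V Z ε : ℝ} (hV : 0 ≤ V) (hn0 : 0 < n)
    (h1 : 24 * (n : ℝ) / 2 ^ d ≤ ε) (h2 : 24 * (n : ℝ) / 2 ^ d ≤ 1) (hVZ : V ≤ Z)
    (hZ : Z ≤ (1 + 1 / (2 ^ d : ℝ)) ^ (3 * n) * (V + 2 * n / 2 ^ K))
    (hc : 2 * (n : ℝ) * 2 ^ d ≤ Z * 2 ^ K) : Z ≤ (1 + ε) * V := by
  have hD : (0 : ℝ) < 2 ^ d := by positivity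
  have hP : (0 : ℝ) < 2 ^ K := by positivity
  have hn1 : (1 : ℝ) ≤ n := by exact_mod_cast hn0
  set e := 24 * (n : ℝ) / 2 ^ d with he
  have he0 : 0 ≤ e := by positivity
  have hpow : (1 + 1 / (2 ^ d : ℝ)) ^ (3 * n) ≤ 1 + e / 4 := by
    have h3 : (1 + 1 / (2 ^ d : ℝ)) ^ (3 * n) ≤ Real.exp (e / 8) := by
      have h4 : 1 + 1 / (2 ^ d : ℝ) ≤ Real.exp (1 / 2 ^ d) := by
        have := Real.add_one_le_exp (1 / (2 ^ d : ℝ))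
        linarith
      calc _ ≤ Real.exp (1 / 2 ^ d) ^ (3 * n) := pow_le_pow_left₀ (by positivity) h4 _
        _ = Real.exp (e / 8) := by
            rw [← Real.exp_nat_mul]
            congr 1
            rw [he]; push_cast; ring
    -- `3 * n / 2 ^ d = e / 8`, and `|exp x - 1| ≤ 2 * |x|` for `|x| ≤ 1` gives `e / 4`.
    have h5 := Real.abs_exp_sub_one_le (x := e / 8) (abs_le.2 ⟨by linarith, by linarith⟩)
    rw [abs_of_nonneg (by positivity : 0 ≤ e / 8)] at h5
    have := le_abs_self (Real.exp (e / 8) - 1)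
    linarith
  have hZ0 : 0 ≤ Z := hV.trans hVZ
  have hadd : 2 * (n : ℝ) / 2 ^ K ≤ Z * e / 24 := by
    have h3 : 2 * (n : ℝ) / 2 ^ K ≤ Z / 2 ^ d := by
      rw [div_le_div_iff₀ hP hD]; exact hc
    refine h3.trans ?_
    have h4 : Z * e / 24 = Z * n / 2 ^ d := by rw [he]; ring
    rw [h4]
    gcongr
    exact le_mul_of_one_le_right hZ0 hn1
  have h6 : Z ≤ (1 + e / 4) * (V + Z * e / 24) := hZ.trans (by gcongr)
  -- As `e ≤ 1`, the coefficient of `Z * e` is at most `(5 / 4) / 24 ≤ 1 / 16`.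
  have h7 : Z * (1 - e / 16) ≤ (1 + e / 4) * V := by
    have : (e / 4) * (Z * e / 24) ≤ (1 / 4) * (Z * e / 24) := by gcongr
    nlinarith
  have h8 : (1 + e / 4) * V ≤ ((1 + e) * V) * (1 - e / 16) := by
    have : 0 ≤ V * e * (1 - e) := mul_nonneg (mul_nonneg hV he0) (by linarith)
    nlinarith [mul_nonneg hV he0]
  have h9 : Z ≤ (1 + e) * V := le_of_mul_le_mul_right (h7.trans h8) (by linarith)
  exact h9.trans (by gcongr)

theorem encLen_gridPt_le : ∀ K d l : ℕ, encLen (gridPt (2 ^ K) (2 ^ d) l) ≤ 2 * (K + d + 1) := by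
  intro K d l
  obtain ⟨m, -, hm, -⟩ := VolProg.exists_cells (P := 2 ^ K) (Nat.two_pow_pos d) rfl
  exact ((isGrid_gridPt (Nat.two_pow_pos K) (Nat.two_pow_pos d) hm).bits
    (le_of_eq (pow_add 2 K d).symm) l).encLen_le

theorem one_le_encLen (r : ℚ) : 1 ≤ encLen r := by
  have : 0 < Nat.clog 2 (r.den + 1) := Nat.clog_pos (by norm_num) (by have := r.den_pos; omega)
  unfold encLen
  omega

/-- The number of bits of the relative accuracy. -/
theorem exists_fineness (hn : 1 ≤ n) {e : ℝ} (he : 0 < e) (he1 : e ≤ 1) :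
    ∃ d : ℕ, 24 * (n : ℝ) / 2 ^ d ≤ e ∧ (2 : ℝ) ^ d ≤ 48 * (n / e) := by
  classical
  have hex : ∃ d : ℕ, 24 * (n : ℝ) / e ≤ 2 ^ d := by
    obtain ⟨d, hd⟩ := pow_unbounded_of_one_lt (24 * (n : ℝ) / e) one_lt_two
    exact ⟨d, hd.le⟩
  have hn' : (1 : ℝ) ≤ n := by exact_mod_cast hn
  have hspec := Nat.find_spec hex
  refine ⟨Nat.find hex, ?_, ?_⟩
  · rw [div_le_iff₀ he] at hspec
    rw [div_le_iff₀ (by positivity)]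
    linarith
  · obtain ⟨k, hk⟩ : ∃ k, k = Nat.find hex := ⟨_, rfl⟩
    rw [← hk] at hspec ⊢
    cases k with
    | zero =>
      have : 1 ≤ (n : ℝ) / e := by rw [le_div_iff₀ he]; linarith
      rw [pow_zero]
      linarith
    | succ k =>
      -- By minimality the preceding power of two is too small, whence the factor `48 = 2 * 24`.
      have h1 := not_le.1 (Nat.find_min hex (m := k) (by omega))
      have h2 : 24 * (n : ℝ) / e = 24 * (n / e) := by ring
      rw [pow_succ]
      linarith

theorem fineness_le {d : ℕ} {x : ℝ} (hx : 1 ≤ x) (hd : (2 : ℝ) ^ d ≤ 48 * x) :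
    (d : ℝ) ≤ Real.logb 2 x + 6 := by
  have h : (d : ℝ) ≤ Real.logb 2 (x * 2 ^ (6 : ℝ)) := by
    rw [Real.le_logb_iff_rpow_le one_lt_two (by positivity), Real.rpow_natCast]
    norm_num
    linarith
  rwa [Real.logb_mul (by positivity) (by positivity), Real.logb_rpow (by norm_num) (by norm_num)]
    at h

/-- With `Λ = Lo + lam`, the fineness `2 ^ d` is `O(n / e)` and both bit counts are `O(Λ)`, so the
main term is of order `n ^ 3 * Λ ^ 3 * L / e ^ 2`; the fifth power of `n` is more than needed. The
constants `13`, `66` and `51` come from `d ≤ lam + 6` and `1 ≤ Lo`. -/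
theorem time_bound {n d L Lo : ℕ} {e lam : ℝ} (hn : 1 ≤ n) (hL : 1 ≤ L) (hLo : 1 ≤ Lo)
    (he : 0 < e) (he1 : e ≤ 1) (hlam : 0 ≤ lam) (hd : (d : ℝ) ≤ lam + 6)
    (hD : (2 : ℝ) ^ d ≤ 48 * (n / e)) :
    ((d * 6 + 15 + 3800 * (n * (2 ^ d) ^ 2 * (L * (2 * (2 * (Lo + 2 * d) + d + 1)))) *
      (8 * (Lo + 2 * d) ^ 2) : ℕ) : ℝ)
      ≤ 10 ^ 12 * ((n : ℝ) ^ 5 * (Lo + lam) ^ 3 * (L + Real.logb 2 n) / e ^ 2) := by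
  have hn' : (1 : ℝ) ≤ n := by exact_mod_cast hn
  have hL' : (1 : ℝ) ≤ L := by exact_mod_cast hL
  have hLo' : (1 : ℝ) ≤ Lo := by exact_mod_cast hLo
  set Λ : ℝ := Lo + lam with hΛ
  have hΛ1 : 1 ≤ Λ := by linarith
  have hdΛ : (d : ℝ) ≤ 6 * Λ := by linarith
  have hKs : (Lo : ℝ) + 2 * d ≤ 13 * Λ := by linarith
  have hM : 2 * (2 * ((Lo : ℝ) + 2 * d) + d + 1) ≤ 66 * Λ := by linarith
  set a : ℝ := (n : ℝ) ^ 3 * Λ ^ 3 * L / e ^ 2 with ha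
  have hlog : 0 ≤ Real.logb 2 n := Real.logb_nonneg one_lt_two hn'
  have haX : a ≤ (n : ℝ) ^ 5 * Λ ^ 3 * (L + Real.logb 2 n) / e ^ 2 := by
    rw [ha]
    gcongr
    · norm_num
    · linarith
  have hΛa : Λ ≤ a := by
    rw [ha, le_div_iff₀ (by positivity)]
    have h1 : e ^ 2 ≤ 1 := pow_le_one₀ he.le he1
    have h2 : (1 : ℝ) ≤ (n : ℝ) ^ 3 := one_le_pow₀ hn'
    have h3 : Λ ≤ Λ ^ 3 := le_self_pow₀ hΛ1 (by norm_num)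
    calc Λ * e ^ 2 ≤ Λ * 1 := by gcongr
      _ = 1 * Λ * 1 := by ring
      _ ≤ (n : ℝ) ^ 3 * Λ ^ 3 * L := by gcongr
  have hmain : 3800 * ((n : ℝ) * (2 ^ d) ^ 2 * (L * (2 * (2 * (Lo + 2 * d) + d + 1)))) *
      (8 * (Lo + 2 * d) ^ 2) ≤ 781244006400 * a := by
    calc _ ≤ 3800 * ((n : ℝ) * (48 * (n / e)) ^ 2 * (L * (66 * Λ))) * (8 * (13 * Λ) ^ 2) := by
          gcongr
      _ = 781244006400 * a := by rw [ha]; field_simp; ring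
  push_cast
  calc _ ≤ 51 * a + 781244006400 * a := by
        refine add_le_add ?_ hmain
        linarith
    _ ≤ 10 ^ 12 * a := by nlinarith
    _ ≤ _ := by gcongr

end Final

theorem mainTheorem3 :
    ∃ (p : RatProg) (C : ℝ), 0 < C ∧
      ∀ (n : ℕ), 1 ≤ n →
      ∀ (f : Fin n → ℝ → ℝ) (b ε : ℚ) (L Lo : ℕ),
        (∀ j, ∀ x ∈ Icc (0 : ℝ) 1, 0 ≤ f j x) →
        (∀ j, MonotoneOn (f j) (Icc 0 1)) →
        (∀ j, ConvexOn ℝ (Icc 0 1) (f j)) →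
        (∀ j, ∀ x ∈ Icc (0 : ℚ) 1, ∃ r : ℚ, f j (x : ℝ) = (r : ℝ) ∧ encLen r ≤ L * encLen x) →
        encLen b ≤ L →
        0 < ε →
        IsOutputLength (volume (truncatedCube f b)).toReal Lo →
        ∃ (s : RatState) (t B : ℕ),
          p.Exec f B (RatState.init n b ε) s t ∧
          (volume (truncatedCube f b)).toReal ≤ (s.output : ℝ) ∧
          (s.output : ℝ) ≤ (1 + (ε : ℝ)) * (volume (truncatedCube f b)).toReal ∧
          (t : ℝ) ≤ C * ((n : ℝ) ^ 5 * (Lo + Real.logb 2 (n / min (ε : ℝ) 1)) ^ 3 *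
            (L + Real.logb 2 n) / (min (ε : ℝ) 1) ^ 2) ∧
          (B : ℝ) ≤ C * (L * (Real.logb 2 (n / min (ε : ℝ) 1) + Lo)) := by
  refine ⟨VolProg.main, 10 ^ 12, by norm_num, ?_⟩
  intro n hn f b ε L Lo hf0 hmono hconv hval hbL hε ⟨hLo, hV⟩
  change 1 ≤ volume.real (truncatedCube f b) * 2 ^ Lo at hV
  change ∃ (s : RatState) (t B : ℕ), _ ∧ volume.real (truncatedCube f b) ≤ _ ∧
    _ ≤ (1 + (ε : ℝ)) * volume.real (truncatedCube f b) ∧ _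
  set V := volume.real (truncatedCube f b) with hVdef
  have hne : (truncatedCube f b).Nonempty := by
    by_contra h
    rw [Set.not_nonempty_iff_eq_empty] at h
    rw [hVdef, h] at hV
    norm_num at hV
  have hb : 0 ≤ b := by
    obtain ⟨x, hx⟩ := hne
    have : (0 : ℝ) ≤ b :=
      (Finset.sum_nonneg fun j _ => hf0 j (x j) (hx.1 j)).trans hx.2
    exact_mod_cast this
  -- Outside `[0, 1]` the rational values are arbitrary (`0`), so that `choose` yields total
  -- functions.
  have hval' : ∀ (j : Fin n) (x : ℚ), ∃ r : ℚ, x ∈ Icc (0 : ℚ) 1 →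
      f j (x : ℝ) = (r : ℝ) ∧ encLen r ≤ L * encLen x := fun j x => by
    by_cases hx : x ∈ Icc (0 : ℚ) 1
    · obtain ⟨r, hr⟩ := hval j x hx
      exact ⟨r, fun _ => hr⟩
    · exact ⟨0, fun h => absurd h hx⟩
  choose val hval'' using hval'
  have hmemR : ∀ x : ℚ, x ∈ Icc (0 : ℚ) 1 → (x : ℝ) ∈ Icc (0 : ℝ) 1 := fun x hx =>
    ⟨by exact_mod_cast hx.1, by exact_mod_cast hx.2⟩
  have hveq : ∀ j, ∀ x ∈ Icc (0 : ℚ) 1, f j (x : ℝ) = (val j x : ℝ) := fun j x hx =>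
    (hval'' j x hx).1
  have hv0 : ∀ j, ∀ x ∈ Icc (0 : ℚ) 1, 0 ≤ val j x := fun j x hx => by
    have := hf0 j x (hmemR x hx)
    rw [hveq j x hx] at this
    exact_mod_cast this
  have hvm : ∀ j, MonotoneOn (val j) (Icc 0 1) := fun j x hx y hy hxy => by
    have := hmono j (hmemR x hx) (hmemR y hy) (by exact_mod_cast hxy)
    rw [hveq j x hx, hveq j y hy] at this
    exact_mod_cast this
  have hL : 1 ≤ L := (one_le_encLen b).trans hbL
  have hε' : (0 : ℝ) < ε := by exact_mod_cast hε
  set e : ℝ := min (ε : ℝ) 1 with he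
  have he0 : 0 < e := lt_min hε' one_pos
  have he1 : e ≤ 1 := min_le_right _ _
  have hn' : (1 : ℝ) ≤ n := by exact_mod_cast hn
  have hx1 : 1 ≤ (n : ℝ) / e := by rw [le_div_iff₀ he0]; linarith
  obtain ⟨d₀, hd1, hd2⟩ := exists_fineness hn he0 he1
  have hd3 := fineness_le hx1 hd2
  have hlam := Real.logb_nonneg one_lt_two hx1
  set lam := Real.logb 2 ((n : ℝ) / e) with hlamdef
  have h24 : 24 * n ≤ 2 ^ d₀ := by
    have := (div_le_one (by positivity)).1 (hd1.trans he1)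
    exact_mod_cast this
  have hdε : 24 * (n : ℚ) / 2 ^ d₀ ≤ ε := by
    refine (Rat.cast_le (K := ℝ)).1 ?_
    push_cast
    exact hd1.trans (min_le_left _ _)
  -- Grid points have encoding length at most `2 * (K + d + 1)` with `K ≤ 2 * Ks` and `Ks = Lo + 2 *
  -- d₀`; an evaluation multiplies this by at most `L`.
  set M := L * (2 * (2 * (Lo + 2 * d₀) + d₀ + 1)) with hM
  set B := 2 * (40 * M + 1) with hB
  have hM2 : 2 * (2 * (Lo + 2 * d₀) + d₀ + 1) ≤ M := Nat.le_mul_of_pos_left _ hL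
  have hLM : L ≤ M := Nat.le_mul_of_pos_right _ (by omega)
  have hbounds : ∀ {d K : ℕ} {Z : ℚ}, 24 * n ≤ 2 ^ d → VolProg.IsRoundResult val b M d K Z → _ :=
    fun hnd hZ => hZ.bounds (f := f) hn hnd hmono hconv hveq hv0 hb hne
  obtain ⟨s, t, hexec, ht, d, K, Z, hd, hnd, hdε', hZ, hout, hcert⟩ :=
    VolProg.runs_main (f := f) (val := val) (b := b) (ε := ε) (B := B) (M := M) (Lo := Lo)
      (d₀ := d₀) (Ks := Lo + 2 * d₀) (fun d hd hnd =>
        { enc := fun r hr => hr.encLen_le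
          n_pos := hn
          n_le := hnd
          size := by omega
          Ks_ge := by omega
          val_eq := hveq
          val_bits := fun j K l hK => by
            refine RatBits.of_encLen (((hval'' j _ ⟨gridPt_nonneg (Nat.two_pow_pos K) l,
              gridPt_le_one l⟩).2.trans (Nat.mul_le_mul_left L (encLen_gridPt_le K d l))).trans ?_)
            exact Nat.mul_le_mul_left L (by omega)
          val_nonneg := hv0
          val_mono := hvm
          b_nonneg := hb
          b_bits := RatBits.of_encLen (hbL.trans hLM)
          -- No round underestimates the volume, so the output length bounds every result from
          -- below.
          low := fun K Z hZ => by
            have h1 := (hbounds hnd hZ).1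
            have h2 : (1 : ℝ) ≤ (Z : ℝ) * 2 ^ Lo := hV.trans (by gcongr)
            exact_mod_cast h2 }) hLo h24 hdε
  have hfin := hbounds hnd hZ
  refine ⟨s, t, B, hexec, ?_, ?_, ?_, ?_⟩
  · rw [hout]; exact hfin.1
  · rw [hout]
    have h24' : 24 * (n : ℝ) ≤ 2 ^ d := by exact_mod_cast hnd
    refine le_of_certificate (K := K) (d := d) measureReal_nonneg hn ?_
      ((div_le_one (by positivity)).2 h24') hfin.1 hfin.2 (by exact_mod_cast hcert)
    have := (Rat.cast_le (K := ℝ)).2 hdε'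
    push_cast at this
    exact this
  · exact (Nat.cast_le.2 ht).trans (time_bound hn hL hLo he0 he1 hlam hd3 hd2)
  · have hL' : (1 : ℝ) ≤ L := by exact_mod_cast hL
    have hLo' : (1 : ℝ) ≤ Lo := by exact_mod_cast hLo
    have h1 : 1 ≤ (L : ℝ) * (lam + Lo) := by nlinarith
    have h2 : (M : ℝ) ≤ 66 * (L * (lam + Lo)) := by
      rw [hM]
      push_cast
      calc (L : ℝ) * (2 * (2 * (Lo + 2 * d₀) + d₀ + 1)) ≤ L * (66 * (lam + Lo)) := by
            exact mul_le_mul_of_nonneg_left (by linarith) (by positivity)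
        _ = _ := by ring
    rw [hB]
    push_cast
    linarith
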